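/- Let $\mathcal U\subset\mathbb R^N$ be open and let $A:\mathcal U\to\mathbb R^{N\times N}$, $q:\mathcal U\to\mathbb R^N$ be smooth. Consider the system $$U_t+A(U)U_x=q(U). \qquad (1)$$ Assume the following. (i) (Stationary profile.) There is a smooth $\bar U:\mathbb R\to\mathcal U$ with $A(\bar U)\bar U_x=q(\bar U)$, and there are end-states $U^\pm\in\mathcal U$ such that for every $k\ge 0$ there are $c_k,\theta_k>0$ with $|\partial_x^k(\bar U-U^\pm)(x)|\le c_ke^{-\theta_k|x|}$ for $x\gtrless 0$. (ii) (Strict hyperbolicity and non-characteristicity.) There is $c>0$ such that for every $u$ in the closure of $\bar U(\mathbb R)$ the matrix $A(u)$ has $N$ distinct real eigenvalues $\lambda_1(u)<\dots<\lambda_N(u)$, and $|\lambda_j(u)|\ge c$ for $j=1,\dots,N$. (iii) (High-frequency stability.) There are $c,C_0>0$ such that, with $A^\pm=A(U^\pm)$ and $Q^\pm=dq(U^\pm)$, every eigenvalue $\mu$ of $i\xi A^\pm+Q^\pm$ satisfies $\mathrm{Re}\,\mu\le -c$ for all real $\xi$ with $|\xi|\ge C_0$. For $f:\mathbb R\to\mathbb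 R^N$ write $\|f\|_{C^K_b}=\max_{0\le j\le K}\sup_{x\in\mathbb R}|\partial_x^jf(x)|\in[0,\infty]$. Then for every integer $K\ge0$ there are constants $C,\varepsilon,\theta>0$ such that the following holds for every $T>0$, every solution $\tilde U\in C^\infty([0,T]\times\mathbb R)$ of (1) with values in $\mathcal U$, and every continuously differentiable $\delta:[0,T]\to\mathbb R$. If the shifted perturbation $U(t,x)=\tilde U(t,x+\delta(t))-\bar U(x)$ satisfies $$|\dot\delta(t)|\le\varepsilon\quad\text{and}\quad \|U(t)\|_{C^1_b}\le\varepsilon\qquad\text{for all }t\in[0,T],$$ then for all $t\in[0,T]$ $$\|U(t)\|_{C^K_b}\le Ce^{-\theta t}\|U(0)\|_{C^K_b}+C\int_0^te^{-\theta(t-s)}\big(\|U(s)\|_{C^0_b}+|\dot\delta(s)|\big)\,ds.$$ (If $\|U(0)\|_{C^K_b}=\infty$ the inequality is trivially true; if it is finite, the inequality contains the claim that $\|U(t)\|_{C^K_b}<\infty$.) -/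

import Mathlib

open Set MeasureTheory
open scoped ENNReal ContDiff Matrix

noncomputable section

/-- The state space `ℝ^N` with its Euclidean norm. -/
abbrev StateSpace (N : ℕ) : Type := EuclideanSpace ℝ (Fin N)

/-- The action `M v` of a real `N × N` matrix on `ℝ^N`. -/
def matAct {N : ℕ} (M : Matrix (Fin N) (Fin N) ℝ) (v : StateSpace N) : StateSpace N :=
  WithLp.toLp 2 (M *ᵥ WithLp.ofLp v)

/-- The Jacobian matrix `dq(u)` of the source term `q`. -/
def jacobianMatrix {N : ℕ} (q : StateSpace N → StateSpace N) (u : StateSpace N) :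
    Matrix (Fin N) (Fin N) ℝ :=
  Matrix.of fun i j => (fderiv ℝ q u (EuclideanSpace.single j 1)) i

/-- The coefficient matrix `A` and the source term `q` are smooth on the open set `𝒰`. -/
structure SmoothCoefficients {N : ℕ} (𝒰 : Set (StateSpace N))
    (A : StateSpace N → Matrix (Fin N) (Fin N) ℝ) (q : StateSpace N → StateSpace N) : Prop where
  isOpen : IsOpen 𝒰
  smooth_A : ∀ i j, ContDiffOn ℝ ∞ (fun u => A u i j) 𝒰
  smooth_q : ContDiffOn ℝ ∞ q 𝒰

/-- `Ubar` is a smooth stationary solution of `U_t + A(U) U_x = q(U)` with values in `𝒰`, which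
converges, with all its derivatives, at exponential rate to the end-states `Um ∈ 𝒰` (at `-∞`)
and `Up ∈ 𝒰` (at `+∞`). -/
structure IsProfile {N : ℕ} (𝒰 : Set (StateSpace N))
    (A : StateSpace N → Matrix (Fin N) (Fin N) ℝ) (q : StateSpace N → StateSpace N)
    (Ubar : ℝ → StateSpace N) (Um Up : StateSpace N) : Prop where
  smooth : ContDiff ℝ ∞ Ubar
  mem : ∀ x, Ubar x ∈ 𝒰
  stationary : ∀ x, matAct (A (Ubar x)) (deriv Ubar x) = q (Ubar x)
  left_mem : Um ∈ 𝒰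
  right_mem : Up ∈ 𝒰
  decay : ∀ k : ℕ, ∃ c θ : ℝ, 0 < c ∧ 0 < θ ∧
    (∀ x : ℝ, 0 < x → ‖iteratedDeriv k (fun y => Ubar y - Up) x‖ ≤ c * Real.exp (-θ * |x|)) ∧
    (∀ x : ℝ, x < 0 → ‖iteratedDeriv k (fun y => Ubar y - Um) x‖ ≤ c * Real.exp (-θ * |x|))

/-- Strict hyperbolicity and non-characteristicity along the profile: on the closure of the range
of `Ubar` the matrix `A(u)` has `N` distinct real eigenvalues, all of modulus at least `c`, where
`c > 0` does not depend on `u`. -/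
def StrictlyHyperbolicNonchar {N : ℕ} (A : StateSpace N → Matrix (Fin N) (Fin N) ℝ)
    (Ubar : ℝ → StateSpace N) : Prop :=
  ∃ c : ℝ, 0 < c ∧ ∀ u ∈ closure (range Ubar), ∃ ev : Fin N → ℝ, StrictMono ev ∧
    ∀ j, Module.End.HasEigenvalue (Matrix.toLin' (A u)) (ev j) ∧ c ≤ |ev j|

/-- High-frequency stability at the state `u`: for some `c, C > 0`, every complex eigenvalue of
`i ξ A(u) + dq(u)` with `|ξ| ≥ C` has real part at most `-c`. -/
def HighFrequencyStable {N : ℕ} (A : StateSpace N → Matrix (Fin N) (Fin N) ℝ)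
    (q : StateSpace N → StateSpace N) (u : StateSpace N) : Prop :=
  ∃ c C : ℝ, 0 < c ∧ 0 < C ∧ ∀ ξ : ℝ, C ≤ |ξ| →
    ∀ μ ∈ spectrum ℂ ((Complex.I * (ξ : ℂ)) • (A u).map (fun r : ℝ => (r : ℂ))
      + (jacobianMatrix q u).map (fun r : ℝ => (r : ℂ))), μ.re ≤ -c

/-- `V` is a smooth solution of `V_t + A(V) V_x = q(V)` on `[0,T] × ℝ` with values in `𝒰`;
at `t = 0` and `t = T` the time derivative is one-sided. -/
structure IsSmoothSolution {N : ℕ} (𝒰 : Set (StateSpace N))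
    (A : StateSpace N → Matrix (Fin N) (Fin N) ℝ) (q : StateSpace N → StateSpace N)
    (T : ℝ) (V : ℝ → ℝ → StateSpace N) : Prop where
  smooth : ContDiffOn ℝ ∞ (fun p : ℝ × ℝ => V p.1 p.2) (Icc 0 T ×ˢ univ)
  mem : ∀ t ∈ Icc 0 T, ∀ x, V t x ∈ 𝒰
  eqn : ∀ t ∈ Icc 0 T, ∀ x,
    derivWithin (fun s => V s x) (Icc 0 T) t + matAct (A (V t x)) (deriv (V t) x) = q (V t x)

/-- The norm `max_{0 ≤ j ≤ K} sup_x |∂_x^j f(x)|` with values in `[0,∞]`; it is `∞` exactly when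
one of these derivatives is unbounded. -/
def cbNorm {N : ℕ} (K : ℕ) (f : ℝ → StateSpace N) : ℝ≥0∞ :=
  ⨆ (j : ℕ) (_ : j ≤ K) (x : ℝ), ‖iteratedDeriv j f x‖ₑ

/-- The shifted perturbation `U(t,x) = V(t, x + δ(t)) - Ubar(x)`. -/
def shiftedPerturbation {N : ℕ} (V : ℝ → ℝ → StateSpace N) (Ubar : ℝ → StateSpace N)
    (δ : ℝ → ℝ) (t x : ℝ) : StateSpace N :=
  V t (x + δ t) - Ubar x

end

/-! The argument follows each characteristic family separately. Let `P_j`, `λ_j` be the spectral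
projections and eigenvalues of `A`. Since `P_j (λ_j - A) = 0`, applying `P_j` to the derivative of
the perturbation along a `j`-characteristic removes the term with one more space derivative
(`proj_dispRate`). Pointwise bounds then come from ordinary differential equations and Duhamel's
inequality, without loss of derivatives.

At order zero nothing has to be damped. The `j`-component changes at a rate bounded by `|U| + |δ'|`,
which is already in the integrand, so any exponential rate can be inserted by hand
(`exists_norm_disp_zero_le`).

At order `K ≥ 1` the right unknown is `P_j (∂^K U + B ∂^(K-1) U)`. The gauge `B` is chosen so that
the coupling to the other families cancels (`gauge_identity`). What remains is a scalar equation
with rate `tr (P_j (dq + β))`, a term with `λ_j P_j'`, and errors. Here `P_j'` is the derivative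
along the profile, and `β` comes from the differentiated nonlinearity and carries a derivative of
the profile; both vanish at infinity. At the end-states `tr (P_j dq)` is the diagonal entry of `dq`
in the eigenbasis of `A`, and high-frequency stability bounds it by a negative constant: this is
first order perturbation theory as `ξ → ∞` (`re_diag_le_of_spectrum`). Hence the growth rate is at
most `-κ/2 + M/(1+x²)`. The positive part is harmless because a non-characteristic family crosses
the profile in one direction with speed bounded below: a bounded weight, the exponential of a
multiple of `arctan`, absorbs it (`exists_weight`).

The errors are lower derivatives, `|δ'|`, and `ε` times the top order. The last point has to be
obtained from smallness in `C^1` alone. Interpolation gives scales `e ≤ ε` and `h ≥ 1` such that the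
derivative of order `a` is at most a constant times `e h^(a-1)`, with `e h^(K-1)` at most the
top-order bound (`exists_geometric_bound`). A product of two derivatives of total order `K+1` is
then of size `e² h^(K-1)`, which is `ε` times the top order (`DiffPoly.exists_estimate`). Lower
derivatives are interpolated between order zero and the top order with a small coefficient on the
top.

The top-order terms must finally be absorbed, although the top derivative is not known in advance to
be bounded on the line. The estimate is therefore run inside a backward cone of finite propagation
speed. There the derivative is bounded by compactness, and a bound that improves itself by a factor
`1/2` (`le_two_mul_of_improving`) closes the argument with constants independent of the cone. -/

open Filter Topology Asymptotics
open scoped RealInnerProductSpace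

/-! ### Absorption of constants and interpolation of derivatives -/

section GeneralAnalysis

/-- A bound that improves by a factor `1/2` up to an additive constant is bounded by twice
that constant. -/
theorem le_two_mul_of_improving {ι : Sort*} {f : ι → ℝ} {D B₀ : ℝ} (h₀ : ∀ i, f i ≤ B₀)
    (h : ∀ B, 2 * D ≤ B → (∀ i, f i ≤ B) → ∀ i, f i ≤ B / 2 + D) (i : ι) : f i ≤ 2 * D := by
  set B₁ := max B₀ (2 * D) with hB₁
  -- Each application of the improvement halves the excess of the bound over `2 * D`.
  have key : ∀ n : ℕ, ∀ i, f i ≤ (B₁ - 2 * D) / 2 ^ n + 2 * D := by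
    intro n
    induction n with
    | zero => intro i; have := h₀ i; have := le_max_left B₀ (2 * D); simp; linarith
    | succ n ih =>
      intro i
      have hn : 0 ≤ (B₁ - 2 * D) / 2 ^ n :=
        div_nonneg (by have := le_max_right B₀ (2 * D); linarith) (by positivity)
      have := h _ (by linarith) ih i
      rw [pow_succ, ← div_div]
      linarith
  have hlim : Tendsto (fun n : ℕ => (B₁ - 2 * D) / 2 ^ n + 2 * D) atTop (𝓝 (0 + 2 * D)) := by
    refine Tendsto.add ?_ tendsto_const_nhds
    exact tendsto_const_nhds.div_atTop (tendsto_pow_atTop_atTop_of_one_lt (by norm_num))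
  simpa using ge_of_tendsto' hlim (fun n => key n i)

variable {F : Type*} [NormedAddCommGroup F] [NormedSpace ℝ F]

/-- First order Taylor expansion at `y`. The remainder is estimated by applying the mean value
inequality twice on the segment, because a vector-valued function has no Lagrange remainder; `2 * a`
pays for the two values of `f`. -/
theorem norm_deriv_le_of_taylor {f f' f'' : ℝ → F} {s : Set ℝ} (hs : Convex ℝ s)
    (hf : ∀ x, HasDerivAt f (f' x) x) (hf' : ∀ x, HasDerivAt f' (f'' x) x) {a b : ℝ}
    (ha : ∀ x ∈ s, ‖f x‖ ≤ a) (hb : ∀ x ∈ s, ‖f'' x‖ ≤ b) {y z : ℝ} (hy : y ∈ s) (hz : z ∈ s) :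
    |z - y| * ‖f' y‖ ≤ 2 * a + b * |z - y| ^ 2 := by
  have hseg : segment ℝ y z ⊆ s := hs.segment_subset hy hz
  have hb0 : 0 ≤ b := (norm_nonneg _).trans (hb y hy)
  have h1 : ∀ x ∈ segment ℝ y z, ‖f' x - f' y‖ ≤ b * |z - y| := by
    intro x hx
    have := hs.norm_image_sub_le_of_norm_hasDerivWithin_le
      (fun x _ => (hf' x).hasDerivWithinAt) hb hy (hseg hx)
    refine this.trans (mul_le_mul_of_nonneg_left ?_ hb0)
    rw [segment_eq_uIcc] at hx
    rw [Real.norm_eq_abs]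
    exact abs_sub_left_of_mem_uIcc hx
  have h2 := (convex_segment y z).norm_image_sub_le_of_norm_hasDerivWithin_le
    (f := fun x => f x - (x - y) • f' y) (f' := fun x => f' x - f' y) (C := b * |z - y|)
    (fun x _ => by
      have := ((hf x).fun_sub (((hasDerivAt_id x).sub_const y).smul_const (f' y))).hasDerivWithinAt
        (s := segment ℝ y z)
      simpa using this) h1 (left_mem_segment ℝ y z) (right_mem_segment ℝ y z)
  have h3 : (z - y) • f' y = f z - f y - (f z - (z - y) • f' y - (f y - (y - y) • f' y)) := by
    simp
  have h4 : |z - y| * ‖f' y‖ = ‖(z - y) • f' y‖ := by rw [norm_smul, Real.norm_eq_abs]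
  rw [h4, h3]
  have := norm_sub_le (f z - f y) (f z - (z - y) • f' y - (f y - (y - y) • f' y))
  have := norm_sub_le (f z) (f y)
  have := ha z hz
  have := ha y hy
  rw [Real.norm_eq_abs] at h2
  nlinarith

/-- An interval of length at least one contains a point at distance `h / 2` from `y` on at least one
side, and Taylor's inequality is used with that point. -/
theorem norm_deriv_le_of_length {f f' f'' : ℝ → F} {l r : ℝ} (hlr : 1 ≤ r - l)
    (hf : ∀ x, HasDerivAt f (f' x) x) (hf' : ∀ x, HasDerivAt f' (f'' x) x) {a b h : ℝ}
    (ha : ∀ x ∈ Icc l r, ‖f x‖ ≤ a) (hb : ∀ x ∈ Icc l r, ‖f'' x‖ ≤ b) (h0 : 0 < h) (h1 : h ≤ 1)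
    {y : ℝ} (hy : y ∈ Icc l r) : h * ‖f' y‖ ≤ 4 * (a + h ^ 2 * b) := by
  have hb0 : 0 ≤ b := (norm_nonneg _).trans (hb y hy)
  obtain ⟨z, hz, hzy⟩ : ∃ z ∈ Icc l r, |z - y| = h / 2 := by
    by_cases hc : y + h / 2 ≤ r
    · exact ⟨y + h / 2, ⟨by linarith [hy.1], hc⟩, by rw [add_sub_cancel_left, abs_of_pos]; linarith⟩
    · exact ⟨y - h / 2, ⟨by linarith, by linarith [hy.2]⟩, by
        rw [sub_sub_cancel_left, abs_neg, abs_of_pos]; linarith⟩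
  have := norm_deriv_le_of_taylor (convex_Icc l r) hf hf' ha hb hy hz
  rw [hzy] at this
  nlinarith [mul_nonneg hb0 (sq_nonneg h)]

/-- Interpolation of intermediate derivatives on intervals of length at least one. -/
theorem exists_interpolation (n : ℕ) : ∃ C : ℝ, 1 ≤ C ∧ ∀ (f : ℕ → ℝ → F) (l r a b h : ℝ),
    1 ≤ r - l → (∀ k x, HasDerivAt (f k) (f (k + 1) x) x) → 0 < h → h ≤ 1 →
    (∀ x ∈ Icc l r, ‖f 0 x‖ ≤ a) → (∀ x ∈ Icc l r, ‖f n x‖ ≤ b) →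
    ∀ k ≤ n, ∀ x ∈ Icc l r, h ^ k * ‖f k x‖ ≤ C * (a + h ^ n * b) := by
  induction n with
  | zero =>
    refine ⟨1, le_rfl, fun f l r a b h _ _ _ _ ha hb k hk x hx => ?_⟩
    obtain rfl : k = 0 := by omega
    have := ha x hx
    have := (norm_nonneg _).trans (hb x hx)
    simp; linarith
  | succ n ih =>
    obtain ⟨C, hC, ih⟩ := ih
    have hC0 : 0 < C := by linarith
    rcases Nat.eq_zero_or_pos n with rfl | hn
    · refine ⟨1, le_rfl, fun f l r a b h _ _ h0 _ ha hb k hk x hx => ?_⟩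
      have h1 := ha x hx
      have h2 := hb x hx
      have h3 := (norm_nonneg _).trans h1
      have h4 := (norm_nonneg _).trans h2
      have h5 := mul_nonneg h0.le h4
      interval_cases k
      · simp; linarith
      · simp; nlinarith
    obtain ⟨m, rfl⟩ : ∃ m, n = m + 1 := ⟨n - 1, by omega⟩
    set D₁ : ℝ := 8 * C * (8 * C) ^ m + 8 with hD₁
    have hD₁1 : 1 ≤ D₁ := by
      have : 0 < 8 * C * (8 * C) ^ m := by positivity
      linarith
    refine ⟨C * (1 + D₁), by nlinarith, fun f l r a b h hlr hf h0 h1 ha hb k hk x hx => ?_⟩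
    have ha0 : 0 ≤ a := (norm_nonneg _).trans (ha x hx)
    have hb0 : 0 ≤ b := (norm_nonneg _).trans (hb x hx)
    -- Compactness supplies the qualitative bound on the derivative of order `m + 1` without which
    -- nothing could be absorbed.
    have hcont : ContinuousOn (fun y => ‖f (m + 1) y‖) (Icc l r) :=
      (continuous_iff_continuousAt.2 fun y => (hf (m + 1) y).continuousAt).norm.continuousOn
    obtain ⟨B₀, hB₀⟩ := (isCompact_Icc.image_of_continuousOn hcont).bddAbove
    -- The inductive interpolation is used at this finer scale, so that after division by `h` the
    -- unknown bound `B` returns with the factor `4 * C * g / h = 1 / 2`.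
    set g : ℝ := h / (8 * C) with hg
    have hg0 : 0 < g := by positivity
    have hgC : h = 8 * C * g := by rw [hg]; field_simp
    have hg1 : g ≤ 1 := by
      rw [hg, div_le_one (by positivity)]; linarith
    set D : ℝ := 4 * C * a / (h * g ^ m) + 4 * h * b with hD
    have hmid : ∀ y : Icc l r, ‖f (m + 1) y‖ ≤ 2 * D := by
      refine le_two_mul_of_improving (f := fun y : Icc l r => ‖f (m + 1) y‖) (B₀ := B₀)
        (fun y => hB₀ ⟨y, y.2, rfl⟩) fun B hB hfB y => ?_
      have hm : ∀ z ∈ Icc l r, ‖f m z‖ ≤ C * a / g ^ m + C * g * B := by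
        intro z hz
        have := ih f l r a B g hlr hf hg0 hg1 ha (fun z hz => hfB ⟨z, hz⟩) m (by omega) z hz
        rw [div_add' _ _ _ (by positivity), le_div_iff₀ (by positivity)]
        calc ‖f m z‖ * g ^ m = g ^ m * ‖f m z‖ := by ring
          _ ≤ _ := this
          _ = _ := by ring
      have := norm_deriv_le_of_length hlr (hf m) (hf (m + 1)) hm hb h0 h1 y.2
      have h6 : h * (B / 2 + D) = 4 * (C * a / g ^ m + C * g * B + h ^ 2 * b) := by
        rw [hD, hgC]; field_simp; ring
      exact le_of_mul_le_mul_left (this.trans h6.ge) h0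
    have hmid' : h ^ (m + 1) * (2 * D) ≤ D₁ * (a + h ^ (m + 2) * b) := by
      have h7 : h ^ (m + 1) * (2 * D) = 8 * C * (8 * C) ^ m * a + 8 * (h ^ (m + 2) * b) := by
        rw [hD, hg, div_pow]; field_simp; ring
      have h8 : 0 ≤ h ^ (m + 2) * b := by positivity
      have h9 : 0 ≤ 8 * C * (8 * C) ^ m := by positivity
      rw [h7, hD₁]; nlinarith [mul_nonneg h9 h8]
    rcases Nat.lt_or_ge (m + 1) k with hk' | hk'
    · obtain rfl : k = m + 2 := by omega
      have h8 := mul_le_mul_of_nonneg_left (hb x hx) (pow_nonneg h0.le (m + 2))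
      have h9 : 1 ≤ C * (1 + D₁) := by nlinarith
      have h10 : 0 ≤ h ^ (m + 2) * b := by positivity
      change h ^ (m + 2) * ‖f (m + 2) x‖ ≤ C * (1 + D₁) * (a + h ^ (m + 2) * b)
      nlinarith
    · have := ih f l r a (2 * D) h hlr hf h0 h1 ha (fun z hz => hmid ⟨z, hz⟩) k hk' x hx
      refine this.trans ?_
      have h10 : 0 ≤ h ^ (m + 2) * b := by positivity
      change C * (a + h ^ (m + 1) * (2 * D)) ≤ C * (1 + D₁) * (a + h ^ (m + 2) * b)
      rw [mul_assoc]
      refine mul_le_mul_of_nonneg_left ?_ hC0.le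
      nlinarith

end GeneralAnalysis

/-! ### Damped curves and exponentially weighted histories -/

section Duhamel

variable {H : Type*} [NormedAddCommGroup H] [InnerProductSpace ℝ H]

/-- Duhamel's inequality for a damped curve in an inner product space. -/
theorem exp_mul_norm_le_of_inner_deriv_le {Z Z' : ℝ → H} {f : ℝ → ℝ} {κ t : ℝ} (hκ : 0 ≤ κ)
    (ht : 0 ≤ t) (hcont : ContinuousOn Z (Icc 0 t)) (hderiv : ∀ s ∈ Ioo 0 t, HasDerivAt Z (Z' s) s)
    (hf : IntegrableOn f (Icc 0 t)) (hf0 : ∀ s ∈ Ioo 0 t, 0 ≤ f s)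
    (hZ : ∀ s ∈ Ioo 0 t, ⟪Z s, Z' s⟫ ≤ -κ * ‖Z s‖ ^ 2 + ‖Z s‖ * f s) :
    Real.exp (κ * t) * ‖Z t‖ ≤ ‖Z 0‖ + ∫ s in 0..t, Real.exp (κ * s) * f s := by
  have hexpf : IntegrableOn (fun s => Real.exp (κ * s) * f s) (Icc 0 t) :=
    hf.continuousOn_mul (by fun_prop) isCompact_Icc
  have hexp : IntegrableOn (fun s => Real.exp (κ * s)) (Icc 0 t) :=
    ContinuousOn.integrableOn_Icc (by fun_prop)
  -- The norm is not differentiable at zero, so it is replaced by `√(‖Z‖² + η²)`. This costs terms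
  -- proportional to `η`, which disappear as `η → 0`.
  have key : ∀ η : ℝ, 0 < η → Real.exp (κ * t) * ‖Z t‖ ≤ ‖Z 0‖ + η +
      ((∫ s in 0..t, Real.exp (κ * s) * f s) + κ * η * ∫ s in 0..t, Real.exp (κ * s)) := by
    intro η hη
    set ρ : ℝ → ℝ := fun s => Real.sqrt (‖Z s‖ ^ 2 + η ^ 2) with hρ
    have hpos : ∀ s, 0 < ‖Z s‖ ^ 2 + η ^ 2 := fun s => by positivity
    have hρpos : ∀ s, 0 < ρ s := fun s => Real.sqrt_pos.2 (hpos s)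
    have hρsq : ∀ s, ρ s ^ 2 = ‖Z s‖ ^ 2 + η ^ 2 := fun s => Real.sq_sqrt (hpos s).le
    have hηρ : ∀ s, η ≤ ρ s := fun s => Real.le_sqrt_of_sq_le (by nlinarith [sq_nonneg ‖Z s‖])
    have hZρ : ∀ s, ‖Z s‖ ≤ ρ s := fun s => Real.le_sqrt_of_sq_le (by nlinarith [sq_nonneg η])
    have main := intervalIntegral.sub_le_integral_of_hasDeriv_right_of_le (a := 0) (b := t)
      (g := fun s => Real.exp (κ * s) * ρ s)
      (g' := fun s => Real.exp (κ * s) * (κ * ρ s + ⟪Z s, Z' s⟫ / ρ s))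
      (φ := fun s => Real.exp (κ * s) * f s + κ * η * Real.exp (κ * s)) ht
      (by
        refine ContinuousOn.mul (by fun_prop) ?_
        exact ((hcont.norm.pow 2).add continuousOn_const).sqrt)
      (by
        intro s hs
        have h1 : HasDerivAt (fun s => Real.exp (κ * s)) (Real.exp (κ * s) * κ) s := by
          simpa using ((hasDerivAt_id s).const_mul κ).exp
        have h2 : HasDerivAt ρ (2 * ⟪Z s, Z' s⟫ / (2 * Real.sqrt (‖Z s‖ ^ 2 + η ^ 2))) s :=
          (((hderiv s hs).norm_sq).add_const (η ^ 2)).sqrt (hpos s).ne'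
        refine ((h1.mul h2).congr_deriv ?_).hasDerivWithinAt
        change _ * κ * ρ s + _ * (2 * _ / (2 * ρ s)) = _
        have := (hρpos s).ne'
        field_simp)
      (hexpf.add (hexp.const_mul _))
      (by
        intro s hs
        have h1 : ⟪Z s, Z' s⟫ / ρ s ≤ -κ * ρ s + κ * η + f s := by
          rw [div_le_iff₀ (hρpos s)]
          have h2 := hZ s hs
          have h3 := mul_le_mul_of_nonneg_right (hZρ s) (hf0 s hs)
          have h4 := mul_le_mul_of_nonneg_left (hηρ s) (mul_nonneg hκ hη.le)
          nlinarith [hρsq s]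
        have := mul_le_mul_of_nonneg_left h1 (Real.exp_pos (κ * s)).le
        nlinarith)
    rw [intervalIntegral.integral_add, intervalIntegral.integral_const_mul] at main
    · have h5 := mul_le_mul_of_nonneg_left (hZρ t) (Real.exp_pos (κ * t)).le
      have h6 : ρ 0 ≤ ‖Z 0‖ + η := by
        rw [hρ]; apply Real.sqrt_le_iff.2
        constructor
        · positivity
        · nlinarith [mul_nonneg (norm_nonneg (Z 0)) hη.le]
      simp only [mul_zero, Real.exp_zero, one_mul] at main
      linarith
    · exact (intervalIntegrable_iff_integrableOn_Icc_of_le ht).2 hexpf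
    · exact (intervalIntegrable_iff_integrableOn_Icc_of_le ht).2 (hexp.const_mul _)
  have hlim : Tendsto (fun η : ℝ => ‖Z 0‖ + η +
      ((∫ s in 0..t, Real.exp (κ * s) * f s) + κ * η * ∫ s in 0..t, Real.exp (κ * s))) (𝓝[>] 0)
      (𝓝 (‖Z 0‖ + 0 +
        ((∫ s in 0..t, Real.exp (κ * s) * f s) + κ * 0 * ∫ s in 0..t, Real.exp (κ * s)))) :=
    Tendsto.mono_left (Continuous.tendsto (by fun_prop) 0) nhdsWithin_le_nhds
  have := ge_of_tendsto hlim (by filter_upwards [self_mem_nhdsWithin] with η hη using key η hη)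
  simpa using this

/-- The exponentially weighted history `e^{-θ t} (a + ∫₀ᵗ e^{θ s} g(s) ds)`. -/
noncomputable def expHistory (θ a : ℝ) (g : ℝ → ℝ) (t : ℝ) : ℝ :=
  Real.exp (-θ * t) * (a + ∫ s in 0..t, Real.exp (θ * s) * g s)

variable {θ a T : ℝ} {g : ℝ → ℝ}

theorem expHistory_zero : expHistory θ a g 0 = a := by simp [expHistory]

theorem integrableOn_exp_mul (hg : IntegrableOn g (Icc 0 T)) (θ : ℝ) :
    IntegrableOn (fun s => Real.exp (θ * s) * g s) (Icc 0 T) :=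
  hg.continuousOn_mul (by fun_prop) isCompact_Icc

theorem intervalIntegrable_exp_mul (hg : IntegrableOn g (Icc 0 T)) (θ : ℝ) {s t : ℝ}
    (hs : 0 ≤ s) (hst : s ≤ t) (ht : t ≤ T) :
    IntervalIntegrable (fun s => Real.exp (θ * s) * g s) volume s t :=
  (intervalIntegrable_iff_integrableOn_Icc_of_le hst).2
    ((integrableOn_exp_mul hg θ).mono_set (Icc_subset_Icc hs ht))

/-- The factor `e^(θ t)` undoes the decaying prefactor and leaves `a` plus the integral of a
nonnegative function. This is how earlier histories are compared with the present one. -/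
theorem exp_mul_expHistory_mono (hg : IntegrableOn g (Icc 0 T)) (hg0 : ∀ s, 0 ≤ g s) {s t : ℝ}
    (hs : 0 ≤ s) (hst : s ≤ t) (ht : t ≤ T) :
    Real.exp (θ * s) * expHistory θ a g s ≤ Real.exp (θ * t) * expHistory θ a g t := by
  have h : ∀ r, Real.exp (θ * r) * expHistory θ a g r = a + ∫ s in 0..r, Real.exp (θ * s) * g s :=
    fun r => by
      rw [expHistory, ← mul_assoc, ← Real.exp_add]; simp
  rw [h, h, ← intervalIntegral.integral_add_adjacent_intervals
    (intervalIntegrable_exp_mul hg θ le_rfl hs (hst.trans ht))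
    (intervalIntegrable_exp_mul hg θ hs hst ht)]
  have := intervalIntegral.integral_nonneg (μ := volume) hst
    (fun u _ => mul_nonneg (Real.exp_pos (θ * u)).le (hg0 u))
  linarith

theorem le_exp_mul_expHistory (hg : IntegrableOn g (Icc 0 T)) (hg0 : ∀ s, 0 ≤ g s) {t : ℝ}
    (h0 : 0 ≤ t) (ht : t ≤ T) : a ≤ Real.exp (θ * t) * expHistory θ a g t := by
  have := exp_mul_expHistory_mono (θ := θ) (a := a) hg hg0 le_rfl h0 ht
  simpa [expHistory_zero] using this

theorem expHistory_nonneg (ha : 0 ≤ a) (hg : IntegrableOn g (Icc 0 T)) (hg0 : ∀ s, 0 ≤ g s)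
    {t : ℝ} (h0 : 0 ≤ t) (ht : t ≤ T) : 0 ≤ expHistory θ a g t := by
  have := le_exp_mul_expHistory (θ := θ) (a := a) hg hg0 h0 ht
  exact nonneg_of_mul_nonneg_right (ha.trans this) (Real.exp_pos _)

/-- A damped curve driven by `g` and by a multiple of its weighted history is controlled by that
history. -/
theorem norm_le_expHistory {Z Z' : ℝ → H} {t c₀ α c : ℝ} (hθ : 0 < θ) (ht : 0 ≤ t)
    (htT : t ≤ T) (ha : 0 ≤ a) (hg : IntegrableOn g (Icc 0 T)) (hg0 : ∀ s, 0 ≤ g s) (hα : 0 ≤ α)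
    (hc : 0 ≤ c) (hc₀ : 0 ≤ c₀)
    (hcont : ContinuousOn Z (Icc 0 t)) (hderiv : ∀ s ∈ Ioo 0 t, HasDerivAt Z (Z' s) s)
    (h0 : ‖Z 0‖ ≤ c₀ * a)
    (hZ : ∀ s ∈ Ioo 0 t, ⟪Z s, Z' s⟫ ≤ -(2 * θ) * ‖Z s‖ ^ 2 +
      ‖Z s‖ * (α * expHistory θ a g s + c * g s)) :
    ‖Z t‖ ≤ (c₀ + α / θ + c) * expHistory θ a g t := by
  have hgt : IntegrableOn g (Icc 0 t) := hg.mono_set (Icc_subset_Icc le_rfl htT)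
  have hcontH : ContinuousOn (expHistory θ a g) (Icc 0 t) := by
    refine ContinuousOn.mul (by fun_prop) (continuousOn_const.add ?_)
    have := intervalIntegral.continuousOn_primitive_interval (μ := volume) (a := 0) (b := t)
      (f := fun s => Real.exp (θ * s) * g s)
      (by rw [uIcc_of_le ht]; exact integrableOn_exp_mul hgt θ)
    rwa [uIcc_of_le ht] at this
  have hintH : IntegrableOn (expHistory θ a g) (Icc 0 t) := hcontH.integrableOn_Icc
  have hH0 : ∀ s ∈ Icc 0 t, 0 ≤ expHistory θ a g s := fun s hs =>
    expHistory_nonneg ha hg hg0 hs.1 (hs.2.trans htT)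
  have main := exp_mul_norm_le_of_inner_deriv_le (κ := 2 * θ) (by positivity) ht hcont hderiv
    (f := fun s => α * expHistory θ a g s + c * g s)
    ((hintH.const_mul _).add (hgt.const_mul _))
    (fun s hs => add_nonneg (mul_nonneg hα (hH0 s (Ioo_subset_Icc_self hs)))
      (mul_nonneg hc (hg0 s))) hZ
  set I : ℝ := Real.exp (θ * t) * expHistory θ a g t with hI
  have haI : a ≤ I := le_exp_mul_expHistory hg hg0 ht htT
  have hI0 : 0 ≤ I := ha.trans haI
  have hint1 : IntervalIntegrable (fun s => Real.exp (θ * s)) volume 0 t :=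
    (by fun_prop : Continuous fun s => Real.exp (θ * s)).intervalIntegrable _ _
  have hint2 := intervalIntegrable_exp_mul hg θ le_rfl ht htT
  have hexp1 : ∫ s in 0..t, Real.exp (θ * s) ≤ Real.exp (θ * t) / θ := by
    have : ∫ s in 0..t, Real.exp (θ * s) = Real.exp (θ * t) / θ - Real.exp (θ * 0) / θ := by
      apply intervalIntegral.integral_eq_sub_of_hasDerivAt (f := fun s => Real.exp (θ * s) / θ)
      · intro s _
        have : HasDerivAt (fun s => Real.exp (θ * s)) (Real.exp (θ * s) * θ) s := by
          simpa using ((hasDerivAt_id s).const_mul θ).exp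
        exact (this.div_const θ).congr_deriv (by field_simp)
      · exact hint1
    rw [this]
    have : 0 < Real.exp (θ * 0) / θ := by positivity
    linarith
  have hIeq : ∫ s in 0..t, Real.exp (θ * s) * g s = I - a := by
    rw [hI, expHistory, ← mul_assoc, ← Real.exp_add]; simp
  -- The damping rate `2 θ` is twice the rate of the history. One factor `e^(θ s)` turns the history
  -- into a quantity bounded by its final value `I`; the other one integrates to at most `e^(θ t) /
  -- θ`, so no factor `t` appears.
  have hbound : ∫ s in 0..t, Real.exp (2 * θ * s) * (α * expHistory θ a g s + c * g s) ≤
      ∫ s in 0..t, (α * I * Real.exp (θ * s) +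
        c * Real.exp (θ * t) * (Real.exp (θ * s) * g s)) := by
    apply intervalIntegral.integral_mono_on ht
    · exact (intervalIntegrable_iff_integrableOn_Icc_of_le ht).2
        (integrableOn_exp_mul ((hintH.const_mul _).add (hgt.const_mul _)) _)
    · exact (hint1.const_mul _).add (hint2.const_mul _)
    · intro s hs
      have e1 : Real.exp (2 * θ * s) = Real.exp (θ * s) * Real.exp (θ * s) := by
        rw [← Real.exp_add]; ring_nf
      have h1 : Real.exp (θ * s) * expHistory θ a g s ≤ I :=
        exp_mul_expHistory_mono hg hg0 hs.1 hs.2 htT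
      have h2 : Real.exp (θ * s) ≤ Real.exp (θ * t) := by gcongr; exact hs.2
      have h3 := mul_le_mul_of_nonneg_left h1 (mul_nonneg hα (Real.exp_pos (θ * s)).le)
      have h4 := mul_le_mul_of_nonneg_left h2
        (mul_nonneg hc (mul_nonneg (Real.exp_pos (θ * s)).le (hg0 s)))
      rw [e1]; nlinarith
  rw [intervalIntegral.integral_add (hint1.const_mul _) (hint2.const_mul _),
    intervalIntegral.integral_const_mul, intervalIntegral.integral_const_mul, hIeq] at hbound
  have e2 : Real.exp (2 * θ * t) = Real.exp (θ * t) * Real.exp (θ * t) := by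
    rw [← Real.exp_add]; ring_nf
  have hE : 0 < Real.exp (θ * t) := Real.exp_pos _
  have hE1 : 1 ≤ Real.exp (θ * t) := Real.one_le_exp (by positivity)
  have h5 : α * I * ∫ s in 0..t, Real.exp (θ * s) ≤ α * I * (Real.exp (θ * t) / θ) :=
    mul_le_mul_of_nonneg_left hexp1 (mul_nonneg hα hI0)
  have h6 : c * Real.exp (θ * t) * (I - a) ≤ c * Real.exp (θ * t) * I :=
    mul_le_mul_of_nonneg_left (by linarith) (by positivity)
  have h7 : c₀ * a ≤ Real.exp (θ * t) * (c₀ * I) := by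
    have := mul_le_mul_of_nonneg_left haI hc₀
    have := mul_nonneg hc₀ hI0
    nlinarith
  have h8 : Real.exp (θ * t) * (Real.exp (θ * t) * ‖Z t‖) ≤
      Real.exp (θ * t) * (Real.exp (θ * t) * ((c₀ + α / θ + c) * expHistory θ a g t)) := by
    have e3 : Real.exp (θ * t) * (Real.exp (θ * t) * ((c₀ + α / θ + c) * expHistory θ a g t)) =
        Real.exp (θ * t) * (c₀ * I) + α * I * (Real.exp (θ * t) / θ) +
          c * Real.exp (θ * t) * I := by
      rw [hI]; field_simp
    rw [e3, ← mul_assoc, ← e2]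
    linarith
  exact le_of_mul_le_mul_left (le_of_mul_le_mul_left h8 hE) hE

end Duhamel

/-! ### Spectrum of `i ξ A + Q` at high frequency -/

section HighFrequency

variable {n : Type*} [Fintype n] [DecidableEq n]

/-- A monic complex polynomial whose roots lie in a left half-plane varies slowly, in a
multiplicative sense, to the right of that half-plane. -/
theorem norm_eval_charpoly_le_of_re_spectrum_le (M : Matrix n n ℂ) {c : ℝ}
    (hM : ∀ z ∈ spectrum ℂ M, z.re ≤ -c) {d : ℂ} (hd : 0 < d.re + c) :
    ‖M.charpoly.eval (d + 1)‖ ≤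
      (1 + 1 / (d.re + c)) ^ Fintype.card n * ‖M.charpoly.eval d‖ := by
  have hsplit : M.charpoly.Splits := IsAlgClosed.splits _
  -- Every root is at distance at least `d.re + c` from `d`, so a unit step enlarges each linear
  -- factor by a bounded ratio.
  have hroot : ∀ r ∈ M.charpoly.roots, ‖d + 1 - r‖ ≤ (1 + 1 / (d.re + c)) * ‖d - r‖ := by
    intro r hr
    have hr' : r ∈ spectrum ℂ M :=
      Matrix.mem_spectrum_iff_isRoot_charpoly.2 (Polynomial.isRoot_of_mem_roots hr)
    have h1 : d.re + c ≤ ‖d - r‖ := by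
      refine le_trans ?_ (Complex.re_le_norm _)
      have := hM r hr'
      simp; linarith
    have h2 : ‖d + 1 - r‖ ≤ ‖d - r‖ + 1 := by
      rw [add_sub_right_comm]
      simpa using norm_add_le (d - r) 1
    have h3 : 1 ≤ 1 / (d.re + c) * ‖d - r‖ := by
      rw [one_div, inv_mul_eq_div, le_div_iff₀ hd]; linarith
    linarith
  have hcard : M.charpoly.roots.card = Fintype.card n := by
    rw [← hsplit.natDegree_eq_card_roots, Matrix.charpoly_natDegree_eq_dim]
  rw [hsplit.eval_eq_prod_roots_of_monic M.charpoly_monic,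
    hsplit.eval_eq_prod_roots_of_monic M.charpoly_monic, ← hcard]
  generalize M.charpoly.roots = s at hroot
  induction s using Multiset.induction_on with
  | empty => simp
  | cons r s ih =>
    have h1 := hroot r (Multiset.mem_cons_self r s)
    have h2 := ih fun q hq => hroot q (Multiset.mem_cons_of_mem hq)
    simp only [Multiset.map_cons, Multiset.prod_cons, Multiset.card_cons, norm_mul, pow_succ]
    calc _ ≤ ((1 + 1 / (d.re + c)) * ‖d - r‖) * _ := mul_le_mul h1 h2 (norm_nonneg _) (by positivity)
      _ = _ := by ring

/-- First order perturbation theory at high frequency: the real parts of the diagonal entries of `Q`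
inherit an upper bound on the spectrum of `i ξ diag(l) + Q`, as `ξ → ∞`. -/
theorem re_diag_le_of_spectrum (l : n → ℝ) (hl : Function.Injective l) (Q : Matrix n n ℂ) {c C : ℝ}
    (h : ∀ ξ : ℝ, C ≤ ξ → ∀ z ∈ spectrum ℂ
      ((Complex.I * (ξ : ℂ)) • Matrix.diagonal (fun k => (l k : ℂ)) + Q), z.re ≤ -c) (j : n) :
    (Q j j).re ≤ -c := by
  by_contra hcon
  set d : ℂ := Q j j with hd
  have hρ : 0 < d.re + c := by push Not at hcon; linarith
  -- This is the characteristic matrix after the imaginary shift `i ξ l_j`, with every column except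
  -- the `j`-th divided by `ξ`. In terms of `τ = 1/ξ` it extends continuously to `τ = 0`.
  set G : ℂ → ℝ → Matrix n n ℂ := fun w τ => Matrix.of fun i k =>
    if k = j then (if i = k then w else 0) - Q i k
    else (τ : ℂ) * ((if i = k then w else 0) - Q i k) -
      (if i = k then Complex.I * ((l k : ℂ) - l j) else 0) with hG
  have hGdet : ∀ w : ℂ, ∀ ξ : ℝ, 0 < ξ → (G w ξ⁻¹).det =
      (((Complex.I * (ξ : ℂ)) • Matrix.diagonal (fun k => (l k : ℂ)) + Q -
        (Complex.I * ξ * l j) • (1 : Matrix n n ℂ)).charpoly.eval w) *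
        (Matrix.diagonal fun k => if k = j then (1 : ℂ) else (ξ : ℂ)⁻¹).det := by
    intro w ξ hξ
    rw [Matrix.eval_charpoly, ← Matrix.det_mul]
    congr 1
    have hξ' : (ξ : ℂ) ≠ 0 := by exact_mod_cast hξ.ne'
    ext i k
    simp only [hG, Matrix.of_apply, Matrix.mul_diagonal, Matrix.sub_apply, Matrix.scalar_apply,
      Matrix.add_apply, Matrix.smul_apply, Matrix.one_apply, Matrix.diagonal_apply, smul_eq_mul]
    by_cases hkj : k = j
    · subst hkj
      by_cases hik : i = k
      · subst hik; simp
      · simp [hik]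
    · by_cases hik : i = k
      · subst hik; simp [hkj]; field_simp; ring
      · simp [hkj, hik]; ring
  have hGle : ∀ ξ : ℝ, max C 1 ≤ ξ → ‖(G (d + 1) ξ⁻¹).det‖ ≤
      (1 + 1 / (d.re + c)) ^ Fintype.card n * ‖(G d ξ⁻¹).det‖ := by
    intro ξ hξ
    have hξ0 : 0 < ξ := by linarith [le_max_right C 1]
    rw [hGdet _ _ hξ0, hGdet _ _ hξ0, norm_mul, norm_mul, ← mul_assoc]
    refine mul_le_mul_of_nonneg_right ?_ (norm_nonneg _)
    refine norm_eval_charpoly_le_of_re_spectrum_le _ (fun z hz => ?_) hρ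
    have hz' : z + Complex.I * ξ * l j ∈ spectrum ℂ
        ((Complex.I * (ξ : ℂ)) • Matrix.diagonal (fun k => (l k : ℂ)) + Q) := by
      rw [← Algebra.algebraMap_eq_smul_one] at hz
      have := spectrum.add_mem_iff (R := ℂ) (r := z) (s := Complex.I * ξ * l j)
        (a := (Complex.I * (ξ : ℂ)) • Matrix.diagonal (fun k => (l k : ℂ)) + Q)
      rw [this, ← sub_eq_neg_add]
      exact hz
    have := h ξ ((le_max_left _ _).trans hξ) _ hz'
    simpa using this
  have hcont : ∀ w, Continuous fun τ : ℝ => (G w τ).det := by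
    intro w
    refine Continuous.matrix_det (continuous_matrix fun i k => ?_)
    simp only [hG, Matrix.of_apply]
    by_cases hkj : k = j
    · simp only [hkj, if_true]; fun_prop
    · simp only [hkj, if_false]; fun_prop
  have hlim : ‖(G (d + 1) 0).det‖ ≤ (1 + 1 / (d.re + c)) ^ Fintype.card n * ‖(G d 0).det‖ := by
    have h0 : Tendsto (fun ξ : ℝ => ξ⁻¹) atTop (𝓝 0) := tendsto_inv_atTop_zero
    exact le_of_tendsto_of_tendsto (((hcont (d + 1)).norm.tendsto 0).comp h0)
      ((((hcont d).norm.tendsto 0).const_mul _).comp h0)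
      (by filter_upwards [eventually_ge_atTop (max C 1)] with ξ hξ using hGle ξ hξ)
  -- At `τ = 0` only the `j`-th column is not diagonal, so the determinant is `w - Q_jj` times a
  -- product of eigenvalue gaps.
  have hG0 : ∀ w, (G w 0).det = (w - d) *
      (Matrix.diagonal fun k => if k = j then (1 : ℂ) else -(Complex.I * ((l k : ℂ) - l j))).det := by
    intro w
    have h1 : (w - d) = ((1 : Matrix n n ℂ).updateCol j fun i => (if i = j then w else 0) - Q i j).det := by
      rw [← Matrix.cramer_apply, Matrix.cramer_one]; simp [hd]
    rw [h1, ← Matrix.det_mul]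
    congr 1
    ext i k
    simp only [hG, Matrix.of_apply, Matrix.mul_diagonal, Matrix.updateCol_apply, Matrix.one_apply]
    by_cases hkj : k = j
    · simp [hkj]
    · by_cases hik : i = k <;> simp [hkj, hik]
  -- The limiting inequality bounds the value at `d + 1` by a multiple of the value at `d`, which is
  -- zero. The gaps would then have a vanishing product, contrary to injectivity of `l`.
  rw [hG0, hG0, sub_self, zero_mul, norm_zero, mul_zero, add_sub_cancel_left, one_mul,
    norm_le_zero_iff, Matrix.det_diagonal, Finset.prod_eq_zero_iff] at hlim
  obtain ⟨k, -, hk⟩ := hlim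
  by_cases hkj : k = j
  · simp [hkj] at hk
  · rw [if_neg hkj, neg_eq_zero, mul_eq_zero, sub_eq_zero] at hk
    rcases hk with hk | hk
    · exact Complex.I_ne_zero hk
    · exact hkj (hl (by exact_mod_cast hk))

end HighFrequency

/-! ### Smooth dependence of eigenvalues and spectral projections -/

section Spectral

variable {N : ℕ}

/-- The tuple `ev` lists, in increasing order, `N` distinct real eigenvalues of `M`. -/
structure IsSpectralTuple (M : Matrix (Fin N) (Fin N) ℝ) (ev : Fin N → ℝ) : Prop where
  strictMono : StrictMono ev
  isRoot : ∀ j, M.charpoly.IsRoot (ev j)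

theorem isSpectralTuple_of_hasEigenvalue {M : Matrix (Fin N) (Fin N) ℝ} {ev : Fin N → ℝ}
    (hev : StrictMono ev) (h : ∀ j, Module.End.HasEigenvalue (Matrix.toLin' M) (ev j)) :
    IsSpectralTuple M ev :=
  ⟨hev, fun j => by
    have := (Module.End.hasEigenvalue_iff_isRoot_charpoly _ _).1 (h j)
    rwa [Matrix.charpoly_toLin'] at this⟩

theorem IsSpectralTuple.charpoly_eq {M : Matrix (Fin N) (Fin N) ℝ} {ev : Fin N → ℝ}
    (h : IsSpectralTuple M ev) : M.charpoly = ∏ j, (Polynomial.X - Polynomial.C (ev j)) := by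
  have hmonic : (∏ j, (Polynomial.X - Polynomial.C (ev j))).Monic :=
    Polynomial.monic_prod_of_monic _ _ fun j _ => Polynomial.monic_X_sub_C _
  refine (Polynomial.eq_of_monic_of_dvd_of_natDegree_le hmonic M.charpoly_monic ?_ ?_)
  · refine Finset.prod_dvd_of_coprime (fun i _ j _ hij => ?_) fun j _ =>
      Polynomial.dvd_iff_isRoot.2 (h.isRoot j)
    exact Polynomial.pairwise_coprime_X_sub_C h.strictMono.injective hij
  · rw [M.charpoly_natDegree_eq_dim, Polynomial.natDegree_prod_of_monic _ _
      fun j _ => Polynomial.monic_X_sub_C _]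
    simp

theorem IsSpectralTuple.isRoot_iff {M : Matrix (Fin N) (Fin N) ℝ} {ev : Fin N → ℝ}
    (h : IsSpectralTuple M ev) (z : ℝ) : M.charpoly.IsRoot z ↔ z ∈ range ev := by
  rw [h.charpoly_eq, Polynomial.IsRoot, Polynomial.eval_prod, Finset.prod_eq_zero_iff]
  simp [sub_eq_zero, eq_comm]

theorem IsSpectralTuple.unique {M : Matrix (Fin N) (Fin N) ℝ} {ev ev' : Fin N → ℝ}
    (h : IsSpectralTuple M ev) (h' : IsSpectralTuple M ev') : ev = ev' :=
  (StrictMono.range_inj h.strictMono h'.strictMono).1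
    (by ext z; rw [← h.isRoot_iff, ← h'.isRoot_iff])

/-- In the differentiated product only the summand that omits the factor of `ev j` survives at `ev
j`. This is the nondegeneracy needed for the implicit function theorem. -/
theorem IsSpectralTuple.derivative_ne_zero {M : Matrix (Fin N) (Fin N) ℝ} {ev : Fin N → ℝ}
    (h : IsSpectralTuple M ev) (j : Fin N) :
    (Polynomial.derivative M.charpoly).eval (ev j) ≠ 0 := by
  rw [h.charpoly_eq, Polynomial.derivative_prod_finset, Polynomial.eval_finsetSum,
    Finset.sum_eq_single j]
  · simp only [Polynomial.derivative_sub, Polynomial.derivative_X, Polynomial.derivative_C,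
      sub_zero, mul_one, Polynomial.eval_prod, Polynomial.eval_sub, Polynomial.eval_X,
      Polynomial.eval_C]
    refine Finset.prod_ne_zero_iff.2 fun k hk => sub_ne_zero.2 fun hjk => ?_
    exact (Finset.ne_of_mem_erase hk) (h.strictMono.injective hjk).symm
  · intro k _ hkj
    rw [Polynomial.eval_mul, Polynomial.eval_prod]
    rw [Finset.prod_eq_zero (i := j) (Finset.mem_erase.2 ⟨hkj.symm, Finset.mem_univ _⟩) (by simp),
      zero_mul]
  · simp

variable {𝒰 : Set (StateSpace N)} {A : StateSpace N → Matrix (Fin N) (Fin N) ℝ}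

theorem contDiffAt_charpoly_eval {u₀ : StateSpace N}
    (hA : ∀ i j, ContDiffAt ℝ ∞ (fun u => A u i j) u₀) (z₀ : ℝ) :
    ContDiffAt ℝ ∞ (fun p : StateSpace N × ℝ => (A p.1).charpoly.eval p.2) (u₀, z₀) := by
  have h : (fun p : StateSpace N × ℝ => (A p.1).charpoly.eval p.2) = fun p =>
      ∑ σ : Equiv.Perm (Fin N), ((Equiv.Perm.sign σ : ℤ) : ℝ) *
        ∏ i, ((if σ i = i then p.2 else 0) - A p.1 (σ i) i) := by
    ext p
    rw [Matrix.eval_charpoly, Matrix.det_apply']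
    simp [Matrix.sub_apply, Matrix.scalar_apply, Matrix.diagonal_apply]
  rw [h]
  refine ContDiffAt.sum fun σ _ => contDiffAt_const.mul (contDiffAt_prod fun i _ => ?_)
  refine ContDiffAt.sub ?_ ((hA (σ i) i).comp (u₀, z₀) contDiffAt_fst)
  split_ifs
  · exact contDiffAt_snd
  · exact contDiffAt_const

/-- Simple eigenvalues depend smoothly on the matrix. -/
theorem exists_local_eigenvalues {u₀ : StateSpace N}
    (hA : ∀ i j, ContDiffAt ℝ ∞ (fun u => A u i j) u₀) {ev : Fin N → ℝ}
    (hev : IsSpectralTuple (A u₀) ev) :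
    ∃ μ : StateSpace N → Fin N → ℝ, (∀ j, ContDiffAt ℝ ∞ (fun u => μ u j) u₀) ∧
      ∀ᶠ u in 𝓝 u₀, IsSpectralTuple (A u) (μ u) := by
  have hroot : ∀ j, ∃ m : StateSpace N → ℝ, ContDiffAt ℝ ∞ m u₀ ∧ m u₀ = ev j ∧
      ∀ᶠ u in 𝓝 u₀, (A u).charpoly.IsRoot (m u) := by
    intro j
    set f : StateSpace N × ℝ → ℝ := fun p => (A p.1).charpoly.eval p.2 with hf
    have cdf : ContDiffAt ℝ ∞ f (u₀, ev j) := contDiffAt_charpoly_eval hA (ev j)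
    set D := (Polynomial.derivative (A u₀).charpoly).eval (ev j) with hD
    have hD0 : D ≠ 0 := hev.derivative_ne_zero j
    have hinv : (fderiv ℝ f (u₀, ev j) ∘L .inr ℝ (StateSpace N) ℝ).IsInvertible := by
      refine ⟨ContinuousLinearEquiv.unitsEquivAut ℝ (Units.mk0 D hD0), ?_⟩
      ext
      have h1 : HasFDerivAt f (fderiv ℝ f (u₀, ev j)) (u₀, ev j) :=
        (cdf.differentiableAt (by simp)).hasFDerivAt
      have h2 : HasFDerivAt (fun z : ℝ => f (u₀, z))
          (fderiv ℝ f (u₀, ev j) ∘L .inr ℝ (StateSpace N) ℝ) (ev j) :=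
        HasFDerivAt.comp (f := fun z : ℝ => (u₀, z)) (ev j) h1 (hasFDerivAt_prodMk_right u₀ (ev j))
      have h3 : HasDerivAt (fun z : ℝ => f (u₀, z)) D (ev j) :=
        (A u₀).charpoly.hasDerivAt (ev j)
      have := h2.hasDerivAt.unique h3
      simpa using this.symm
    refine ⟨cdf.implicitFunction (by simp) hinv, cdf.contDiffAt_implicitFunction (by simp) hinv,
      cdf.implicitFunction_apply_self (by simp) hinv, ?_⟩
    filter_upwards [cdf.eventually_apply_implicitFunction (by simp) hinv] with u hu
    have h0 : f (u₀, ev j) = 0 := hev.isRoot j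
    rw [h0] at hu
    exact hu
  choose m hm hm0 hmroot using hroot
  refine ⟨fun u j => m j u, hm, ?_⟩
  -- The local root branches keep their order by continuity, so together they exhaust the spectrum.
  have hmono : ∀ᶠ u in 𝓝 u₀, ∀ i j, i < j → m i u < m j u := by
    refine eventually_all.2 fun i => eventually_all.2 fun j => ?_
    by_cases hij : i < j
    · have := (hm i).continuousAt.eventually_lt (hm j).continuousAt
        (by rw [hm0, hm0]; exact hev.strictMono hij)
      filter_upwards [this] with u hu _ using hu
    · exact Eventually.of_forall fun u h => absurd h hij
  filter_upwards [hmono, eventually_all.2 hmroot] with u h1 h2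
  exact ⟨fun i j hij => h1 i j hij, h2⟩

/-- The states at which the coefficient matrix has `N` distinct real eigenvalues. -/
def hyperbolicSet (𝒰 : Set (StateSpace N)) (A : StateSpace N → Matrix (Fin N) (Fin N) ℝ) :
    Set (StateSpace N) :=
  {u ∈ 𝒰 | ∃ ev, IsSpectralTuple (A u) ev}

open Classical in
/-- The increasing list of eigenvalues of `A u`, when there are `N` distinct ones. -/
noncomputable def eigenvalueTuple (A : StateSpace N → Matrix (Fin N) (Fin N) ℝ)
    (u : StateSpace N) : Fin N → ℝ :=
  if h : ∃ ev, IsSpectralTuple (A u) ev then h.choose else 0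

theorem isSpectralTuple_eigenvalueTuple {u : StateSpace N} (hu : u ∈ hyperbolicSet 𝒰 A) :
    IsSpectralTuple (A u) (eigenvalueTuple A u) := by
  rw [eigenvalueTuple, dif_pos hu.2]
  exact hu.2.choose_spec

theorem isOpen_hyperbolicSet (h𝒰 : IsOpen 𝒰)
    (hA : ∀ i j, ContDiffOn ℝ ∞ (fun u => A u i j) 𝒰) : IsOpen (hyperbolicSet 𝒰 A) := by
  rw [isOpen_iff_mem_nhds]
  rintro u ⟨hu, ev, hev⟩
  obtain ⟨μ, -, hμ⟩ := exists_local_eigenvalues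
    (fun i j => (hA i j).contDiffAt (h𝒰.mem_nhds hu)) hev
  filter_upwards [hμ, h𝒰.mem_nhds hu] with v hv hv' using ⟨hv', μ v, hv⟩

/-- The increasing list of eigenvalues is unique. The globally chosen list therefore agrees near
each point with the smooth local branches, whatever choice was made in its definition. -/
theorem contDiffOn_eigenvalueTuple (h𝒰 : IsOpen 𝒰)
    (hA : ∀ i j, ContDiffOn ℝ ∞ (fun u => A u i j) 𝒰) (j : Fin N) :
    ContDiffOn ℝ ∞ (fun u => eigenvalueTuple A u j) (hyperbolicSet 𝒰 A) := by
  rintro u ⟨hu, ev, hev⟩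
  obtain ⟨μ, hsmooth, hμ⟩ := exists_local_eigenvalues
    (fun i j => (hA i j).contDiffAt (h𝒰.mem_nhds hu)) hev
  refine ((hsmooth j).congr_of_eventuallyEq ?_).contDiffWithinAt
  filter_upwards [hμ, h𝒰.mem_nhds hu] with v hv hv'
  rw [(isSpectralTuple_eigenvalueTuple (𝒰 := 𝒰) ⟨hv', μ v, hv⟩).unique hv]

/-- The coefficient matrix as an operator on the state space. -/
noncomputable def coeffOp (A : StateSpace N → Matrix (Fin N) (Fin N) ℝ) (u : StateSpace N) :
    StateSpace N →L[ℝ] StateSpace N :=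
  Matrix.toEuclideanCLM (n := Fin N) (𝕜 := ℝ) (A u)

theorem coeffOp_apply (u v : StateSpace N) : coeffOp A u v = matAct (A u) v := rfl

theorem contDiffOn_coeffOp (hA : ∀ i j, ContDiffOn ℝ ∞ (fun u => A u i j) 𝒰) :
    ContDiffOn ℝ ∞ (coeffOp A) 𝒰 := by
  let Φ : (Fin N → Fin N → ℝ) →ₗ[ℝ] (StateSpace N →L[ℝ] StateSpace N) :=
    { toFun := fun M => Matrix.toEuclideanCLM (n := Fin N) (𝕜 := ℝ) (Matrix.of M)
      map_add' := fun M M' => map_add (Matrix.toEuclideanCLM (n := Fin N) (𝕜 := ℝ)) _ _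
      map_smul' := fun r M => map_smul (Matrix.toEuclideanCLM (n := Fin N) (𝕜 := ℝ)) r _ }
  have h : ContDiffOn ℝ ∞ (fun u => fun i j => A u i j) 𝒰 :=
    contDiffOn_pi.2 fun i => contDiffOn_pi.2 fun j => hA i j
  exact Φ.toContinuousLinearMap.contDiff.comp_contDiffOn h

/-- The `j`-th spectral projection, by Lagrange's formula. -/
noncomputable def spectralProj (A : StateSpace N → Matrix (Fin N) (Fin N) ℝ) (j : Fin N)
    (u : StateSpace N) : StateSpace N →L[ℝ] StateSpace N :=
  (((List.finRange N).filter (· ≠ j)).map fun k =>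
    (eigenvalueTuple A u j - eigenvalueTuple A u k)⁻¹ •
      (coeffOp A u - eigenvalueTuple A u k • (1 : StateSpace N →L[ℝ] StateSpace N))).prod

theorem contDiffOn_spectralProj (h𝒰 : IsOpen 𝒰)
    (hA : ∀ i j, ContDiffOn ℝ ∞ (fun u => A u i j) 𝒰) (j : Fin N) :
    ContDiffOn ℝ ∞ (spectralProj A j) (hyperbolicSet 𝒰 A) := by
  have hlam := contDiffOn_eigenvalueTuple h𝒰 hA
  have hop : ContDiffOn ℝ ∞ (coeffOp A) (hyperbolicSet 𝒰 A) :=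
    (contDiffOn_coeffOp hA).mono fun u hu => hu.1
  unfold spectralProj
  have hl : ∀ k ∈ (List.finRange N).filter (· ≠ j), k ≠ j := by simp
  generalize (List.finRange N).filter (· ≠ j) = l at hl
  induction l with
  | nil => simpa using contDiffOn_const
  | cons k l ih =>
    simp only [List.map_cons, List.prod_cons]
    refine ContDiffOn.mul (ContDiffOn.smul (ContDiffOn.inv ((hlam j).sub (hlam k)) ?_) ?_)
      (ih fun i hi => hl i (List.mem_cons_of_mem _ hi))
    · intro u hu h
      exact hl k List.mem_cons_self
        ((isSpectralTuple_eigenvalueTuple hu).strictMono.injective (sub_eq_zero.1 h)).symm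
    · exact hop.sub ((hlam k).smul contDiffOn_const)

theorem IsSpectralTuple.exists_basis {M : Matrix (Fin N) (Fin N) ℝ} {ev : Fin N → ℝ}
    (h : IsSpectralTuple M ev) : ∃ b : Module.Basis (Fin N) ℝ (StateSpace N),
      ∀ j, Matrix.toEuclideanCLM (n := Fin N) (𝕜 := ℝ) M (b j) = ev j • b j := by
  have hvec : ∀ j, ∃ v, Module.End.HasEigenvector (Matrix.toLin' M) (ev j) v := fun j =>
    ((Module.End.hasEigenvalue_iff_isRoot_charpoly _ _).2
      (by rw [Matrix.charpoly_toLin']; exact h.isRoot j)).exists_hasEigenvector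
  choose v hv using hvec
  have hli : LinearIndependent ℝ v :=
    Module.End.eigenvectors_linearIndependent' (Matrix.toLin' M) ev h.strictMono.injective v hv
  let e := (WithLp.linearEquiv 2 ℝ (Fin N → ℝ)).symm
  have hli' : LinearIndependent ℝ (fun j => e (v j)) :=
    hli.map' (e : (Fin N → ℝ) →ₗ[ℝ] StateSpace N) e.ker
  refine ⟨basisOfLinearIndependentOfCardEqFinrank' _ hli' (by simp), fun j => ?_⟩
  rw [coe_basisOfLinearIndependentOfCardEqFinrank']
  have h1 := (hv j).apply_eq_smul
  rw [Matrix.toLin'_apply] at h1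
  change Matrix.toEuclideanCLM (n := Fin N) (𝕜 := ℝ) M (WithLp.toLp 2 (v j)) = _
  rw [Matrix.toEuclideanCLM_toLp, h1]
  rfl

end Spectral

/-! ### Rank one resolutions and the trace form of the damping rate -/

section SpectralFrame

variable {N : ℕ}

/-- The trace of an operator on the state space, as a continuous linear functional. -/
noncomputable def traceCLM (N : ℕ) : (StateSpace N →L[ℝ] StateSpace N) →L[ℝ] ℝ :=
  LinearMap.toContinuousLinearMap
    ((LinearMap.trace ℝ (StateSpace N)).comp (ContinuousLinearMap.coeLM ℝ))

theorem traceCLM_apply (X : StateSpace N →L[ℝ] StateSpace N) :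
    traceCLM N X = LinearMap.trace ℝ (StateSpace N) (X : StateSpace N →ₗ[ℝ] StateSpace N) := rfl

/-- Rank one spectral resolution of an operator; `tr` is the trace functional. -/
structure IsSpectralFrame {E ι : Type*} [NormedAddCommGroup E] [NormedSpace ℝ E] [Fintype ι]
    (tr : (E →L[ℝ] E) →L[ℝ] ℝ) (M : E →L[ℝ] E) (l : ι → ℝ) (P : ι → E →L[ℝ] E) : Prop where
  injective : Function.Injective l
  idem : ∀ j, P j * P j = P j
  orth : ∀ j k, j ≠ k → P j * P k = 0
  sum_eq_one : ∑ j, P j = 1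
  mul_proj : ∀ j, M * P j = l j • P j
  proj_mul : ∀ j, P j * M = l j • P j
  rank_one : ∀ j X, P j * X * P j = tr (P j * X) • P j

/-- The range of `P` is spanned by `b j`, so `P * X` has a single nonzero diagonal entry. The trace
thus expresses that entry without choosing eigenvectors, and depends smoothly on the projection. -/
theorem traceCLM_of_rank_one {b : Module.Basis (Fin N) ℝ (StateSpace N)}
    {P : StateSpace N →L[ℝ] StateSpace N} {j : Fin N} (hP : ∀ v, P v = b.repr v j • b j)
    (X : StateSpace N →L[ℝ] StateSpace N) : traceCLM N (P * X) = b.repr (X (b j)) j := by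
  rw [traceCLM_apply, LinearMap.trace_eq_matrix_trace ℝ b, Matrix.trace]
  simp only [Matrix.diag_apply, LinearMap.toMatrix_apply]
  rw [Finset.sum_eq_single j]
  · change b.repr (P (X (b j))) j = _
    rw [hP]; simp
  · intro i _ hij
    change b.repr (P (X (b i))) i = 0
    rw [hP]; simp [hij.symm]
  · simp

theorem isSpectralFrame_of_basis {b : Module.Basis (Fin N) ℝ (StateSpace N)}
    {M : StateSpace N →L[ℝ] StateSpace N} {l : Fin N → ℝ} (hl : Function.Injective l)
    {P : Fin N → StateSpace N →L[ℝ] StateSpace N} (hM : ∀ j, M (b j) = l j • b j)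
    (hP : ∀ j v, P j v = b.repr v j • b j) : IsSpectralFrame (traceCLM N) M l P where
  injective := hl
  idem j := by ext1 v; simp [hP]
  orth j k hjk := by ext1 v; simp [hP, hjk.symm]
  sum_eq_one := by
    ext1 v
    simp only [sum_apply, hP, one_apply_eq_self]
    exact b.sum_repr v
  mul_proj j := by ext1 v; simp [hP, hM, smul_smul, mul_comm]
  proj_mul j := by
    have h : ((P j * M : StateSpace N →L[ℝ] StateSpace N) : StateSpace N →ₗ[ℝ] StateSpace N) =
        ((l j • P j : StateSpace N →L[ℝ] StateSpace N) : StateSpace N →ₗ[ℝ] StateSpace N) := by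
      refine b.ext fun k => ?_
      by_cases hjk : k = j
      · subst hjk; simp [hP, hM]
      · simp [hP, hM, hjk]
    exact ContinuousLinearMap.coe_injective h
  rank_one j X := by
    ext1 v
    rw [traceCLM_of_rank_one (hP j)]
    simp [hP, smul_smul, mul_comm]

variable {𝒰 : Set (StateSpace N)} {A : StateSpace N → Matrix (Fin N) (Fin N) ℝ}

/-- On the eigenvector `b i` the Lagrange product acts by the scalar `∏ (l i - l k) / (l j - l k)`
over `k ≠ j`. It equals one for `i = j`, and otherwise contains the vanishing factor `k = i`. -/
theorem exists_eigenbasis {u : StateSpace N} (hu : u ∈ hyperbolicSet 𝒰 A) :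
    ∃ b : Module.Basis (Fin N) ℝ (StateSpace N),
      (∀ j, coeffOp A u (b j) = eigenvalueTuple A u j • b j) ∧
      ∀ j v, spectralProj A j u v = b.repr v j • b j := by
  obtain ⟨b, hb⟩ := (isSpectralTuple_eigenvalueTuple hu).exists_basis
  refine ⟨b, hb, fun j => ?_⟩
  have hinj := (isSpectralTuple_eigenvalueTuple hu).strictMono.injective
  set l := eigenvalueTuple A u with hl
  have hprod : ∀ (L : List (Fin N)) (i : Fin N), (L.map fun k => (l j - l k)⁻¹ •
      (coeffOp A u - l k • (1 : StateSpace N →L[ℝ] StateSpace N))).prod (b i) =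
      (L.map fun k => (l j - l k)⁻¹ * (l i - l k)).prod • b i := by
    intro L i
    induction L with
    | nil => simp
    | cons k L ih =>
      have h1 : coeffOp A u (b i) = l i • b i := hb i
      simp only [List.map_cons, List.prod_cons, mul_apply_eq_comp, ih, map_smul,
        smul_apply, sub_apply,
        one_apply_eq_self, h1, ← sub_smul, smul_smul]
      congr 1; ring
  have hbi : ∀ i, spectralProj A j u (b i) = if i = j then b j else 0 := by
    intro i
    rw [spectralProj, hprod]
    split_ifs with hij
    · subst hij
      rw [List.prod_eq_one, one_smul]
      intro x hx
      obtain ⟨k, hk, rfl⟩ := List.mem_map.1 hx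
      have hk : k ≠ i := by simpa using hk
      exact inv_mul_cancel₀ (sub_ne_zero.2 fun h => hk (hinj h).symm)
    · rw [List.prod_eq_zero, zero_smul]
      exact List.mem_map.2 ⟨i, by simp [hij], by simp⟩
  have h : (spectralProj A j u : StateSpace N →ₗ[ℝ] StateSpace N) =
      (b.coord j).smulRight (b j) := by
    refine b.ext fun i => ?_
    rw [ContinuousLinearMap.coe_coe, hbi]
    by_cases hij : i = j
    · subst hij; simp
    · simp [hij]
  intro v
  exact LinearMap.congr_fun h v

theorem isSpectralFrame_spectralProj {u : StateSpace N} (hu : u ∈ hyperbolicSet 𝒰 A) :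
    IsSpectralFrame (traceCLM N) (coeffOp A u) (eigenvalueTuple A u) (fun j => spectralProj A j u) := by
  obtain ⟨b, h1, h2⟩ := exists_eigenbasis hu
  exact isSpectralFrame_of_basis (isSpectralTuple_eigenvalueTuple hu).strictMono.injective h1 h2

theorem toEuclideanCLM_jacobianMatrix (q : StateSpace N → StateSpace N) (u : StateSpace N) :
    Matrix.toEuclideanCLM (n := Fin N) (𝕜 := ℝ) (jacobianMatrix q u) = fderiv ℝ q u := by
  apply ContinuousLinearMap.coe_injective
  refine (EuclideanSpace.basisFun (Fin N) ℝ).toBasis.ext fun k => ?_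
  ext i
  simp [jacobianMatrix]

/-- Conjugation to an eigenbasis makes `A u` diagonal without changing the spectrum, and the trace
becomes a diagonal entry of the conjugated Jacobian. High-frequency perturbation theory bounds that
entry. -/
theorem traceCLM_le_of_highFrequencyStable {q : StateSpace N → StateSpace N} {u : StateSpace N}
    (hu : u ∈ hyperbolicSet 𝒰 A) (h : HighFrequencyStable A q u) :
    ∃ c : ℝ, 0 < c ∧ ∀ j, traceCLM N (spectralProj A j u * fderiv ℝ q u) ≤ -c := by
  obtain ⟨c, C, hc, hC, hspec⟩ := h
  refine ⟨c, hc, fun j => ?_⟩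
  obtain ⟨b, hb, hP⟩ := exists_eigenbasis hu
  set l := eigenvalueTuple A u with hl
  have hinj : Function.Injective l := (isSpectralTuple_eigenvalueTuple hu).strictMono.injective
  rw [traceCLM_of_rank_one (hP j)]
  let e := (EuclideanSpace.basisFun (Fin N) ℝ).toBasis
  set S := e.toMatrix b with hS
  set S' := b.toMatrix e with hS'
  set Q := LinearMap.toMatrix b b (fderiv ℝ q u : StateSpace N →ₗ[ℝ] StateSpace N) with hQ
  have hSS' : S * S' = 1 := e.toMatrix_mul_toMatrix_flip b
  have hS'S : S' * S = 1 := b.toMatrix_mul_toMatrix_flip e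
  have hmat : ∀ M : Matrix (Fin N) (Fin N) ℝ, M = S * LinearMap.toMatrix b b
      (Matrix.toEuclideanCLM (n := Fin N) (𝕜 := ℝ) M : StateSpace N →ₗ[ℝ] StateSpace N) * S' := by
    intro M
    rw [hS, hS', basis_toMatrix_mul_linearMap_toMatrix_mul_basis_toMatrix]
    ext i k
    simp [LinearMap.toMatrix_apply, e]
  have hA : A u = S * Matrix.diagonal l * S' := by
    conv_lhs => rw [hmat (A u)]
    congr 2
    ext i k
    have h1 : Matrix.toEuclideanCLM (n := Fin N) (𝕜 := ℝ) (A u) (b k) = l k • b k := hb k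
    rw [LinearMap.toMatrix_apply, ContinuousLinearMap.coe_coe, h1, Matrix.diagonal_apply]
    by_cases hik : i = k
    · subst hik; simp
    · simp [hik]
  have hJ : jacobianMatrix q u = S * Q * S' := by
    conv_lhs => rw [hmat (jacobianMatrix q u)]
    rw [toEuclideanCLM_jacobianMatrix]
  have hQj : b.repr (fderiv ℝ q u (b j)) j = Q j j := by
    rw [hQ, LinearMap.toMatrix_apply]; rfl
  rw [hQj]
  let φ : Matrix (Fin N) (Fin N) ℝ →+* Matrix (Fin N) (Fin N) ℂ := Complex.ofRealHom.mapMatrix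
  let U : (Matrix (Fin N) (Fin N) ℂ)ˣ :=
    ⟨φ S, φ S', by rw [← map_mul, hSS', map_one], by rw [← map_mul, hS'S, map_one]⟩
  have key : ∀ ξ : ℝ, (Complex.I * (ξ : ℂ)) • (A u).map (fun r : ℝ => (r : ℂ)) +
      (jacobianMatrix q u).map (fun r : ℝ => (r : ℂ)) =
      (U : Matrix (Fin N) (Fin N) ℂ) * ((Complex.I * (ξ : ℂ)) •
        Matrix.diagonal (fun k => (l k : ℂ)) + φ Q) * (U⁻¹ : (Matrix (Fin N) (Fin N) ℂ)ˣ) := by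
    intro ξ
    have h1 : (A u).map (fun r : ℝ => (r : ℂ)) = φ S * Matrix.diagonal (fun k => (l k : ℂ)) * φ S' := by
      have : Matrix.diagonal (fun k => (l k : ℂ)) = φ (Matrix.diagonal l) := by
        ext i k; simp [φ, Matrix.diagonal_apply]; split_ifs <;> simp
      rw [this, ← map_mul, ← map_mul, ← hA]; rfl
    have h2 : (jacobianMatrix q u).map (fun r : ℝ => (r : ℂ)) = φ S * φ Q * φ S' := by
      rw [← map_mul, ← map_mul, ← hJ]; rfl
    rw [h1, h2]
    change _ = φ S * _ * φ S'
    simp only [mul_add, add_mul, Matrix.mul_smul, Matrix.smul_mul]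
  have := re_diag_le_of_spectrum l hinj (φ Q) (c := c) (C := C) (fun ξ hξ z hz => by
    refine hspec ξ (hξ.trans (le_abs_self ξ)) z ?_
    rw [key ξ, spectrum.units_conjugate]
    exact hz) j
  simpa [φ] using this

end SpectralFrame

/-! ### Bounded coefficients with bounded derivative -/

section BoundedC1

variable {F G H : Type*} [NormedAddCommGroup F] [NormedSpace ℝ F] [NormedAddCommGroup G]
  [NormedSpace ℝ G] [NormedAddCommGroup H] [NormedSpace ℝ H]

/-- A differentiable function on the line which is bounded together with its derivative. -/
structure BddC1 (f : ℝ → F) : Prop where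
  differentiable : Differentiable ℝ f
  bdd : ∃ C, ∀ x, ‖f x‖ ≤ C
  bdd_deriv : ∃ C, ∀ x, ‖deriv f x‖ ≤ C

theorem BddC1.const (c : F) : BddC1 fun _ : ℝ => c :=
  ⟨differentiable_const c, ⟨‖c‖, fun _ => le_rfl⟩, ⟨0, fun x => by simp⟩⟩

theorem BddC1.add {f g : ℝ → F} (hf : BddC1 f) (hg : BddC1 g) : BddC1 fun x => f x + g x := by
  obtain ⟨C, hC⟩ := hf.bdd
  obtain ⟨D, hD⟩ := hg.bdd
  obtain ⟨C', hC'⟩ := hf.bdd_deriv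
  obtain ⟨D', hD'⟩ := hg.bdd_deriv
  refine ⟨hf.differentiable.add hg.differentiable,
    ⟨C + D, fun x => norm_add_le_of_le (hC x) (hD x)⟩, ⟨C' + D', fun x => ?_⟩⟩
  rw [deriv_fun_add (hf.differentiable x) (hg.differentiable x)]
  exact norm_add_le_of_le (hC' x) (hD' x)

theorem BddC1.sum {ι : Type*} {s : Finset ι} {f : ι → ℝ → F} (hf : ∀ i ∈ s, BddC1 (f i)) :
    BddC1 fun x => ∑ i ∈ s, f i x := by
  classical
  induction s using Finset.induction_on with
  | empty => simpa using BddC1.const (0 : F)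
  | insert i s hi ih =>
    simp only [Finset.sum_insert hi]
    exact (hf i (Finset.mem_insert_self _ _)).add
      (ih fun j hj => hf j (Finset.mem_insert_of_mem hj))

theorem BddC1.bilinear (B : F →L[ℝ] G →L[ℝ] H) {f : ℝ → F} {g : ℝ → G} (hf : BddC1 f)
    (hg : BddC1 g) : BddC1 fun x => B (f x) (g x) := by
  obtain ⟨C, hC⟩ := hf.bdd
  obtain ⟨D, hD⟩ := hg.bdd
  obtain ⟨C', hC'⟩ := hf.bdd_deriv
  obtain ⟨D', hD'⟩ := hg.bdd_deriv
  have hle : ∀ (u : F) (v : G) (a b : ℝ), ‖u‖ ≤ a → ‖v‖ ≤ b → ‖B u v‖ ≤ ‖B‖ * a * b := by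
    intro u v a b hu hv
    refine (B.le_opNorm₂ u v).trans ?_
    have := (norm_nonneg u).trans hu
    gcongr
  have hder : ∀ x, HasDerivAt (fun x => B (f x) (g x)) (B (f x) (deriv g x) + B (deriv f x) (g x)) x :=
    fun x => B.hasDerivAt_of_bilinear (fun _ => (hf.differentiable x).hasDerivAt)
      (fun _ => (hg.differentiable x).hasDerivAt)
  refine ⟨fun x => (hder x).differentiableAt, ⟨_, fun x => hle _ _ _ _ (hC x) (hD x)⟩,
    ⟨‖B‖ * C * D' + ‖B‖ * C' * D, fun x => ?_⟩⟩
  rw [(hder x).deriv]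
  exact norm_add_le_of_le (hle _ _ _ _ (hC x) (hD' x)) (hle _ _ _ _ (hC' x) (hD x))

theorem BddC1.clm (B : F →L[ℝ] G) {f : ℝ → F} (hf : BddC1 f) : BddC1 fun x => B (f x) :=
  BddC1.bilinear (ContinuousLinearMap.id ℝ (F →L[ℝ] G)) (BddC1.const B) hf

theorem BddC1.smul {f : ℝ → ℝ} {g : ℝ → F} (hf : BddC1 f) (hg : BddC1 g) :
    BddC1 fun x => f x • g x :=
  BddC1.bilinear (ContinuousLinearMap.lsmul ℝ ℝ) hf hg

theorem BddC1.mul {f g : ℝ → F →L[ℝ] F} (hf : BddC1 f) (hg : BddC1 g) : BddC1 fun x => f x * g x :=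
  BddC1.bilinear (ContinuousLinearMap.mul ℝ (F →L[ℝ] F)) hf hg

theorem tendsto_zero_bilinear {α : Type*} {l : Filter α} (B : F →L[ℝ] G →L[ℝ] H) {f : α → F}
    {g : α → G} (hf : Tendsto f l (𝓝 0)) (hg : ∃ C, ∀ x, ‖g x‖ ≤ C) :
    Tendsto (fun x => B (f x) (g x)) l (𝓝 0) := by
  obtain ⟨C, hC⟩ := hg
  have h := (hf.norm.const_mul ‖B‖).mul_const C
  rw [norm_zero, mul_zero, zero_mul] at h
  refine squeeze_zero_norm (fun x => (B.le_opNorm₂ _ _).trans ?_) h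
  have := hC x
  gcongr

end BoundedC1

/-! ### Uniform neighbourhoods of the profile -/

section Tube

variable {E : Type*} [NormedAddCommGroup E] [NormedSpace ℝ E]
  {F : Type*} [NormedAddCommGroup F] [NormedSpace ℝ F]

/-- A smooth bounded curve `W`, all of whose derivatives are bounded and tend to zero at infinity,
with a compact neighbourhood `Kc` of uniform size `r` inside the open set `O`. -/
structure IsTube (O Kc : Set E) (r : ℝ) (W : ℝ → E) : Prop where
  isOpen : IsOpen O
  isCompact : IsCompact Kc
  subset : Kc ⊆ O
  pos : 0 < r
  closedBall_subset : ∀ x, Metric.closedBall (W x) r ⊆ Kc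
  smooth : ContDiff ℝ ∞ W
  bdd : ∀ k, ∃ C, ∀ x, ‖iteratedDeriv k W x‖ ≤ C
  tendsto : ∀ k, 1 ≤ k → Tendsto (iteratedDeriv k W) (cocompact ℝ) (𝓝 0)

theorem hasDerivAt_iteratedDeriv {W : ℝ → E} (hW : ContDiff ℝ ∞ W) (k : ℕ) (x : ℝ) :
    HasDerivAt (iteratedDeriv k W) (iteratedDeriv (k + 1) W x) x := by
  rw [iteratedDeriv_succ]
  exact (hW.differentiable_iteratedDeriv k (by exact_mod_cast WithTop.coe_lt_top _) x).hasDerivAt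

variable {O Kc : Set E} {r : ℝ} {W : ℝ → E}

theorem IsTube.mem (h : IsTube O Kc r W) (x : ℝ) : W x ∈ Kc :=
  h.closedBall_subset x (Metric.mem_closedBall_self h.pos.le)

theorem IsTube.bddC1_iteratedDeriv (h : IsTube O Kc r W) (k : ℕ) : BddC1 (iteratedDeriv k W) :=
  ⟨fun x => (hasDerivAt_iteratedDeriv h.smooth k x).differentiableAt, h.bdd k, by
    simpa only [← iteratedDeriv_succ] using h.bdd (k + 1)⟩

theorem IsTube.exists_bound {F : Type*} [NormedAddCommGroup F] (h : IsTube O Kc r W) {g : E → F}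
    (hg : ContinuousOn g O) :
    ∃ C, 0 ≤ C ∧ ∀ v ∈ Kc, ‖g v‖ ≤ C := by
  obtain ⟨C, hC⟩ := (h.isCompact.image_of_continuousOn (hg.mono h.subset).norm).bddAbove
  exact ⟨max C 0, le_max_right _ _, fun v hv => (hC ⟨v, hv, rfl⟩).trans (le_max_left _ _)⟩

theorem IsTube.hasFDerivAt (h : IsTube O Kc r W) {g : E → F} (hg : ContDiffOn ℝ ∞ g O) {v : E}
    (hv : v ∈ O) : HasFDerivAt g (fderiv ℝ g v) v :=
  ((hg.contDiffAt (h.isOpen.mem_nhds hv)).differentiableAt (by simp)).hasFDerivAt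

theorem contDiffOn_fderiv {g : E → F} (hO : IsOpen O) (hg : ContDiffOn ℝ ∞ g O) :
    ContDiffOn ℝ ∞ (fderiv ℝ g) O :=
  hg.fderiv_of_isOpen hO (by simp)

/-- Each closed ball is convex and lies in the one compact set `Kc`, so the bound on the derivative
there serves all base points at once. -/
theorem IsTube.exists_lipschitz (h : IsTube O Kc r W) {g : E → F} (hg : ContDiffOn ℝ ∞ g O) :
    ∃ C, 0 ≤ C ∧ ∀ x, ∀ v ∈ Metric.closedBall (W x) r, ‖g v - g (W x)‖ ≤ C * ‖v - W x‖ := by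
  obtain ⟨C, hC0, hC⟩ := h.exists_bound (contDiffOn_fderiv h.isOpen hg).continuousOn
  refine ⟨C, hC0, fun x v hv => ?_⟩
  exact (convex_closedBall (W x) r).norm_image_sub_le_of_norm_hasFDerivWithin_le
    (fun u hu => (h.hasFDerivAt hg (h.subset (h.closedBall_subset x hu))).hasFDerivWithinAt)
    (fun u hu => hC u (h.closedBall_subset x hu)) (Metric.mem_closedBall_self h.pos.le) hv

theorem IsTube.hasDerivAt_comp (h : IsTube O Kc r W) {g : E → F} (hg : ContDiffOn ℝ ∞ g O) (x : ℝ) :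
    HasDerivAt (fun x => g (W x)) (fderiv ℝ g (W x) (iteratedDeriv 1 W x)) x := by
  have h1 := hasDerivAt_iteratedDeriv h.smooth 0 x
  rw [iteratedDeriv_zero] at h1
  exact (h.hasFDerivAt hg (h.subset (h.mem x))).comp_hasDerivAt x h1

theorem IsTube.bddC1_comp (h : IsTube O Kc r W) {g : E → F} (hg : ContDiffOn ℝ ∞ g O) :
    BddC1 fun x => g (W x) := by
  obtain ⟨C, -, hC⟩ := h.exists_bound hg.continuousOn
  obtain ⟨D, hD0, hD⟩ := h.exists_bound (contDiffOn_fderiv h.isOpen hg).continuousOn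
  obtain ⟨B, hB⟩ := h.bdd 1
  refine ⟨fun x => (h.hasDerivAt_comp hg x).differentiableAt, ⟨C, fun x => hC _ (h.mem x)⟩,
    ⟨D * B, fun x => ?_⟩⟩
  rw [(h.hasDerivAt_comp hg x).deriv]
  exact ContinuousLinearMap.le_of_opNorm_le_of_le _ (hD _ (h.mem x)) (hB x)

end Tube

/-! ### Differential polynomials and prolongation of the equation -/

section DiffPoly

variable {N : ℕ}

/-- The sequence of derivatives of the curve `W` at `x`. -/
noncomputable def jet {E : Type*} [NormedAddCommGroup E] [NormedSpace ℝ E] (W : ℝ → E) (x : ℝ) :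
    ℕ → E :=
  fun k => iteratedDeriv k W x

/-- Differential polynomials: functions of jets which are polynomial in the derivatives of order at
least one, with coefficients that are smooth in the state. The indices bound the order of the
derivatives, the total order of a monomial, and (from below) its degree. -/
inductive DiffPoly (O : Set (StateSpace N)) :
    ℕ → ℕ → ℕ → ((ℕ → StateSpace N) → StateSpace N) → Prop
  | coeff (g : StateSpace N → StateSpace N) (hg : ContDiffOn ℝ ∞ g O) :
      DiffPoly O 0 0 0 (fun J => g (J 0))
  | zero (m w p : ℕ) : DiffPoly O m w p (fun _ => 0)
  | smul_jet {m w p : ℕ} {Φ : (ℕ → StateSpace N) → StateSpace N} (a : ℕ) (c : Fin N)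
      (h : DiffPoly O m w p Φ) (h1 : 1 ≤ a) (ham : a ≤ m) :
      DiffPoly O m (w + a) (p + 1) (fun J => J a c • Φ J)
  | add {m w p : ℕ} {Φ Ψ : (ℕ → StateSpace N) → StateSpace N} (hΦ : DiffPoly O m w p Φ)
      (hΨ : DiffPoly O m w p Ψ) : DiffPoly O m w p (fun J => Φ J + Ψ J)
  | mono {m w p m' w' p' : ℕ} {Φ : (ℕ → StateSpace N) → StateSpace N} (h : DiffPoly O m w p Φ)
      (hm : m ≤ m') (hw : w ≤ w') (hp : p' ≤ p) : DiffPoly O m' w' p' Φ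

theorem clm_apply_eq_sum {F : Type*} [NormedAddCommGroup F] [NormedSpace ℝ F]
    (L : StateSpace N →L[ℝ] F) (v : StateSpace N) :
    L v = ∑ c, v c • L (EuclideanSpace.single c 1) := by
  conv_lhs => rw [← (EuclideanSpace.basisFun (Fin N) ℝ).sum_repr v]
  simp

variable {O : Set (StateSpace N)}

theorem DiffPoly.sum {ι : Type*} (s : Finset ι) {m w p : ℕ}
    {Φ : ι → (ℕ → StateSpace N) → StateSpace N} (h : ∀ i ∈ s, DiffPoly O m w p (Φ i)) :
    DiffPoly O m w p (fun J => ∑ i ∈ s, Φ i J) := by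
  classical
  induction s using Finset.induction_on with
  | empty => simpa using DiffPoly.zero m w p
  | insert i s hi ih =>
    simp only [Finset.sum_insert hi]
    exact (h i (Finset.mem_insert_self _ _)).add (ih fun j hj => h j (Finset.mem_insert_of_mem hj))

theorem DiffPoly.of_linear {g : StateSpace N → StateSpace N →L[ℝ] StateSpace N}
    (hg : ContDiffOn ℝ ∞ g O) {a m : ℕ} (ha : 1 ≤ a) (ham : a ≤ m) :
    DiffPoly O m a 1 (fun J => g (J 0) (J a)) := by
  simp only [fun J : ℕ → StateSpace N => clm_apply_eq_sum (g (J 0)) (J a)]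
  refine DiffPoly.sum _ fun c _ => ?_
  have := DiffPoly.smul_jet a c ((DiffPoly.coeff (fun u => g u (EuclideanSpace.single c 1))
    (hg.clm_apply contDiffOn_const)).mono (Nat.zero_le m) le_rfl le_rfl) ha ham
  simpa using this

theorem DiffPoly.of_bilinear
    {g : StateSpace N → StateSpace N →L[ℝ] StateSpace N →L[ℝ] StateSpace N}
    (hg : ContDiffOn ℝ ∞ g O) {a b m : ℕ} (ha : 1 ≤ a) (ham : a ≤ m) (hb : 1 ≤ b) (hbm : b ≤ m) :
    DiffPoly O m (b + a) 2 (fun J => g (J 0) (J a) (J b)) := by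
  have h : ∀ J : ℕ → StateSpace N, g (J 0) (J a) (J b) =
      ∑ c, J a c • g (J 0) (EuclideanSpace.single c 1) (J b) := fun J => by
    rw [clm_apply_eq_sum (g (J 0)) (J a)]; simp
  simp only [h]
  exact DiffPoly.sum _ fun c _ => DiffPoly.smul_jet a c
    (DiffPoly.of_linear (hg.clm_apply contDiffOn_const) hb hbm) ha ham

theorem hasDerivAt_comp_curve {E F : Type*} [NormedAddCommGroup E] [NormedSpace ℝ E]
    [NormedAddCommGroup F] [NormedSpace ℝ F] {O : Set E}
    (hO : IsOpen O) {g : E → F} (hg : ContDiffOn ℝ ∞ g O) {W : ℝ → E}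
    (hW : ContDiff ℝ ∞ W) {x : ℝ} (hx : W x ∈ O) :
    HasDerivAt (fun x => g (W x)) (fderiv ℝ g (W x) (jet W x 1)) x := by
  have h1 := hasDerivAt_iteratedDeriv hW 0 x
  rw [iteratedDeriv_zero] at h1
  exact ((hg.contDiffAt (hO.mem_nhds hx)).differentiableAt (by simp)).hasFDerivAt.comp_hasDerivAt x h1

theorem hasDerivAt_jet {E : Type*} [NormedAddCommGroup E] [NormedSpace ℝ E] {W : ℝ → E} (hW : ContDiff ℝ ∞ W) (k : ℕ) (x : ℝ) :
    HasDerivAt (fun x => jet W x k) (jet W x (k + 1)) x :=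
  hasDerivAt_iteratedDeriv hW k x

/-- By the product and chain rules a derivative raises the maximal order and the total order by at
most one and never lowers the degree: it hits either one jet factor or the coefficient, and the
latter adds a factor of order one. -/
theorem DiffPoly.exists_deriv (hO : IsOpen O) {m w p : ℕ}
    {Φ : (ℕ → StateSpace N) → StateSpace N} (h : DiffPoly O m w p Φ) :
    ∃ Ψ, DiffPoly O (m + 1) (w + 1) p Ψ ∧ ∀ W : ℝ → StateSpace N, ContDiff ℝ ∞ W →
      (∀ x, W x ∈ O) → ∀ x, HasDerivAt (fun x => Φ (jet W x)) (Ψ (jet W x)) x := by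
  induction h with
  | coeff g hg =>
    refine ⟨fun J => fderiv ℝ g (J 0) (J 1),
      (DiffPoly.of_linear (contDiffOn_fderiv hO hg) le_rfl le_rfl).mono le_rfl le_rfl (by simp),
      fun W hW hWO x => ?_⟩
    simpa [jet] using hasDerivAt_comp_curve hO hg hW (hWO x)
  | zero m w p => exact ⟨_, DiffPoly.zero _ _ _, fun W _ _ x => hasDerivAt_const _ _⟩
  | @smul_jet m w p Φ a c h h1 ham ih =>
    obtain ⟨Ψ, hΨ, hder⟩ := ih
    refine ⟨fun J => J a c • Ψ J + J (a + 1) c • Φ J, DiffPoly.add ?_ ?_, fun W hW hWO x => ?_⟩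
    · exact (DiffPoly.smul_jet a c hΨ h1 (by omega)).mono le_rfl (by omega) le_rfl
    · exact (DiffPoly.smul_jet (m := m + 1) (a + 1) c (h.mono (by omega) le_rfl le_rfl) (by omega)
        (by omega)).mono le_rfl (by omega) le_rfl
    · have h2 : HasDerivAt (fun x => jet W x a c) (jet W x (a + 1) c) x :=
        (EuclideanSpace.proj c : StateSpace N →L[ℝ] ℝ).hasFDerivAt.comp_hasDerivAt x
          (hasDerivAt_iteratedDeriv hW a x)
      exact h2.smul (hder W hW hWO x)
  | add _ _ ih1 ih2 =>
    obtain ⟨Ψ₁, hΨ₁, h1⟩ := ih1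
    obtain ⟨Ψ₂, hΨ₂, h2⟩ := ih2
    exact ⟨_, hΨ₁.add hΨ₂, fun W hW hWO x => (h1 W hW hWO x).add (h2 W hW hWO x)⟩
  | mono _ hm hw hp ih =>
    obtain ⟨Ψ, hΨ, h1⟩ := ih
    exact ⟨Ψ, hΨ.mono (by omega) (by omega) hp, h1⟩

/-- The non-principal part of the `k`-th prolongation of `q(W) - A(W) W'`, given its nonlinear
remainders `R`. -/
noncomputable def prolongation (q : StateSpace N → StateSpace N)
    (R : ℕ → (ℕ → StateSpace N) → StateSpace N) : ℕ → (ℕ → StateSpace N) → StateSpace N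
  | 0, J => q (J 0)
  | k + 1, J => fderiv ℝ q (J 0) (J (k + 1)) + R k J

/-- Apart from the principal term and `dq` applied to the highest derivative, each differentiation
creates only terms with at least two factors of order one or more. Degree two is what later makes
these terms quadratic in the perturbation or multiplied by a derivative of the profile. -/
theorem exists_prolongation (hO : IsOpen O) {q : StateSpace N → StateSpace N}
    {𝔸 : StateSpace N → StateSpace N →L[ℝ] StateSpace N} (hq : ContDiffOn ℝ ∞ q O)
    (h𝔸 : ContDiffOn ℝ ∞ 𝔸 O) :
    ∃ R : ℕ → (ℕ → StateSpace N) → StateSpace N, (∀ k, DiffPoly O (k + 1) (k + 2) 2 (R k)) ∧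
      ∀ W : ℝ → StateSpace N, ContDiff ℝ ∞ W → (∀ x, W x ∈ O) → ∀ k x,
        HasDerivAt (fun x => prolongation q R k (jet W x) - 𝔸 (W x) (jet W x (k + 1)))
          (prolongation q R (k + 1) (jet W x) - 𝔸 (W x) (jet W x (k + 2))) x := by
  have hdA : ContDiffOn ℝ ∞ (fun u => -fderiv ℝ 𝔸 u) O := (contDiffOn_fderiv hO h𝔸).neg
  have hdq := contDiffOn_fderiv hO hq
  have hddq := contDiffOn_fderiv hO hdq
  -- This is the commutator: the derivative of the coefficient in front of the principal term.
  have hcomm : ∀ k, DiffPoly O (k + 1) (k + 2) 2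
      (fun J => (-fderiv ℝ 𝔸 (J 0)) (J 1) (J (k + 1))) := fun k =>
    (DiffPoly.of_bilinear (m := k + 1) hdA le_rfl (by omega) (by omega : 1 ≤ k + 1) le_rfl).mono
      le_rfl (by omega) le_rfl
  -- The next remainder is the derivative of the present one, plus the second derivative of `q`,
  -- plus the new commutator. The bounds on orders and degree are carried along in the subtype.
  let step : ∀ k, {Φ // DiffPoly O (k + 1) (k + 2) 2 Φ} → {Φ // DiffPoly O (k + 2) (k + 3) 2 Φ} :=
    fun k Φ => ⟨fun J => (Φ.2.exists_deriv hO).choose J +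
      (fderiv ℝ (fderiv ℝ q) (J 0) (J 1) (J (k + 1)) + (-fderiv ℝ 𝔸 (J 0)) (J 1) (J (k + 2))),
      (Φ.2.exists_deriv hO).choose_spec.1.add
        (((DiffPoly.of_bilinear (m := k + 2) hddq le_rfl (by omega) (by omega : 1 ≤ k + 1)
          (by omega)).mono le_rfl (by omega) le_rfl).add (hcomm (k + 1)))⟩
  let S : ∀ k, {Φ // DiffPoly O (k + 1) (k + 2) 2 Φ} := fun k =>
    Nat.rec ⟨_, hcomm 0⟩ step k
  refine ⟨fun k => (S k).1, fun k => (S k).2, fun W hW hWO k x => ?_⟩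
  have hprinc : ∀ k, HasDerivAt (fun x => 𝔸 (W x) (jet W x (k + 1)))
      (𝔸 (W x) (jet W x (k + 2)) + fderiv ℝ 𝔸 (W x) (jet W x 1) (jet W x (k + 1))) x := fun k => by
    exact ((hasDerivAt_comp_curve hO h𝔸 hW (hWO x)).clm_apply
      (hasDerivAt_jet hW (k + 1) x)).congr_deriv (add_comm _ _)
  have hW0 : ∀ x, jet W x 0 = W x := fun x => by simp [jet]
  cases k with
  | zero =>
    have h1 := (hasDerivAt_comp_curve hO hq hW (hWO x)).fun_sub (hprinc 0)
    simp only [prolongation, hW0]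
    refine h1.congr_deriv ?_
    change _ = _ + (-fderiv ℝ 𝔸 (jet W x 0)) (jet W x 1) (jet W x 1) - _
    rw [hW0]
    simp only [neg_apply]
    abel
  | succ k =>
    have h1 := (((hasDerivAt_comp_curve hO hdq hW (hWO x)).clm_apply
      (hasDerivAt_jet hW (k + 1) x)).fun_add
        (((S k).2.exists_deriv hO).choose_spec.2 W hW hWO x)).fun_sub (hprinc (k + 1))
    simp only [prolongation, hW0]
    refine h1.congr_deriv ?_
    change _ = _ + (_ + (fderiv ℝ (fderiv ℝ q) (jet W x 0) (jet W x 1) (jet W x (k + 1)) +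
      (-fderiv ℝ 𝔸 (jet W x 0)) (jet W x 1) (jet W x (k + 2)))) - _
    rw [hW0]
    simp only [neg_apply]
    change _ + fderiv ℝ q (W x) (jet W x (k + 2)) + _ -
      (𝔸 (W x) (jet W x (k + 3)) + fderiv ℝ 𝔸 (W x) (jet W x 1) (jet W x (k + 2))) =
      fderiv ℝ q (W x) (jet W x (k + 2)) + _ - 𝔸 (W x) (jet W x (k + 3))
    abel

end DiffPoly

/-! ### Linearisation of differential polynomials at the profile -/

section DiffPolyEstimate

variable {N : ℕ} {O Kc : Set (StateSpace N)} {r : ℝ} {W : ℝ → StateSpace N}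

/-- The jet `J` is close to the jet of `W` at `x`, with constants which grow geometrically in the
order of the derivative. -/
structure JetClose {E : Type*} [NormedAddCommGroup E] [NormedSpace ℝ E] (W : ℝ → E) (K : ℕ)
    (C₀ r x : ℝ) (J : ℕ → E) (e h : ℝ) : Prop where
  nonneg : 0 ≤ e
  le_radius : e ≤ r
  le_one : e ≤ 1
  one_le : 1 ≤ h
  base : ‖J 0 - W x‖ ≤ e
  deriv : ∀ a, 1 ≤ a → a ≤ K → ‖J a - jet W x a‖ ≤ C₀ * (e * h ^ (a - 1))

theorem abs_coord_le (v : StateSpace N) (c : Fin N) : |v c| ≤ ‖v‖ := by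
  simpa using EuclideanSpace.norm_eq v ▸ PiLp.norm_apply_le v c

/-- Expanding a monomial about the jet of `W` leaves terms linear in the perturbation and products
of at least two perturbations. The coefficient of the highest derivative is collected in `β`: a
monomial of degree at least two still has a factor from the profile there, so `β` vanishes at
infinity. In the quadratic terms the geometric scale turns the bound `K + 1` on the total order into
`e² h^(K-1)`. -/
theorem DiffPoly.exists_estimate (hT : IsTube O Kc r W) {m w p : ℕ}
    {Φ : (ℕ → StateSpace N) → StateSpace N} (h : DiffPoly O m w p Φ) {K : ℕ} (hK : 1 ≤ K)
    {C₀ : ℝ} (hC₀ : 0 ≤ C₀) :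
    m ≤ K → w ≤ K + 1 → ∃ (C : ℝ) (β : ℝ → StateSpace N →L[ℝ] StateSpace N), 0 ≤ C ∧ BddC1 β ∧
      (2 ≤ p → Tendsto β (cocompact ℝ) (𝓝 0)) ∧ (m < K → ∀ x, β x = 0) ∧
      BddC1 (fun x => Φ (jet W x)) ∧
      (1 ≤ p → Tendsto (fun x => Φ (jet W x)) (cocompact ℝ) (𝓝 0)) ∧
      ∀ x J e h, JetClose W K C₀ r x J e h →
        ‖Φ J - Φ (jet W x)‖ ≤ C * (e * h ^ (w - 1)) ∧
        ‖Φ J - Φ (jet W x) - β x (J K - jet W x K)‖ ≤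
          C * (∑ a ∈ Finset.range K, ‖J a - jet W x a‖ + e ^ 2 * h ^ (K - 1)) := by
  have hsum0 : ∀ (x : ℝ) (J : ℕ → StateSpace N),
      0 ≤ ∑ a ∈ Finset.range K, ‖J a - jet W x a‖ := fun x J =>
    Finset.sum_nonneg fun _ _ => norm_nonneg _
  have hsumle : ∀ (x : ℝ) (J : ℕ → StateSpace N) (a : ℕ), a < K →
      ‖J a - jet W x a‖ ≤ ∑ a ∈ Finset.range K, ‖J a - jet W x a‖ := fun x J a ha =>
    Finset.single_le_sum (f := fun a => ‖J a - jet W x a‖) (fun _ _ => norm_nonneg _)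
      (Finset.mem_range.2 ha)
  induction h with
  | coeff g hg =>
    intro _ _
    obtain ⟨C, hC0, hC⟩ := hT.exists_lipschitz hg
    refine ⟨C, fun _ => 0, hC0, BddC1.const 0, by simp, fun _ _ => rfl, ?_, by simp, ?_⟩
    · simpa [jet] using hT.bddC1_comp hg
    · intro x J e h hJ
      have hj0 : jet W x 0 = W x := by simp [jet]
      have h1 : ‖g (J 0) - g (W x)‖ ≤ C * ‖J 0 - W x‖ := hC x _ (by
        rw [mem_closedBall_iff_norm]; exact hJ.base.trans hJ.le_radius)
      have h2 := hsumle x J 0 (by omega)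
      rw [hj0] at h2
      change ‖g (J 0) - g (jet W x 0)‖ ≤ _ ∧ ‖g (J 0) - g (jet W x 0) - _‖ ≤ _
      rw [hj0]
      have h3 : 0 ≤ e ^ 2 * h ^ (K - 1) := by
        have := hJ.one_le; positivity
      refine ⟨h1.trans ?_, ?_⟩
      · simpa using mul_le_mul_of_nonneg_left hJ.base hC0
      · simp only [zero_apply, sub_zero]
        exact h1.trans (mul_le_mul_of_nonneg_left (by linarith) hC0)
  | zero m w p =>
    intro _ _
    refine ⟨0, fun _ => 0, le_rfl, BddC1.const 0, by simp, fun _ _ => rfl, BddC1.const 0,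
      by simp, ?_⟩
    intro x J e h hJ
    simp
  | @smul_jet m w p Φ a c h h1 ham ih =>
    intro hm hw
    obtain ⟨C, β, hC0, hβ, hβ0, hβm, hΦ, hΦ0, hest⟩ := ih hm (by omega)
    obtain ⟨D, hD⟩ := (hT.bddC1_iteratedDeriv a).bdd
    obtain ⟨M, hM⟩ := hΦ.bdd
    have hD0 : 0 ≤ D := (norm_nonneg _).trans (hD 0)
    have hM0 : 0 ≤ M := (norm_nonneg _).trans (hM 0)
    have hcoord : BddC1 fun x => jet W x a c :=
      (hT.bddC1_iteratedDeriv a).clm (EuclideanSpace.proj c : StateSpace N →L[ℝ] ℝ)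
    have hcoord0 : Tendsto (fun x => jet W x a c) (cocompact ℝ) (𝓝 0) := by
      have := ((EuclideanSpace.proj c : StateSpace N →L[ℝ] ℝ).continuous.tendsto 0).comp
        (hT.tendsto a h1)
      rwa [map_zero] at this
    obtain ⟨SR, hSR⟩ : ∃ SR : StateSpace N →L[ℝ] StateSpace N →L[ℝ] StateSpace N,
        ∀ u v, SR u v = v c • u :=
      ⟨ContinuousLinearMap.smulRightL ℝ (StateSpace N) (StateSpace N)
        (EuclideanSpace.proj c : StateSpace N →L[ℝ] ℝ), fun u v => rfl⟩
    -- Product rule for the top-order coefficient: the new factor is frozen at the profile, or, if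
    -- it is itself of order `K`, the old monomial is frozen there.
    refine ⟨D * C + C₀ * C + M * C₀ + M, fun x => jet W x a c • β x +
      (if a = K then SR (Φ (jet W x)) else 0), by positivity, ?_, ?_, ?_, hcoord.smul hΦ, ?_, ?_⟩
    · refine (hcoord.smul hβ).add ?_
      split_ifs
      · exact hΦ.clm SR
      · exact BddC1.const 0
    · intro hp
      have hz : Tendsto (fun x => if a = K then SR (Φ (jet W x)) else 0) (cocompact ℝ) (𝓝 0) := by
        split_ifs
        · have := (SR.continuous.tendsto 0).comp (hΦ0 (by omega))
          rwa [map_zero] at this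
        · exact tendsto_const_nhds
      have := (tendsto_zero_bilinear (ContinuousLinearMap.lsmul ℝ ℝ :
        ℝ →L[ℝ] (StateSpace N →L[ℝ] StateSpace N) →L[ℝ] _) hcoord0 hβ.bdd).add hz
      rwa [add_zero] at this
    · intro hmK x
      change _ • β x + (if a = K then _ else _) = 0
      rw [hβm hmK, if_neg (by omega), add_zero]
      ext1 v
      simp
    · intro _
      exact tendsto_zero_bilinear (ContinuousLinearMap.lsmul ℝ ℝ) hcoord0 hΦ.bdd
    · intro x J e h hJ
      obtain ⟨he1, he2⟩ := hest x J e h hJ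
      have he0 := hJ.nonneg
      have hh1 := hJ.one_le
      have hu := hJ.deriv a h1 (ham.trans hm)
      set u : StateSpace N := J a - jet W x a with hu_def
      set Δ : StateSpace N := Φ J - Φ (jet W x) with hΔ
      have hJa : J a c = jet W x a c + u c := by simp [hu_def]
      have huc : |u c| ≤ ‖u‖ := abs_coord_le u c
      have hWc : |jet W x a c| ≤ D := (abs_coord_le _ c).trans (hD x)
      -- Each factor loses one from its exponent, so a product with total order at most `K + 1` has
      -- exponent at most `K - 1`. Truncated subtraction covers the case `w = 0`, where `a ≤ K`
      -- suffices.
      have hquad : ‖u c • Δ‖ ≤ C₀ * C * (e ^ 2 * h ^ ((a - 1) + (w - 1))) := by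
        rw [norm_smul, Real.norm_eq_abs]
        calc |u c| * ‖Δ‖ ≤ (C₀ * (e * h ^ (a - 1))) * (C * (e * h ^ (w - 1))) :=
              mul_le_mul (huc.trans hu) he1 (norm_nonneg _) (by positivity)
          _ = _ := by rw [pow_add]; ring
      have hsplit : J a c • Φ J - jet W x a c • Φ (jet W x) =
          jet W x a c • Δ + u c • Δ + u c • Φ (jet W x) := by
        rw [hJa, hΔ]; module
      have hlinΦ : ‖u c • Φ (jet W x)‖ ≤ M * ‖u‖ := by
        rw [norm_smul, Real.norm_eq_abs, mul_comm]
        exact mul_le_mul (hM x) huc (abs_nonneg _) hM0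
      refine ⟨?_, ?_⟩
      · rw [hsplit]
        have e1 : ‖jet W x a c • Δ‖ ≤ D * C * (e * h ^ (w + a - 1)) := by
          rw [norm_smul, Real.norm_eq_abs, mul_assoc]
          refine mul_le_mul hWc (he1.trans ?_) (norm_nonneg _) hD0
          gcongr
          omega
        have e2 : ‖u c • Δ‖ ≤ C₀ * C * (e * h ^ (w + a - 1)) := by
          refine hquad.trans ?_
          have : e ^ 2 ≤ e := by nlinarith [hJ.le_one]
          gcongr
          omega
        have e3 : ‖u c • Φ (jet W x)‖ ≤ M * C₀ * (e * h ^ (w + a - 1)) := by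
          refine hlinΦ.trans ?_
          rw [mul_assoc]
          refine mul_le_mul_of_nonneg_left (hu.trans ?_) hM0
          gcongr
          omega
        have e4 : 0 ≤ M * (e * h ^ (w + a - 1)) := by positivity
        have := norm_add₃_le (a := jet W x a c • Δ) (b := u c • Δ) (c := u c • Φ (jet W x))
        linarith
      · have hS := hsum0 x J
        have hSa := hsumle x J a
        generalize ∑ a ∈ Finset.range K, ‖J a - jet W x a‖ = S at hS he2 hSa ⊢
        obtain ⟨Qd, hQd⟩ : ∃ Qd, Qd = e ^ 2 * h ^ (K - 1) := ⟨_, rfl⟩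
        rw [← hQd] at he2 ⊢
        have hQ0 : 0 ≤ Qd := by rw [hQd]; positivity
        have e1 : ‖jet W x a c • (Δ - β x (J K - jet W x K))‖ ≤ D * C * (S + Qd) := by
          rw [norm_smul, Real.norm_eq_abs, mul_assoc]
          exact mul_le_mul hWc he2 (norm_nonneg _) hD0
        have e2 : ‖u c • Δ‖ ≤ C₀ * C * (S + Qd) := by
          refine hquad.trans ?_
          have : e ^ 2 * h ^ (a - 1 + (w - 1)) ≤ Qd := by
            rw [hQd]; gcongr
            omega
          have := mul_nonneg hC₀ hC0
          nlinarith
        have e3 : ‖u c • Φ (jet W x) -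
            (if a = K then SR (Φ (jet W x)) else 0) (J K - jet W x K)‖ ≤ M * (S + Qd) := by
          split_ifs with haK
          · subst haK
            rw [hSR, sub_self, norm_zero]
            positivity
          · rw [zero_apply, sub_zero]
            refine hlinΦ.trans (mul_le_mul_of_nonneg_left ?_ hM0)
            have : ‖u‖ ≤ S := hSa (by omega)
            linarith
        have e4 : 0 ≤ M * C₀ * (S + Qd) := by positivity
        have hsplit2 : J a c • Φ J - jet W x a c • Φ (jet W x) -
            (jet W x a c • β x + (if a = K then SR (Φ (jet W x)) else 0)) (J K - jet W x K) =
            jet W x a c • (Δ - β x (J K - jet W x K)) + u c • Δ + (u c • Φ (jet W x) -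
            (if a = K then SR (Φ (jet W x)) else 0) (J K - jet W x K)) := by
          rw [hsplit, add_apply, smul_apply, smul_sub _ Δ (β x _)]
          abel
        rw [hsplit2]
        have := norm_add₃_le (a := jet W x a c • (Δ - β x (J K - jet W x K))) (b := u c • Δ)
          (c := u c • Φ (jet W x) - (if a = K then SR (Φ (jet W x)) else 0) (J K - jet W x K))
        linarith
  | @add m w p Φ Ψ _ _ ih1 ih2 =>
    intro hm hw
    obtain ⟨C, β, hC0, hβ, hβ0, hβm, hΦ, hΦ0, hest⟩ := ih1 hm hw
    obtain ⟨C', β', hC0', hβ', hβ0', hβm', hΦ', hΦ0', hest'⟩ := ih2 hm hw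
    refine ⟨C + C', fun x => β x + β' x, by positivity, hβ.add hβ', fun hp => ?_, fun hmK x => ?_,
      hΦ.add hΦ', fun hp => ?_, fun x J e h hJ => ?_⟩
    · simpa using (hβ0 hp).add (hβ0' hp)
    · change β x + β' x = 0
      rw [hβm hmK, hβm' hmK, add_zero]
    · simpa using (hΦ0 hp).add (hΦ0' hp)
    · obtain ⟨e1, e2⟩ := hest x J e h hJ
      obtain ⟨e1', e2'⟩ := hest' x J e h hJ
      constructor
      · rw [add_sub_add_comm, add_mul]
        exact norm_add_le_of_le e1 e1'
      · rw [add_sub_add_comm, add_apply, add_sub_add_comm, add_mul]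
        exact norm_add_le_of_le e2 e2'
  | @mono m w p m' w' p' Φ _ hmm hww hpp ih =>
    intro hm hw
    obtain ⟨C, β, hC0, hβ, hβ0, hβm, hΦ, hΦ0, hest⟩ := ih (by omega) (by omega)
    refine ⟨C, β, hC0, hβ, fun hp => hβ0 (by omega), fun hmK => hβm (by omega), hΦ,
      fun hp => hΦ0 (by omega), fun x J e h hJ => ?_⟩
    obtain ⟨e1, e2⟩ := hest x J e h hJ
    refine ⟨e1.trans ?_, e2⟩
    have := hJ.nonneg
    have := hJ.one_le
    gcongr

end DiffPolyEstimate

/-! ### Calculus on the closed space-time strip and characteristic curves -/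

section Strip

variable {F : Type*} [NormedAddCommGroup F] [NormedSpace ℝ F] {T : ℝ}

/-- The space-time strip `[0,T] × ℝ`. -/
def strip (T : ℝ) : Set (ℝ × ℝ) := Icc 0 T ×ˢ univ

theorem mem_strip {p : ℝ × ℝ} : p ∈ strip T ↔ p.1 ∈ Icc 0 T := by simp [strip]

theorem uniqueDiffOn_strip (hT : 0 < T) : UniqueDiffOn ℝ (strip T) :=
  (uniqueDiffOn_Icc hT).prod uniqueDiffOn_univ

theorem mem_closure_interior_strip (hT : 0 < T) {p : ℝ × ℝ} (hp : p ∈ strip T) :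
    p ∈ closure (interior (strip T)) := by
  rw [strip, interior_prod_eq, interior_Icc, interior_univ, closure_prod_eq, closure_Ioo hT.ne,
    closure_univ]
  exact hp

theorem strip_mem_nhds {p : ℝ × ℝ} (hp : p.1 ∈ Ioo 0 T) : strip T ∈ 𝓝 p :=
  prod_mem_nhds (Icc_mem_nhds hp.1 hp.2) univ_mem

variable {f : ℝ × ℝ → F}

theorem hasFDerivWithinAt_strip (hf : ContDiffOn ℝ ∞ f (strip T)) {p : ℝ × ℝ} (hp : p ∈ strip T) :
    HasFDerivWithinAt f (fderivWithin ℝ f (strip T) p) (strip T) p :=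
  ((hf p hp).differentiableWithinAt (by simp)).hasFDerivWithinAt

theorem hasDerivAt_space_slice (hf : ContDiffOn ℝ ∞ f (strip T)) {t : ℝ} (ht : t ∈ Icc 0 T) (y : ℝ) :
    HasDerivAt (fun y => f (t, y)) (fderivWithin ℝ f (strip T) (t, y) (0, 1)) y := by
  have h1 : HasDerivWithinAt (fun y : ℝ => (t, y)) ((0 : ℝ), (1 : ℝ)) univ y :=
    ((hasDerivAt_const y t).prodMk (hasDerivAt_id y)).hasDerivWithinAt
  have h2 := (hasFDerivWithinAt_strip hf (p := (t, y)) (mem_strip.2 ht)).comp_hasDerivWithinAt y h1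
    (fun z _ => mem_strip.2 ht)
  rwa [hasDerivWithinAt_univ] at h2

theorem hasDerivWithinAt_time_slice (hf : ContDiffOn ℝ ∞ f (strip T)) {t : ℝ} (ht : t ∈ Icc 0 T)
    (y : ℝ) : HasDerivWithinAt (fun s => f (s, y)) (fderivWithin ℝ f (strip T) (t, y) (1, 0))
      (Icc 0 T) t := by
  have h1 : HasDerivWithinAt (fun s : ℝ => (s, y)) ((1 : ℝ), (0 : ℝ)) (Icc 0 T) t :=
    ((hasDerivAt_id t).prodMk (hasDerivAt_const t y)).hasDerivWithinAt
  exact (hasFDerivWithinAt_strip hf (p := (t, y)) (mem_strip.2 ht)).comp_hasDerivWithinAt t h1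
    (fun s hs => mem_strip.2 hs)

theorem contDiffOn_strip_fderivWithin (hT : 0 < T) (hf : ContDiffOn ℝ ∞ f (strip T)) (v : ℝ × ℝ) :
    ContDiffOn ℝ ∞ (fun p => fderivWithin ℝ f (strip T) p v) (strip T) :=
  (hf.fderivWithin (uniqueDiffOn_strip hT) (by simp)).clm_apply contDiffOn_const

/-- Symmetry of the second derivative extends to the boundary times because the strip lies in the
closure of its interior. -/
theorem fderivWithin_fderivWithin_comm (hT : 0 < T) (hf : ContDiffOn ℝ ∞ f (strip T)) {p : ℝ × ℝ}
    (hp : p ∈ strip T) (v w : ℝ × ℝ) :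
    fderivWithin ℝ (fun p => fderivWithin ℝ f (strip T) p v) (strip T) p w =
      fderivWithin ℝ (fun p => fderivWithin ℝ f (strip T) p w) (strip T) p v := by
  have hd : DifferentiableWithinAt ℝ (fderivWithin ℝ f (strip T)) (strip T) p :=
    ((hf.fderivWithin (m := ∞) (uniqueDiffOn_strip hT) (by simp)) p hp).differentiableWithinAt
      (by simp)
  have hu := uniqueDiffOn_strip hT p hp
  have h : ∀ v w, fderivWithin ℝ (fun p => fderivWithin ℝ f (strip T) p v) (strip T) p w =
      fderivWithin ℝ (fderivWithin ℝ f (strip T)) (strip T) p w v := by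
    intro v w
    rw [fderivWithin_clm_apply hu hd (differentiableWithinAt_const v)]
    simp
  rw [h, h]
  exact (hf p hp).isSymmSndFDerivWithinAt
    (by rw [minSmoothness_of_isRCLikeNormedField]; exact WithTop.coe_le_coe.2 (le_top : (2 : ℕ∞) ≤ ⊤))
    (uniqueDiffOn_strip hT) (mem_closure_interior_strip hT hp) hp w v

/-- Characteristic curves through a point of the strip, traced back to the initial time. -/
theorem exists_characteristic {f : ℝ × ℝ → ℝ} (hf : ContDiffOn ℝ ∞ f (strip T)) {L M : ℝ}
    (hM : ∀ p ∈ strip T, |f p| ≤ M) (hL : ∀ p ∈ strip T, |fderivWithin ℝ f (strip T) p (0, 1)| ≤ L)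
    {t₀ : ℝ} (ht₀ : t₀ ∈ Icc 0 T) (y₀ : ℝ) :
    ∃ y : ℝ → ℝ, y t₀ = y₀ ∧ ContinuousOn y (Icc 0 t₀) ∧
      (∀ s ∈ Icc 0 t₀, |y s - y₀| ≤ M * (t₀ - s)) ∧
      ∀ s ∈ Ioo 0 t₀, HasDerivAt y (f (s, y s)) s := by
  have hsub : ∀ s ∈ Icc 0 t₀, s ∈ Icc 0 T := fun s hs => ⟨hs.1, hs.2.trans ht₀.2⟩
  have hM0 : 0 ≤ M := (abs_nonneg _).trans (hM (t₀, 0) (mem_strip.2 ht₀))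
  have hL0 : 0 ≤ L := (abs_nonneg _).trans (hL (t₀, 0) (mem_strip.2 ht₀))
  -- The initial condition is posed at the right end `t₀`. A ball of radius `M * t₀` cannot be left
  -- at speed `M` within that time, so the curve exists back to time zero.
  have hpl : IsPicardLindelof (fun s y => f (s, y)) (tmin := 0) (tmax := t₀)
      ⟨t₀, right_mem_Icc.2 ht₀.1⟩ y₀ ⟨M * t₀, mul_nonneg hM0 ht₀.1⟩ 0 ⟨M, hM0⟩ ⟨L, hL0⟩ := by
    refine ⟨fun s hs => ?_, fun y _ => ?_, fun s hs y _ => ?_, ?_⟩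
    · refine LipschitzWith.lipschitzOnWith (lipschitzWith_of_nnnorm_deriv_le
        (fun y => (hasDerivAt_space_slice hf (hsub s hs) y).differentiableAt) fun y => ?_)
      rw [(hasDerivAt_space_slice hf (hsub s hs) y).deriv]
      exact hL _ (mem_strip.2 (hsub s hs))
    · exact hf.continuousOn.comp (by fun_prop) fun s hs => mem_strip.2 (hsub s hs)
    · exact hM _ (mem_strip.2 (hsub s hs))
    · simp only [sub_self, sub_zero, NNReal.coe_zero]
      rw [max_eq_right ht₀.1]
      exact le_rfl
  obtain ⟨y, hy0, hy⟩ := hpl.exists_eq_forall_mem_Icc_hasDerivWithinAt₀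
  refine ⟨y, hy0, fun s hs => (hy s hs).continuousWithinAt, fun s hs => ?_, fun s hs => ?_⟩
  · have h1 := (convex_Icc 0 t₀).norm_image_sub_le_of_norm_hasDerivWithin_le hy
      (fun s hs => hM _ (mem_strip.2 (hsub s hs))) (right_mem_Icc.2 ht₀.1) hs
    have hy0' : y t₀ = y₀ := hy0
    rw [Real.norm_eq_abs, Real.norm_eq_abs, hy0', abs_sub_comm s, abs_of_nonneg (sub_nonneg.2 hs.2)] at h1
    exact h1
  · exact (hy s (Ioo_subset_Icc_self hs)).hasDerivAt (Icc_mem_nhds hs.1 hs.2)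

end Strip

/-! ### Evolution of the space derivatives of a solution -/

section SolutionJets

variable {E : Type*} [NormedAddCommGroup E] [NormedSpace ℝ E] {T : ℝ} {V : ℝ → ℝ → E}

/-- The `k`-th space derivative of `V` as a function on space-time. -/
noncomputable def spaceDeriv (V : ℝ → ℝ → E) (k : ℕ) (p : ℝ × ℝ) : E :=
  jet (V p.1) p.2 k

theorem contDiff_slice (hV : ContDiffOn ℝ ∞ (fun p : ℝ × ℝ => V p.1 p.2) (strip T)) {t : ℝ}
    (ht : t ∈ Icc 0 T) : ContDiff ℝ ∞ (V t) := by
  have h : ContDiffOn ℝ ∞ (fun y : ℝ => (t, y)) univ := (contDiff_const.prodMk contDiff_id).contDiffOn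
  exact contDiffOn_univ.1 (hV.comp h fun y _ => mem_strip.2 ht)

theorem contDiffOn_spaceDeriv (hT : 0 < T)
    (hV : ContDiffOn ℝ ∞ (fun p : ℝ × ℝ => V p.1 p.2) (strip T)) (k : ℕ) :
    ContDiffOn ℝ ∞ (spaceDeriv V k) (strip T) ∧
      ∀ p ∈ strip T, fderivWithin ℝ (spaceDeriv V k) (strip T) p (0, 1) = spaceDeriv V (k + 1) p := by
  have hstep : ∀ k, ContDiffOn ℝ ∞ (spaceDeriv V k) (strip T) →
      ∀ p ∈ strip T, fderivWithin ℝ (spaceDeriv V k) (strip T) p (0, 1) = spaceDeriv V (k + 1) p := by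
    intro k hk p hp
    exact (hasDerivAt_space_slice hk (mem_strip.1 hp) p.2).unique
      (hasDerivAt_jet (contDiff_slice hV (mem_strip.1 hp)) k p.2)
  suffices h : ContDiffOn ℝ ∞ (spaceDeriv V k) (strip T) from ⟨h, hstep k h⟩
  induction k with
  | zero => exact hV.congr fun p _ => by simp [spaceDeriv, jet]
  | succ k ih =>
    exact (contDiffOn_strip_fderivWithin hT ih (0, 1)).congr fun p hp => (hstep k ih p hp).symm

variable {O : Set E} {q : E → E}
  {𝔸 : E → E →L[ℝ] E}
  {Φ : ℕ → (ℕ → E) → E}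

/-- Time derivatives of the space derivatives of a solution. -/
theorem fderivWithin_spaceDeriv_time (hT : 0 < T)
    (hV : ContDiffOn ℝ ∞ (fun p : ℝ × ℝ => V p.1 p.2) (strip T))
    (hVO : ∀ t ∈ Icc 0 T, ∀ x, V t x ∈ O)
    (hΦ0 : ∀ J, Φ 0 J = q (J 0))
    (hΦ : ∀ W : ℝ → E, ContDiff ℝ ∞ W → (∀ x, W x ∈ O) → ∀ k x,
        HasDerivAt (fun x => Φ k (jet W x) - 𝔸 (W x) (jet W x (k + 1)))
          (Φ (k + 1) (jet W x) - 𝔸 (W x) (jet W x (k + 2))) x)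
    (heq : ∀ t ∈ Icc 0 T, ∀ x,
      derivWithin (fun s => V s x) (Icc 0 T) t + 𝔸 (V t x) (deriv (V t) x) = q (V t x)) (k : ℕ) :
    ∀ p ∈ strip T, fderivWithin ℝ (spaceDeriv V k) (strip T) p (1, 0) =
      Φ k (jet (V p.1) p.2) - 𝔸 (V p.1 p.2) (spaceDeriv V (k + 1) p) := by
  induction k with
  | zero =>
    rintro ⟨t, y⟩ hp
    have ht := mem_strip.1 hp
    have h1 := hasDerivWithinAt_time_slice (contDiffOn_spaceDeriv hT hV 0).1 ht y
    have h2 : derivWithin (fun s => V s y) (Icc 0 T) t = _ :=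
      HasDerivWithinAt.derivWithin (by simpa [spaceDeriv, jet] using h1)
        (uniqueDiffOn_Icc hT t ht)
    have h3 := heq t ht y
    rw [h2] at h3
    rw [eq_sub_iff_add_eq]
    simpa [hΦ0, spaceDeriv, jet] using h3
  | succ k ih =>
    rintro ⟨t, y⟩ hp
    have ht := mem_strip.1 hp
    obtain ⟨hk, hk1⟩ := contDiffOn_spaceDeriv hT hV k
    -- Time and space derivatives are exchanged, and the formula already known at order `k` is then
    -- differentiated in space.
    rw [fderivWithin_congr (fun p hp => (hk1 p hp).symm) (hk1 _ hp).symm,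
      fderivWithin_fderivWithin_comm hT hk hp, fderivWithin_congr (fun p hp => ih p hp) (ih _ hp)]
    have h1 : ContDiffOn ℝ ∞ (fun p : ℝ × ℝ => Φ k (jet (V p.1) p.2) -
        𝔸 (V p.1 p.2) (spaceDeriv V (k + 1) p)) (strip T) :=
      (contDiffOn_strip_fderivWithin hT hk (1, 0)).congr fun p hp => (ih p hp).symm
    exact (hasDerivAt_space_slice h1 ht y).unique (hΦ (V t) (contDiff_slice hV ht) (hVO t ht) k y)

/-- The derivative of a space derivative of a solution along a curve in space-time. -/
theorem hasDerivAt_spaceDeriv_curve (hT : 0 < T)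
    (hV : ContDiffOn ℝ ∞ (fun p : ℝ × ℝ => V p.1 p.2) (strip T)) {y : ℝ → ℝ} {s y' : ℝ}
    (hs : s ∈ Ioo 0 T) (hy : HasDerivAt y y' s) (k : ℕ) :
    HasDerivAt (fun s => jet (V s) (y s) k)
      (fderivWithin ℝ (spaceDeriv V k) (strip T) (s, y s) (1, 0) + y' • jet (V s) (y s) (k + 1)) s := by
  obtain ⟨hk, hk1⟩ := contDiffOn_spaceDeriv hT hV k
  have hp : (s, y s) ∈ strip T := mem_strip.2 (Ioo_subset_Icc_self hs)
  have h1 := (hasFDerivWithinAt_strip hk hp).hasFDerivAt (strip_mem_nhds hs)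
  have h2 := h1.comp_hasDerivAt s ((hasDerivAt_id s).prodMk hy)
  refine h2.congr_deriv ?_
  have h3 : ((1 : ℝ), y') = (1, 0) + y' • (0, 1) := by simp
  rw [h3, map_add, map_smul, hk1 _ hp]
  rfl

end SolutionJets

/-! ### Algebraic decoupling of the characteristic families -/

section GaugeAlgebra

variable {ι R : Type*} [Fintype ι] [DecidableEq ι] [Ring R] [Algebra ℝ R]

/-- The lower order correction which removes the coupling between the characteristic families. -/
noncomputable def gaugeOp (l : ι → ℝ) (P D : ι → R) (E : R) : R :=
  ∑ a, ∑ b ∈ Finset.univ.erase a, (-(l a - l b)⁻¹) • (P a * (E + l a • D a) * P b)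

/-- Multiply on the right by `P k`. For `k ≠ j` the factor `l j • 1 - M` becomes the gap `l j - l
k`, which cancels the denominator in the gauge and removes the coupling; here `D j * P k = P j * D j
* P k` is needed. For `k = j` the gauge contributes nothing, and the diagonal rate `τ` remains. -/
theorem gauge_identity {M : R} {l : ι → ℝ} {P : ι → R} (hl : Function.Injective l)
    (idem : ∀ j, P j * P j = P j) (orth : ∀ j k, j ≠ k → P j * P k = 0) (hsum : ∑ j, P j = 1)
    (hM : ∀ j, M * P j = l j • P j) {D : ι → R} {j : ι} (hD : D j = P j * D j + D j * P j)
    {E : R} {τ : ℝ} (hτ : P j * E * P j = τ • P j) :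
    P j * E + P j * gaugeOp l P D E * (l j • 1 - M) + l j • D j =
      τ • P j + l j • (D j * P j) := by
  have hPP : ∀ a b, P a * P b = if a = b then P a else 0 := fun a b => by
    split_ifs with hab
    · rw [hab, idem]
    · exact orth a b hab
  -- Since the projections sum to one, an operator is determined by its products with them.
  suffices hk : ∀ k, (P j * E + P j * gaugeOp l P D E * (l j • 1 - M) + l j • D j) * P k =
      (τ • P j + l j • (D j * P j)) * P k by
    have := Finset.sum_congr rfl fun k (_ : k ∈ Finset.univ) => hk k
    rwa [← Finset.mul_sum, ← Finset.mul_sum, hsum, mul_one, mul_one] at this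
  intro k
  have hMk : (l j • 1 - M) * P k = (l j - l k) • P k := by
    rw [sub_mul, hM, smul_mul_assoc, one_mul, sub_smul]
  have hG : P j * gaugeOp l P D E * P k =
      if k = j then 0 else (-(l j - l k)⁻¹) • (P j * (E + l j • D j) * P k) := by
    rw [gaugeOp, Finset.mul_sum, Finset.sum_mul, Finset.sum_eq_single j]
    · rw [Finset.mul_sum, Finset.sum_mul]
      have hterm : ∀ b, P j * ((-(l j - l b)⁻¹) • (P j * (E + l j • D j) * P b)) * P k =
          if b = k then (-(l j - l k)⁻¹) • (P j * (E + l j • D j) * P k) else 0 := by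
        intro b
        rw [mul_smul_comm, smul_mul_assoc, ← mul_assoc, ← mul_assoc, idem, mul_assoc _ (P b),
          hPP]
        split_ifs with hbk
        · rw [hbk]
        · rw [mul_zero, smul_zero]
      simp only [hterm, Finset.sum_ite_eq', Finset.mem_erase, Finset.mem_univ, and_true]
      by_cases hkj : k = j <;> simp [hkj]
    · intro a _ haj
      rw [Finset.mul_sum, Finset.sum_mul]
      refine Finset.sum_eq_zero fun b _ => ?_
      rw [mul_smul_comm, smul_mul_assoc, ← mul_assoc, ← mul_assoc, orth j a haj.symm]
      simp
    · simp
  rw [add_mul, add_mul, mul_assoc (P j * gaugeOp l P D E), hMk, mul_smul_comm, hG]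
  by_cases hkj : k = j
  · subst hkj
    rw [if_pos rfl, smul_zero, add_zero, hτ, add_mul, smul_mul_assoc _ (P k), idem,
      smul_mul_assoc, smul_mul_assoc, mul_assoc (D k), idem]
  · have hne : l j - l k ≠ 0 := sub_ne_zero.2 fun hjk => hkj (hl hjk).symm
    have hDk : D j * P k = P j * D j * P k := by
      conv_lhs => rw [hD]
      rw [add_mul, mul_assoc (D j), orth j k (Ne.symm hkj), mul_zero, add_zero]
    rw [if_neg hkj, smul_smul, mul_neg, mul_inv_cancel₀ hne, neg_one_smul, mul_add, add_mul,
      mul_smul_comm, smul_mul_assoc, smul_mul_assoc, ← hDk, add_mul, smul_mul_assoc,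
      orth j k (Ne.symm hkj), smul_zero, smul_mul_assoc, mul_assoc (D j),
      orth j k (Ne.symm hkj)]
    simp

end GaugeAlgebra

theorem tendsto_zero_clm_apply {α F G : Type*} [NormedAddCommGroup F] [NormedSpace ℝ F]
    [NormedAddCommGroup G] [NormedSpace ℝ G] {m : Filter α} {f : α → F →L[ℝ] G} {g : α → F}
    (hf : ∃ C, ∀ x, ‖f x‖ ≤ C) (hg : Tendsto g m (𝓝 0)) : Tendsto (fun x => f x (g x)) m (𝓝 0) := by
  obtain ⟨C, hC⟩ := hf
  have h := hg.norm.const_mul C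
  rw [norm_zero, mul_zero] at h
  exact squeeze_zero_norm (fun x => (f x).le_of_opNorm_le (hC x) _) h

/-! ### Growth rates along a hyperbolic profile -/

section HyperbolicTube

variable {ι E : Type*} [Fintype ι] [NormedAddCommGroup E] [InnerProductSpace ℝ E]

/-- A stationary profile inside a tube on which the system is hyperbolic, with a smooth spectral
resolution, non-characteristic and damped at infinity. -/
structure IsHyperbolicTube (tr : (E →L[ℝ] E) →L[ℝ] ℝ) (O Kc : Set (E)) (r : ℝ) (W : ℝ → E)
    (𝔸 : E → E →L[ℝ] E) (q : E → E)
    (l : ι → E → ℝ) (P : ι → E → E →L[ℝ] E)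
    (σ : ι → ℝ) (c₀ κ : ℝ) : Prop where
  tube : IsTube O Kc r W
  smooth_A : ContDiffOn ℝ ∞ 𝔸 O
  smooth_q : ContDiffOn ℝ ∞ q O
  smooth_l : ∀ j, ContDiffOn ℝ ∞ (l j) O
  smooth_P : ∀ j, ContDiffOn ℝ ∞ (P j) O
  frame : ∀ u ∈ O, IsSpectralFrame tr (𝔸 u) (fun j => l j u) (fun j => P j u)
  stationary : ∀ x, 𝔸 (W x) (jet W x 1) = q (W x)
  pos : 0 < c₀
  damping_pos : 0 < κ
  sign : ∀ j, |σ j| = 1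
  speed : ∀ j x, c₀ ≤ σ j * l j (W x)
  damping : ∀ j, ∀ᶠ x in cocompact ℝ, tr (P j (W x) * fderiv ℝ q (W x)) ≤ -κ

variable {tr : (E →L[ℝ] E) →L[ℝ] ℝ} {O Kc : Set (E)} {r : ℝ} {W : ℝ → E}
  {𝔸 : E → E →L[ℝ] E} {q : E → E}
  {l : ι → E → ℝ} {P : ι → E → E →L[ℝ] E}
  {σ : ι → ℝ} {c₀ κ : ℝ}

/-- The derivative of the `j`-th spectral projection along the profile. -/
noncomputable def projDeriv (W : ℝ → E)
    (P : ι → E → E →L[ℝ] E) (j : ι) (x : ℝ) :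
    E →L[ℝ] E :=
  fderiv ℝ (P j) (W x) (jet W x 1)

theorem IsHyperbolicTube.mem (h : IsHyperbolicTube tr O Kc r W 𝔸 q l P σ c₀ κ) (x : ℝ) : W x ∈ O :=
  h.tube.subset (h.tube.mem x)

/-- This is the derivative of `P² = P` along the profile. -/
theorem IsHyperbolicTube.projDeriv_eq (h : IsHyperbolicTube tr O Kc r W 𝔸 q l P σ c₀ κ) (j : ι)
    (x : ℝ) : projDeriv W P j x = P j (W x) * projDeriv W P j x + projDeriv W P j x * P j (W x) := by
  have h1 := h.tube.hasDerivAt_comp (h.smooth_P j) x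
  have h2 := h1.mul h1
  have h3 : (fun x => P j (W x)) * (fun x => P j (W x)) = fun x => P j (W x) := by
    ext1 x; exact (h.frame _ (h.mem x)).idem j
  rw [h3] at h2
  rw [add_comm]
  exact h1.unique h2

theorem IsHyperbolicTube.bddC1_projDeriv (h : IsHyperbolicTube tr O Kc r W 𝔸 q l P σ c₀ κ)
    (j : ι) : BddC1 (projDeriv W P j) :=
  BddC1.bilinear (ContinuousLinearMap.id ℝ _)
    (h.tube.bddC1_comp (contDiffOn_fderiv h.tube.isOpen (h.smooth_P j)))
    (h.tube.bddC1_iteratedDeriv 1)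

theorem IsHyperbolicTube.tendsto_projDeriv (h : IsHyperbolicTube tr O Kc r W 𝔸 q l P σ c₀ κ)
    (j : ι) : Tendsto (projDeriv W P j) (cocompact ℝ) (𝓝 0) :=
  tendsto_zero_clm_apply
    (h.tube.bddC1_comp (contDiffOn_fderiv h.tube.isOpen (h.smooth_P j))).bdd
    (h.tube.tendsto 1 le_rfl)

variable [DecidableEq ι]

/-- The gauge operator along the profile. -/
noncomputable def profileGauge (W : ℝ → E) (l : ι → E → ℝ)
    (P : ι → E → E →L[ℝ] E)
    (B : ℝ → E →L[ℝ] E) (x : ℝ) : E →L[ℝ] E :=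
  gaugeOp (fun j => l j (W x)) (fun j => P j (W x)) (fun j => projDeriv W P j x) (B x)

theorem IsHyperbolicTube.bddC1_profileGauge (h : IsHyperbolicTube tr O Kc r W 𝔸 q l P σ c₀ κ)
    {B : ℝ → E →L[ℝ] E} (hE : BddC1 B) : BddC1 (profileGauge W l P B) := by
  unfold profileGauge gaugeOp
  refine BddC1.sum fun a _ => BddC1.sum fun b hb => BddC1.smul ?_ (BddC1.mul (BddC1.mul
    (h.tube.bddC1_comp (h.smooth_P a)) (hE.add (BddC1.smul (h.tube.bddC1_comp (h.smooth_l a))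
      (h.bddC1_projDeriv a)))) (h.tube.bddC1_comp (h.smooth_P b)))
  refine h.tube.bddC1_comp (g := fun u => -(l a u - l b u)⁻¹)
    (((h.smooth_l a).sub (h.smooth_l b)).inv fun u hu h0 => ?_).neg
  exact Finset.ne_of_mem_erase hb ((h.frame u hu).injective (sub_eq_zero.1 h0)).symm

omit [DecidableEq ι]

/-- The growth rate of the `j`-th characteristic component along the profile. -/
noncomputable def growthRate (tr : (E →L[ℝ] E) →L[ℝ] ℝ) (W : ℝ → E) (l : ι → E → ℝ)
    (P : ι → E → E →L[ℝ] E)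
    (B : ℝ → E →L[ℝ] E) (j : ι) (x : ℝ) : ℝ :=
  tr (P j (W x) * B x) + ‖l j (W x) • projDeriv W P j x‖

/-- Near infinity `β` and the derivative of the projection use up at most half of the damping `κ`.
On the remaining compact set the rate is bounded and `1 / (1 + x²)` is bounded below. This profile
is chosen because it is the derivative of the bounded function `arctan`. -/
theorem IsHyperbolicTube.exists_growthRate_le (h : IsHyperbolicTube tr O Kc r W 𝔸 q l P σ c₀ κ)
    {β : ℝ → E →L[ℝ] E} (hβ : BddC1 β) (hβ0 : Tendsto β (cocompact ℝ) (𝓝 0))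
    (j : ι) : ∃ M, 0 ≤ M ∧ ∀ x,
      growthRate tr W l P (fun x => fderiv ℝ q (W x) + β x) j x ≤ -(κ / 2) + M / (1 + x ^ 2) := by
  have hP := h.tube.bddC1_comp (h.smooth_P j)
  have hl := h.tube.bddC1_comp (h.smooth_l j)
  have hq := h.tube.bddC1_comp (contDiffOn_fderiv h.tube.isOpen h.smooth_q)
  have hsmall : Tendsto (fun x => tr (P j (W x) * β x) + ‖l j (W x) • projDeriv W P j x‖)
      (cocompact ℝ) (𝓝 0) := by
    have h1 : Tendsto (fun x => P j (W x) * β x) (cocompact ℝ) (𝓝 0) :=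
      tendsto_zero_bilinear (ContinuousLinearMap.mul ℝ
        (E →L[ℝ] E)).flip hβ0 hP.bdd
    have h2 : Tendsto (fun x => l j (W x) • projDeriv W P j x) (cocompact ℝ) (𝓝 0) :=
      tendsto_zero_bilinear (ContinuousLinearMap.lsmul ℝ ℝ :
        ℝ →L[ℝ] (E →L[ℝ] E) →L[ℝ] _).flip (h.tendsto_projDeriv j) hl.bdd
    have h3 := (tr.continuous.tendsto 0).comp h1
    rw [map_zero] at h3
    have h4 := h3.add h2.norm
    rwa [norm_zero, add_zero] at h4
  have hev : ∀ᶠ x in cocompact ℝ,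
      growthRate tr W l P (fun x => fderiv ℝ q (W x) + β x) j x ≤ -(κ / 2) := by
    filter_upwards [h.damping j, hsmall.eventually_lt_const (half_pos h.damping_pos)] with x h1 h2
    have h3 : growthRate tr W l P (fun x => fderiv ℝ q (W x) + β x) j x =
        tr (P j (W x) * fderiv ℝ q (W x)) +
          (tr (P j (W x) * β x) + ‖l j (W x) • projDeriv W P j x‖) := by
      rw [growthRate, mul_add, map_add, add_assoc]
    rw [h3]; linarith
  obtain ⟨C, hC⟩ := ((hP.mul (hq.add hβ)).clm (tr)).bdd
  obtain ⟨D, hD⟩ := (hl.smul (h.bddC1_projDeriv j)).bdd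
  have hbound : ∀ x, growthRate tr W l P (fun x => fderiv ℝ q (W x) + β x) j x ≤ C + D := fun x =>
    add_le_add ((le_abs_self _).trans (hC x)) (hD x)
  obtain ⟨S, hS, hSc⟩ := mem_cocompact.1 hev
  obtain ⟨ρ, hρ⟩ := hS.isBounded.subset_closedBall 0
  have hC0 : 0 ≤ C := (norm_nonneg _).trans (hC 0)
  have hD0 : 0 ≤ D := (norm_nonneg _).trans (hD 0)
  have hκ := h.damping_pos
  -- On `|x| ≤ ρ` this constant makes the correction at least `C + D + κ / 2`.
  refine ⟨(C + D + κ / 2) * (1 + ρ ^ 2), by positivity, fun x => ?_⟩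
  by_cases hx : x ∈ S
  · have h1 : |x| ≤ ρ := by simpa using hρ hx
    have h2 : x ^ 2 ≤ ρ ^ 2 := by
      rw [← sq_abs x]; gcongr
    have h3 : C + D + κ / 2 ≤ (C + D + κ / 2) * (1 + ρ ^ 2) / (1 + x ^ 2) := by
      rw [le_div_iff₀ (by positivity)]
      gcongr
    linarith [hbound x]
  · have h1 : growthRate tr W l P (fun x => fderiv ℝ q (W x) + β x) j x ≤ -(κ / 2) := hSc hx
    have : 0 ≤ (C + D + κ / 2) * (1 + ρ ^ 2) / (1 + x ^ 2) := by positivity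
    linarith

end HyperbolicTube

/-! ### Error scales for jets near the profile -/

section JetConfig

/-- A jet `J` based at the point `x`, together with the speed `d` of the shift and the scales
`e`, `h` and `ε` in terms of which it is measured. -/
structure JetConfig (E : Type*) where
  x : ℝ
  d : ℝ
  e : ℝ
  h : ℝ
  ε : ℝ
  J : ℕ → E

variable {E F G : Type*} [NormedAddCommGroup E] [NormedSpace ℝ E] [NormedAddCommGroup F]
  [NormedSpace ℝ F] [NormedAddCommGroup G] [NormedSpace ℝ G]

theorem isBigO_clm_apply {α : Type*} {m : Filter α} {T : α → F →L[ℝ] G} {v : α → F} {f g : α → ℝ}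
    (hT : T =O[m] f) (hv : v =O[m] g) : (fun η => T η (v η)) =O[m] fun η => f η * g η := by
  refine IsBigO.trans (isBigO_of_le m fun η => ?_) (hT.norm_left.mul hv.norm_left)
  rw [norm_mul, norm_norm, norm_norm]
  exact (T η).le_opNorm (v η)

theorem isBigO_clm_apply_right {α : Type*} {m : Filter α} {T : α → F →L[ℝ] G} {v : α → F}
    {g : α → ℝ} (hT : T =O[m] fun _ => (1 : ℝ)) (hv : v =O[m] g) :
    (fun η => T η (v η)) =O[m] g := by
  simpa using isBigO_clm_apply hT hv

theorem isBigO_smul_right {α : Type*} {m : Filter α} {c : α → ℝ} {v : α → F}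
    {g : α → ℝ} (hc : c =O[m] fun _ => (1 : ℝ)) (hv : v =O[m] g) :
    (fun η => c η • v η) =O[m] g := by
  simpa using hc.smul hv

namespace JetConfig

/-- The deviation of the `a`-th derivative from that of the profile. -/
noncomputable def disp (W : ℝ → E) (a : ℕ) (η : JetConfig E) : E := η.J a - jet W η.x a

/-- The size allowed for the derivatives of order `K`. -/
def size (K : ℕ) (η : JetConfig E) : ℝ := η.e * η.h ^ (K - 1)

/-- Jets close to that of the profile. -/
def admissible (W : ℝ → E) (K : ℕ) (C₀ r : ℝ) : Set (JetConfig E) :=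
  {η | JetClose W K C₀ r η.x η.J η.e η.h ∧ η.e ≤ η.ε ∧ |η.d| ≤ η.ε ∧ η.ε ≤ 1}

/-- The total of the terms which are of lower order or have a small factor. -/
noncomputable def err (W : ℝ → E) (K : ℕ) (η : JetConfig E) : ℝ :=
  ∑ a ∈ Finset.range K, ‖disp W a η‖ + η.ε * size K η + |η.d|

variable {W : ℝ → E} {K : ℕ} {C₀ r : ℝ}

theorem size_nonneg {η : JetConfig E} (hη : η ∈ admissible W K C₀ r) : 0 ≤ size K η :=
  mul_nonneg hη.1.nonneg (pow_nonneg (zero_le_one.trans hη.1.one_le) _)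

theorem eps_nonneg {η : JetConfig E} (hη : η ∈ admissible W K C₀ r) : 0 ≤ η.ε :=
  hη.1.nonneg.trans hη.2.1

theorem le_size {η : JetConfig E} (hη : η ∈ admissible W K C₀ r) : η.e ≤ size K η :=
  le_mul_of_one_le_right hη.1.nonneg (one_le_pow₀ hη.1.one_le)

theorem le_err {η : JetConfig E} (hη : η ∈ admissible W K C₀ r) :
    (∀ a < K, ‖disp W a η‖ ≤ err W K η) ∧ η.ε * size K η ≤ err W K η ∧ |η.d| ≤ err W K η := by
  have h1 : 0 ≤ ∑ a ∈ Finset.range K, ‖disp W a η‖ := Finset.sum_nonneg fun _ _ => norm_nonneg _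
  have h2 : 0 ≤ η.ε * size K η := mul_nonneg (eps_nonneg hη) (size_nonneg hη)
  have h3 := abs_nonneg η.d
  refine ⟨fun a ha => ?_, ?_, ?_⟩
  · have := Finset.single_le_sum (f := fun a => ‖disp W a η‖) (fun _ _ => norm_nonneg _)
      (Finset.mem_range.2 ha)
    unfold err; linarith
  · unfold err; linarith
  · unfold err; linarith

theorem disp_isBigO_err {a : ℕ} (ha : a < K) : disp W a =O[𝓟 (admissible W K C₀ r)] err W K :=
  isBigO_principal.2 ⟨1, fun η hη => by
    rw [one_mul]; exact ((le_err hη).1 a ha).trans (le_abs_self _)⟩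

theorem eps_mul_size_isBigO_err :
    (fun η : JetConfig E => η.ε * size K η) =O[𝓟 (admissible W K C₀ r)] err W K :=
  isBigO_principal.2 ⟨1, fun η hη => by
    rw [one_mul, Real.norm_of_nonneg (mul_nonneg (eps_nonneg hη) (size_nonneg hη))]
    exact (le_err hη).2.1.trans (le_abs_self _)⟩

theorem d_isBigO_err : (fun η : JetConfig E => η.d) =O[𝓟 (admissible W K C₀ r)] err W K :=
  isBigO_principal.2 ⟨1, fun η hη => by
    rw [one_mul]
    exact (le_err hη).2.2.trans (le_abs_self _)⟩

theorem d_isBigO_eps :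
    (fun η : JetConfig E => η.d) =O[𝓟 (admissible W K C₀ r)] fun η : JetConfig E => η.ε :=
  isBigO_principal.2 ⟨1, fun η hη => by
    rw [one_mul]
    exact hη.2.2.1.trans (le_abs_self _)⟩

theorem eps_isBigO_one :
    (fun η : JetConfig E => η.ε) =O[𝓟 (admissible W K C₀ r)] fun _ => (1 : ℝ) :=
  isBigO_principal.2 ⟨1, fun η hη => by
    rw [Real.norm_of_nonneg (eps_nonneg hη)]
    simpa using hη.2.2.2⟩

theorem norm_disp_zero_le {η : JetConfig E} (hη : η ∈ admissible W K C₀ r) :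
    ‖disp W 0 η‖ ≤ η.e := by
  simpa [disp, jet] using hη.1.base

theorem disp_zero_isBigO_eps :
    disp W 0 =O[𝓟 (admissible W K C₀ r)] fun η : JetConfig E => η.ε :=
  isBigO_principal.2 ⟨1, fun η hη => by
    rw [one_mul]
    exact ((norm_disp_zero_le hη).trans hη.2.1).trans (le_abs_self _)⟩

theorem disp_one_isBigO_eps (hK : 1 ≤ K) :
    disp W 1 =O[𝓟 (admissible W K C₀ r)] fun η : JetConfig E => η.ε :=
  isBigO_principal.2 ⟨|C₀|, fun η hη => by
    -- At order one the power of `h` is trivial, so the smallness `e ≤ ε` carries over.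
    have h1 := hη.1.deriv 1 le_rfl hK
    simp only [Nat.sub_self, pow_zero, mul_one] at h1
    refine h1.trans (mul_le_mul (le_abs_self _) (hη.2.1.trans (le_abs_self _)) hη.1.nonneg
      (abs_nonneg _))⟩

theorem disp_isBigO_size {a : ℕ} (ha : a ≤ K) :
    disp W a =O[𝓟 (admissible W K C₀ r)] size K := by
  rcases Nat.eq_zero_or_pos a with rfl | ha0
  · exact isBigO_principal.2 ⟨1, fun η hη => by
      rw [one_mul]
      exact ((norm_disp_zero_le hη).trans (le_size hη)).trans (le_abs_self _)⟩
  · refine isBigO_principal.2 ⟨|C₀|, fun η hη => ?_⟩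
    have h1 := hη.1.one_le
    have h2 := hη.1.nonneg
    have h3 : η.e * η.h ^ (a - 1) ≤ size K η := by
      unfold size; gcongr
    calc _ ≤ C₀ * (η.e * η.h ^ (a - 1)) := hη.1.deriv a ha0 ha
      _ ≤ |C₀| * ‖size K η‖ := mul_le_mul (le_abs_self _) (h3.trans (le_abs_self _))
        (by positivity) (abs_nonneg _)

omit [NormedSpace ℝ F] in
theorem isBigO_one_of_bdd {f : ℝ → F} (hf : ∃ C, ∀ x, ‖f x‖ ≤ C) :
    (fun η : JetConfig E => f η.x) =O[𝓟 (admissible W K C₀ r)] fun _ => (1 : ℝ) := by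
  obtain ⟨C, hC⟩ := hf
  exact isBigO_principal.2 ⟨C, fun η _ => by simpa using hC η.x⟩

variable {O Kc : Set E}

theorem base_mem {η : JetConfig E} (hη : η ∈ admissible W K C₀ r) :
    η.J 0 ∈ Metric.closedBall (W η.x) r := by
  rw [mem_closedBall_iff_norm]; exact hη.1.base.trans hη.1.le_radius

theorem comp_sub_isBigO (hT : IsTube O Kc r W) {g : E → F} (hg : ContDiffOn ℝ ∞ g O) :
    (fun η : JetConfig E => g (η.J 0) - g (W η.x)) =O[𝓟 (admissible W K C₀ r)] disp W 0 := by
  obtain ⟨C, -, hC⟩ := hT.exists_lipschitz hg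
  refine isBigO_principal.2 ⟨C, fun η hη => ?_⟩
  simpa [disp, jet] using hC η.x _ (base_mem hη)

theorem comp_isBigO_one (hT : IsTube O Kc r W) {g : E → F} (hg : ContDiffOn ℝ ∞ g O) :
    (fun η : JetConfig E => g (η.J 0)) =O[𝓟 (admissible W K C₀ r)] fun _ => (1 : ℝ) := by
  obtain ⟨C, -, hC⟩ := hT.exists_bound hg.continuousOn
  exact isBigO_principal.2 ⟨C, fun η hη => by
    simpa using hC _ (hT.closedBall_subset _ (base_mem hη))⟩

theorem comp_profile_isBigO_one (hT : IsTube O Kc r W) {g : E → F} (hg : ContDiffOn ℝ ∞ g O) :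
    (fun η : JetConfig E => g (W η.x)) =O[𝓟 (admissible W K C₀ r)] fun _ => (1 : ℝ) :=
  isBigO_one_of_bdd (hT.bddC1_comp hg).bdd

end JetConfig

end JetConfig

/-! ### Equations along characteristics -/

section CharacteristicRate

namespace JetConfig

variable {ι E : Type*} [NormedAddCommGroup E] [InnerProductSpace ℝ E]

/-- The derivative of the `a`-th space derivative of a solution along a `j`-characteristic. -/
noncomputable def jetRate (𝔸 : E → E →L[ℝ] E) (l : ι → E → ℝ) (Φ : ℕ → (ℕ → E) → E) (j : ι) (a : ℕ)
    (η : JetConfig E) : E :=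
  Φ a η.J - 𝔸 (η.J 0) (η.J (a + 1)) + l j (η.J 0) • η.J (a + 1)

/-- The derivative of the `a`-th derivative of the perturbation along a `j`-characteristic. -/
noncomputable def dispRate (W : ℝ → E) (𝔸 : E → E →L[ℝ] E) (l : ι → E → ℝ) (Φ : ℕ → (ℕ → E) → E)
    (j : ι) (a : ℕ) (η : JetConfig E) : E :=
  jetRate 𝔸 l Φ j a η - (l j (η.J 0) - η.d) • jet W η.x (a + 1)

/-- The part of `dispRate` which does not contain the next derivative of the perturbation. -/
noncomputable def remainder (W : ℝ → E) (𝔸 : E → E →L[ℝ] E) (Φ : ℕ → (ℕ → E) → E)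
    (a : ℕ) (η : JetConfig E) : E :=
  Φ a η.J - Φ a (jet W η.x) - (𝔸 (η.J 0) - 𝔸 (W η.x)) (jet W η.x (a + 1)) +
    η.d • jet W η.x (a + 1)

variable {tr : (E →L[ℝ] E) →L[ℝ] ℝ} {O Kc : Set E} {r : ℝ} {W : ℝ → E}
  {𝔸 : E → E →L[ℝ] E} {q : E → E} {l : ι → E → ℝ} {P : ι → E → E →L[ℝ] E}
  {σ : ι → ℝ} {c₀ κ : ℝ} {Φ : ℕ → (ℕ → E) → E} {K : ℕ} {C₀ : ℝ}

/-- Subtracting the differentiated profile equation `hΦW` leaves one principal term, with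
coefficient `l j - 𝔸` evaluated at the perturbed state. -/
theorem dispRate_eq (hΦW : ∀ a x, Φ a (jet W x) = 𝔸 (W x) (jet W x (a + 1))) (j : ι) (a : ℕ)
    (η : JetConfig E) : dispRate W 𝔸 l Φ j a η =
      (l j (η.J 0) • 1 - 𝔸 (η.J 0)) (disp W (a + 1) η) + remainder W 𝔸 Φ a η := by
  simp only [dispRate, jetRate, remainder, disp, hΦW, sub_apply, smul_apply, one_apply_eq_self,
    map_sub, sub_smul]
  abel

/-- Apart from the increment of `Φ`, the remainder consists of the variation of `𝔸` and the shift,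
both multiplied by bounded derivatives of the profile. -/
theorem remainder_sub_isBigO (hT : IsTube O Kc r W) (h𝔸 : ContDiffOn ℝ ∞ 𝔸 O) {a : ℕ}
    {f : JetConfig E → E} {g : JetConfig E → ℝ}
    (h : (fun η => Φ a η.J - Φ a (jet W η.x) - f η) =O[𝓟 (admissible W K C₀ r)] g)
    (h0 : disp W 0 =O[𝓟 (admissible W K C₀ r)] g)
    (hd : (fun η => η.d) =O[𝓟 (admissible W K C₀ r)] g) :
    (fun η => remainder W 𝔸 Φ a η - f η) =O[𝓟 (admissible W K C₀ r)] g := by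
  have hW : (fun η : JetConfig E => jet W η.x (a + 1)) =O[𝓟 (admissible W K C₀ r)]
      fun _ => (1 : ℝ) := isBigO_one_of_bdd (hT.bdd (a + 1))
  have h1 := isBigO_clm_apply ((comp_sub_isBigO (K := K) (C₀ := C₀) hT h𝔸).norm_right.trans
    h0.norm_left) hW
  have h2 := hd.smul hW
  simp only [mul_one, smul_eq_mul] at h1 h2
  refine ((h.sub h1).add h2).congr_left fun η => ?_
  simp only [remainder]
  abel

variable [Fintype ι]

/-- The projection onto the `j`-th family annihilates `l j - 𝔸`, and with it the only term that
contains one more derivative. -/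
theorem proj_dispRate (hΦW : ∀ a x, Φ a (jet W x) = 𝔸 (W x) (jet W x (a + 1)))
    {η : JetConfig E} {j : ι}
    (hfr : IsSpectralFrame tr (𝔸 (η.J 0)) (fun j => l j (η.J 0)) (fun j => P j (η.J 0)))
    (a : ℕ) : P j (η.J 0) (dispRate W 𝔸 l Φ j a η) = P j (η.J 0) (remainder W 𝔸 Φ a η) := by
  have h : P j (η.J 0) * (l j (η.J 0) • 1 - 𝔸 (η.J 0)) = 0 := by
    rw [mul_sub, hfr.proj_mul, mul_smul_comm, mul_one, sub_self]
  have h2 := congr($h (disp W (a + 1) η))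
  rw [mul_apply_eq_comp] at h2
  rw [dispRate_eq hΦW, map_add, h2, zero_apply, zero_add]

variable [DecidableEq ι]

/-- The diagonalised perturbation of order `K` in the `j`-th family. -/
noncomputable def charComp (W : ℝ → E) (P : ι → E → E →L[ℝ] E) (B : ℝ → E →L[ℝ] E) (j : ι) (K : ℕ)
    (η : JetConfig E) : E :=
  P j (η.J 0) (disp W K η + B η.x (disp W (K - 1) η))

/-- The derivative of `charComp` along a `j`-characteristic. -/
noncomputable def charRate (W : ℝ → E) (𝔸 : E → E →L[ℝ] E) (l : ι → E → ℝ)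
    (P : ι → E → E →L[ℝ] E) (Φ : ℕ → (ℕ → E) → E) (B : ℝ → E →L[ℝ] E) (j : ι) (K : ℕ)
    (η : JetConfig E) : E :=
  fderiv ℝ (P j) (η.J 0) (jetRate 𝔸 l Φ j 0 η) (disp W K η + B η.x (disp W (K - 1) η)) +
    P j (η.J 0) (dispRate W 𝔸 l Φ j K η + ((l j (η.J 0) - η.d) • deriv B η.x (disp W (K - 1) η) +
      B η.x (dispRate W 𝔸 l Φ j (K - 1) η)))

omit [DecidableEq ι] in
-- To leading order the state itself moves along a characteristic like the profile traversed at
-- speed `l j`. This identifies the term produced by differentiating the projection.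
theorem jetRate_sub_isBigO_eps (hh : IsHyperbolicTube tr O Kc r W 𝔸 q l P σ c₀ κ) (hK : 1 ≤ K)
    (hΦ0 : ∀ J, Φ 0 J = q (J 0)) (hΦW : ∀ a x, Φ a (jet W x) = 𝔸 (W x) (jet W x (a + 1))) (j : ι) :
    (fun η : JetConfig E => jetRate 𝔸 l Φ j 0 η - l j (W η.x) • jet W η.x 1)
      =O[𝓟 (admissible W K C₀ r)] fun η => η.ε := by
  have h0 := disp_zero_isBigO_eps (W := W) (K := K) (C₀ := C₀) (r := r)
  have hrem : (fun η => remainder W 𝔸 Φ 0 η - 0) =O[𝓟 (admissible W K C₀ r)] fun η => η.ε := by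
    refine remainder_sub_isBigO hh.tube hh.smooth_A ?_ h0 d_isBigO_eps
    refine ((comp_sub_isBigO hh.tube hh.smooth_q).trans h0).congr_left fun η => ?_
    simp [hΦ0, jet]
  have hl1 : (fun η : JetConfig E => l j (η.J 0)) =O[𝓟 (admissible W K C₀ r)] fun _ => (1 : ℝ) :=
    comp_isBigO_one hh.tube (hh.smooth_l j)
  have hW : (fun η : JetConfig E => jet W η.x 1) =O[𝓟 (admissible W K C₀ r)] fun _ => (1 : ℝ) :=
    isBigO_one_of_bdd (hh.tube.bdd 1)
  have hsl : (fun η : JetConfig E => (l j (η.J 0) • 1 - 𝔸 (η.J 0) : E →L[ℝ] E))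
      =O[𝓟 (admissible W K C₀ r)] fun _ => (1 : ℝ) :=
    comp_isBigO_one (g := fun u => l j u • (1 : E →L[ℝ] E) - 𝔸 u) hh.tube
      (((hh.smooth_l j).smul contDiffOn_const).sub hh.smooth_A)
  have h1 := isBigO_clm_apply_right hsl (disp_one_isBigO_eps hK)
  have h2 := ((comp_sub_isBigO hh.tube (hh.smooth_l j)).trans h0).smul hW
  have h3 := d_isBigO_eps.smul hW
  simp only [smul_eq_mul, mul_one] at h2 h3
  refine (((h1.add hrem).add h2).sub h3).congr_left fun η => ?_
  have h4 := dispRate_eq (l := l) hΦW j 0 η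
  rw [dispRate, sub_eq_iff_eq_add] at h4
  rw [h4]
  simp only [sub_smul]
  abel

/-- Along a `j`-characteristic, the diagonalised perturbation of order `K` satisfies a scalar linear
equation, up to a skew term and errors of lower order. -/
theorem charRate_sub_isBigO_err [CompleteSpace E] (hh : IsHyperbolicTube tr O Kc r W 𝔸 q l P σ c₀ κ)
    (hK : 1 ≤ K) (hΦ0 : ∀ J, Φ 0 J = q (J 0))
    (hΦW : ∀ a x, Φ a (jet W x) = 𝔸 (W x) (jet W x (a + 1)))
    {β : ℝ → E →L[ℝ] E} (hβ : BddC1 β)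
    (hlow : (fun η : JetConfig E => Φ (K - 1) η.J - Φ (K - 1) (jet W η.x))
      =O[𝓟 (admissible W K C₀ r)] err W K)
    (htop : (fun η : JetConfig E => Φ K η.J - Φ K (jet W η.x) -
      (fderiv ℝ q (W η.x) + β η.x) (disp W K η)) =O[𝓟 (admissible W K C₀ r)] err W K) (j : ι) :
    (fun η : JetConfig E =>
      charRate W 𝔸 l P Φ (profileGauge W l P fun x => fderiv ℝ q (W x) + β x) j K η -
        (tr (P j (W η.x) * (fderiv ℝ q (W η.x) + β η.x)) •
            charComp W P (profileGauge W l P fun x => fderiv ℝ q (W x) + β x) j K η +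
          l j (W η.x) • projDeriv W P j η.x
            (charComp W P (profileGauge W l P fun x => fderiv ℝ q (W x) + β x) j K η)))
      =O[𝓟 (admissible W K C₀ r)] err W K := by
  have hE : BddC1 fun x => fderiv ℝ q (W x) + β x :=
    (hh.tube.bddC1_comp (contDiffOn_fderiv hh.tube.isOpen hh.smooth_q)).add hβ
  have hB := hh.bddC1_profileGauge hE
  set B := profileGauge W l P fun x => fderiv ℝ q (W x) + β x with hBdef
  have h0 := disp_zero_isBigO_eps (W := W) (K := K) (C₀ := C₀) (r := r)
  have hprod := eps_mul_size_isBigO_err (W := W) (K := K) (C₀ := C₀) (r := r)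
  have hu := disp_isBigO_size (W := W) (K := K) (C₀ := C₀) (r := r) le_rfl
  have hu' := disp_isBigO_err (W := W) (C₀ := C₀) (r := r) (show K - 1 < K by omega)
  have hu's := disp_isBigO_size (W := W) (K := K) (C₀ := C₀) (r := r) (Nat.sub_le K 1)
  have hBo := isBigO_one_of_bdd (W := W) (K := K) (C₀ := C₀) (r := r) hB.bdd
  have hBo' := isBigO_one_of_bdd (W := W) (K := K) (C₀ := C₀) (r := r) hB.bdd_deriv
  have hEo := isBigO_one_of_bdd (W := W) (K := K) (C₀ := C₀) (r := r) hE.bdd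
  have hDo := isBigO_one_of_bdd (W := W) (K := K) (C₀ := C₀) (r := r) (hh.bddC1_projDeriv j).bdd
  have hτo := isBigO_one_of_bdd (W := W) (K := K) (C₀ := C₀) (r := r)
    (((hh.tube.bddC1_comp (hh.smooth_P j)).mul hE).clm tr).bdd
  have hlo := comp_profile_isBigO_one (K := K) (C₀ := C₀) hh.tube (hh.smooth_l j)
  have hlV := comp_isBigO_one (K := K) (C₀ := C₀) hh.tube (hh.smooth_l j)
  have hPo := comp_profile_isBigO_one (K := K) (C₀ := C₀) hh.tube (hh.smooth_P j)
  have hPV := comp_isBigO_one (K := K) (C₀ := C₀) hh.tube (hh.smooth_P j)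
  have hPd := (comp_sub_isBigO (K := K) (C₀ := C₀) hh.tube (hh.smooth_P j)).trans h0
  have hdP := contDiffOn_fderiv hh.tube.isOpen (hh.smooth_P j)
  have hdPV := comp_isBigO_one (K := K) (C₀ := C₀) hh.tube hdP
  have hdPd := (comp_sub_isBigO (K := K) (C₀ := C₀) hh.tube hdP).trans h0
  have hS : ContDiffOn ℝ ∞ (fun u => l j u • (1 : E →L[ℝ] E) - 𝔸 u) O :=
    ((hh.smooth_l j).smul contDiffOn_const).sub hh.smooth_A
  have hSV := comp_isBigO_one (K := K) (C₀ := C₀) hh.tube hS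
  have hSd := (comp_sub_isBigO (K := K) (C₀ := C₀) hh.tube hS).trans h0
  have hWo : (fun η : JetConfig E => jet W η.x 1) =O[𝓟 (admissible W K C₀ r)] fun _ => (1 : ℝ) :=
    isBigO_one_of_bdd (hh.tube.bdd 1)
  have hw := hu.add (isBigO_clm_apply_right hBo hu's)
  -- the derivative of the projection
  have hT1 : (fun η : JetConfig E => fderiv ℝ (P j) (η.J 0) (jetRate 𝔸 l Φ j 0 η)
      (disp W K η + B η.x (disp W (K - 1) η)) - l j (W η.x) • projDeriv W P j η.x (disp W K η))
      =O[𝓟 (admissible W K C₀ r)] err W K := by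
    have h1 := isBigO_clm_apply_right hdPV (jetRate_sub_isBigO_eps (C₀ := C₀) hh hK hΦ0 hΦW j)
    have h2 := isBigO_clm_apply hdPd (isBigO_smul_right hlo hWo)
    simp only [mul_one] at h2
    have h3 := (isBigO_clm_apply (h1.add h2) hw).trans hprod
    have h4 := isBigO_smul_right hlo (isBigO_clm_apply_right hDo (isBigO_clm_apply_right hBo hu'))
    refine (h3.add h4).congr_left fun η => ?_
    simp only [projDeriv, map_sub, map_smul, map_add, sub_apply, add_apply, smul_apply]
    module
  -- the highest order term
  have hT2 : (fun η : JetConfig E => P j (η.J 0) (remainder W 𝔸 Φ K η) -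
      P j (W η.x) ((fderiv ℝ q (W η.x) + β η.x) (disp W K η)))
      =O[𝓟 (admissible W K C₀ r)] err W K := by
    have h1 := isBigO_clm_apply_right hPV (remainder_sub_isBigO hh.tube hh.smooth_A htop
      (disp_isBigO_err (by omega)) d_isBigO_err)
    have h2 := (isBigO_clm_apply hPd (isBigO_clm_apply_right hEo hu)).trans hprod
    refine (h1.add h2).congr_left fun η => ?_
    simp only [map_sub, sub_apply]
    abel
  have hT3 : (fun η : JetConfig E => P j (η.J 0)
      ((l j (η.J 0) - η.d) • deriv B η.x (disp W (K - 1) η)))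
      =O[𝓟 (admissible W K C₀ r)] err W K :=
    isBigO_clm_apply_right hPV (isBigO_smul_right (hlV.sub (d_isBigO_eps.trans eps_isBigO_one))
      (isBigO_clm_apply_right hBo' hu'))
  -- At order `K - 1` the principal part of the rate is `(l j - 𝔸)` applied to the derivative of
  -- order `K`. Multiplied by `B` it is not an error: it is the term the gauge was designed to
  -- supply.
  have hT4 : (fun η : JetConfig E => P j (η.J 0) (B η.x (dispRate W 𝔸 l Φ j (K - 1) η)) -
      P j (W η.x) (B η.x ((l j (W η.x) • (1 : E →L[ℝ] E) - 𝔸 (W η.x)) (disp W K η))))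
      =O[𝓟 (admissible W K C₀ r)] err W K := by
    have h1 := isBigO_clm_apply_right hPV (isBigO_clm_apply_right hBo
      (remainder_sub_isBigO (f := fun _ => 0) hh.tube hh.smooth_A (by simpa using hlow)
        (disp_isBigO_err (by omega)) d_isBigO_err))
    have h2 := (isBigO_clm_apply hPd (isBigO_clm_apply_right hBo
      (isBigO_clm_apply_right hSV hu))).trans hprod
    have h3 := isBigO_clm_apply_right hPo (isBigO_clm_apply_right hBo
      ((isBigO_clm_apply hSd hu).trans hprod))
    refine ((h1.add h2).add h3).congr_left fun η => ?_
    rw [dispRate_eq hΦW, Nat.sub_add_cancel hK]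
    simp only [map_sub, sub_apply, map_add, map_zero]
    abel
  -- The gauge term and the change of base point in the projection are errors, so the diagonalised
  -- unknown can replace the projected derivative in the scalar equation.
  have hT6 : (fun η : JetConfig E => P j (W η.x) (disp W K η) - charComp W P B j K η)
      =O[𝓟 (admissible W K C₀ r)] err W K := by
    have h1 := (isBigO_clm_apply hPd hu).trans hprod
    have h2 := isBigO_clm_apply_right hPV (isBigO_clm_apply_right hBo hu')
    refine (h1.add h2).neg_left.congr_left fun η => ?_
    simp only [charComp, sub_apply, map_add]
    abel
  have hT7 := (isBigO_smul_right hτo hT6).add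
    (isBigO_smul_right hlo (isBigO_clm_apply_right hDo hT6))
  refine (((((hT1.add hT2).add hT3).add hT4).add hT7)).congr' ?_ EventuallyEq.rfl
  filter_upwards [mem_principal_self _] with η hη
  have hfr := hh.frame _ (hh.mem η.x)
  -- After all coefficients are frozen at the profile, the terms linear in the highest derivative
  -- combine by the gauge identity.
  have hid := gauge_identity hfr.injective hfr.idem hfr.orth hfr.sum_eq_one hfr.mul_proj
    (D := fun j => projDeriv W P j η.x) (hh.projDeriv_eq j η.x)
    (hfr.rank_one j (fderiv ℝ q (W η.x) + β η.x))
  have hid' := congr($hid (disp W K η))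
  have hBx : gaugeOp (fun j => l j (W η.x)) (fun j => P j (W η.x)) (fun j => projDeriv W P j η.x)
      (fderiv ℝ q (W η.x) + β η.x) = B η.x := rfl
  rw [hBx] at hid'
  simp only [add_apply, mul_apply_eq_comp, smul_apply] at hid'
  rw [charRate, map_add (P j (η.J 0)), map_add (P j (η.J 0)), proj_dispRate hΦW
    (hh.frame _ (hh.tube.subset (hh.tube.closedBall_subset _ (base_mem hη))))]
  generalize charComp W P B j K η = z at *
  rw [← sub_eq_zero] at hid' ⊢
  rw [← neg_eq_zero, ← hid']
  simp only [smul_sub, sub_apply, add_apply, map_sub, map_add]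
  abel

end JetConfig

end CharacteristicRate

/-! ### Weights from non-characteristicity -/

section Weight

namespace JetConfig

variable {ι E : Type*} [Fintype ι] [DecidableEq ι] [NormedAddCommGroup E] [InnerProductSpace ℝ E]
  {tr : (E →L[ℝ] E) →L[ℝ] ℝ} {O Kc : Set E} {r : ℝ} {W : ℝ → E}
  {𝔸 : E → E →L[ℝ] E} {q : E → E} {l : ι → E → ℝ} {P : ι → E → E →L[ℝ] E}
  {σ : ι → ℝ} {c₀ κ : ℝ} {Φ : ℕ → (ℕ → E) → E} {K : ℕ} {C₀ : ℝ}

omit [DecidableEq ι] in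
-- In the frame of the profile a characteristic moves at speed `l j - δ'`. This differs from the
-- speed at the profile by a multiple of `ε`, so sign and lower bound survive with half the
-- constant.
theorem exists_transverse (hh : IsHyperbolicTube tr O Kc r W 𝔸 q l P σ c₀ κ) (j : ι) :
    ∃ ε₀, 0 < ε₀ ∧ ∀ η ∈ admissible W K C₀ r, η.ε ≤ ε₀ → c₀ / 2 ≤ σ j * (l j (η.J 0) - η.d) := by
  have h1 := ((comp_sub_isBigO (K := K) (C₀ := C₀) hh.tube (hh.smooth_l j)).trans
    disp_zero_isBigO_eps).sub (d_isBigO_eps)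
  obtain ⟨C, hC⟩ := isBigO_principal.1 h1
  have hc := hh.pos
  refine ⟨c₀ / 2 / (|C| + 1), by positivity, fun η hη hε => ?_⟩
  have h2 := hC η hη
  have h3 : |l j (η.J 0) - l j (W η.x) - η.d| ≤ c₀ / 2 := by
    have hε0 := eps_nonneg hη
    calc _ ≤ C * ‖η.ε‖ := h2
      _ ≤ (|C| + 1) * (c₀ / 2 / (|C| + 1)) := by
        rw [Real.norm_of_nonneg hε0]
        exact mul_le_mul ((le_abs_self C).trans (by linarith)) hε hε0 (by positivity)
      _ = c₀ / 2 := by field_simp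
  have h4 : |σ j * (l j (η.J 0) - l j (W η.x) - η.d)| ≤ c₀ / 2 := by
    rw [abs_mul, hh.sign, one_mul]; exact h3
  have h5 := hh.speed j η.x
  have h6 := neg_abs_le (σ j * (l j (η.J 0) - l j (W η.x) - η.d))
  linarith [mul_sub (σ j) (l j (η.J 0) - l j (W η.x)) η.d, mul_sub (σ j) (l j (η.J 0)) (l j (W η.x)),
    mul_sub (σ j) (l j (η.J 0)) η.d]

/-- A bounded weight which makes the diagonalised perturbation decay along characteristics. -/
theorem exists_weight [CompleteSpace E] (hh : IsHyperbolicTube tr O Kc r W 𝔸 q l P σ c₀ κ)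
    (hK : 1 ≤ K) (hΦ0 : ∀ J, Φ 0 J = q (J 0))
    (hΦW : ∀ a x, Φ a (jet W x) = 𝔸 (W x) (jet W x (a + 1)))
    {β : ℝ → E →L[ℝ] E} (hβ : BddC1 β) (hβ0 : Tendsto β (cocompact ℝ) (𝓝 0))
    (hlow : (fun η : JetConfig E => Φ (K - 1) η.J - Φ (K - 1) (jet W η.x))
      =O[𝓟 (admissible W K C₀ r)] err W K)
    (htop : (fun η : JetConfig E => Φ K η.J - Φ K (jet W η.x) -
      (fderiv ℝ q (W η.x) + β η.x) (disp W K η)) =O[𝓟 (admissible W K C₀ r)] err W K)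
    {B : ℝ → E →L[ℝ] E} (hB : B = profileGauge W l P fun x => fderiv ℝ q (W x) + β x) (j : ι) :
    ∃ φ : ℝ → ℝ, Differentiable ℝ φ ∧ (∃ M, ∀ x, |φ x| ≤ M) ∧ ∃ C ε₀, 0 ≤ C ∧ 0 < ε₀ ∧
      ∀ η ∈ admissible W K C₀ r, η.ε ≤ ε₀ →
        deriv φ η.x * (l j (η.J 0) - η.d) * ‖charComp W P B j K η‖ ^ 2 +
          ⟪charComp W P B j K η, charRate W 𝔸 l P Φ B j K η⟫ ≤
        -(κ / 2) * ‖charComp W P B j K η‖ ^ 2 + ‖charComp W P B j K η‖ * (C * err W K η) := by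
  obtain ⟨M, hM0, hM⟩ := hh.exists_growthRate_le hβ hβ0 j
  obtain ⟨ε₀, hε₀, htrans⟩ := exists_transverse (K := K) (C₀ := C₀) hh j
  obtain ⟨C, hC⟩ := isBigO_principal.1 (charRate_sub_isBigO_err hh hK hΦ0 hΦW hβ hlow htop j)
  have hc := hh.pos
  -- The sign `σ j` makes the weight decrease along the motion. The factor `2 * M / c₀` compensates
  -- the speed `c₀ / 2`, giving a gain of at least `M / (1 + x²)`, the possibly unstable part of the
  -- growth rate.
  have hφ : ∀ x, HasDerivAt (fun x => -(σ j * (2 * M / c₀)) * Real.arctan x)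
      (-(σ j * (2 * M / c₀)) * (1 / (1 + x ^ 2))) x := fun x =>
    (Real.hasDerivAt_arctan x).const_mul _
  refine ⟨_, fun x => (hφ x).differentiableAt, ⟨|σ j * (2 * M / c₀)| * (Real.pi / 2), fun x => ?_⟩,
    |C|, ε₀, abs_nonneg C, hε₀, fun η hη hε => ?_⟩
  · rw [abs_mul, abs_neg]
    gcongr
    exact abs_le.2 ⟨by linarith [Real.neg_pi_div_two_lt_arctan x], (Real.arctan_lt_pi_div_two x).le⟩
  · rw [(hφ η.x).deriv]
    have h1 := hC η hη
    rw [← hB] at h1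
    have herr : 0 ≤ err W K η := (abs_nonneg _).trans (le_err hη).2.2
    rw [Real.norm_of_nonneg herr] at h1
    set z := charComp W P B j K η
    set τ := tr (P j (W η.x) * (fderiv ℝ q (W η.x) + β η.x))
    set D := l j (W η.x) • projDeriv W P j η.x with hD
    have h2 : ⟪z, charRate W 𝔸 l P Φ B j K η⟫ ≤
        (τ + ‖D‖) * ‖z‖ ^ 2 + ‖z‖ * (|C| * err W K η) := by
      have e1 : charRate W 𝔸 l P Φ B j K η = (τ • z + D z) +
          (charRate W 𝔸 l P Φ B j K η - (τ • z + l j (W η.x) • projDeriv W P j η.x z)) := by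
        rw [hD, smul_apply]; abel
      rw [e1, inner_add_right, inner_add_right, inner_smul_right, real_inner_self_eq_norm_sq]
      have h3 : ⟪z, D z⟫ ≤ ‖D‖ * ‖z‖ ^ 2 :=
        (real_inner_le_norm _ _).trans (by nlinarith [D.le_opNorm z, norm_nonneg z])
      have h4 := (real_inner_le_norm z (charRate W 𝔸 l P Φ B j K η -
        (τ • z + l j (W η.x) • projDeriv W P j η.x z))).trans
        (mul_le_mul_of_nonneg_left (h1.trans
          (mul_le_mul_of_nonneg_right (le_abs_self C) herr)) (norm_nonneg z))
      linarith
    have h3 : τ + ‖D‖ ≤ -(κ / 2) + M / (1 + η.x ^ 2) := hM η.x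
    have h4 : -(σ j * (2 * M / c₀)) * (1 / (1 + η.x ^ 2)) * (l j (η.J 0) - η.d) ≤
        -(M / (1 + η.x ^ 2)) := by
      have h5 := mul_le_mul_of_nonneg_left (htrans η hη hε)
        (by positivity : 0 ≤ 2 * M / c₀ * (1 / (1 + η.x ^ 2)))
      have h6 : 2 * M / c₀ * (1 / (1 + η.x ^ 2)) * (c₀ / 2) = M / (1 + η.x ^ 2) := by
        field_simp
      rw [h6] at h5
      linarith
    nlinarith [sq_nonneg ‖z‖, mul_le_mul_of_nonneg_right (add_le_add h3 h4) (sq_nonneg ‖z‖)]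

omit [DecidableEq ι] in
/-- The derivative of a characteristic component of the undifferentiated perturbation. -/
theorem proj_rate_isBigO [CompleteSpace E] (hh : IsHyperbolicTube tr O Kc r W 𝔸 q l P σ c₀ κ)
    (hΦ0 : ∀ J, Φ 0 J = q (J 0))
    (hΦW : ∀ a x, Φ a (jet W x) = 𝔸 (W x) (jet W x (a + 1))) (j : ι) :
    (fun η : JetConfig E => fderiv ℝ (P j) (η.J 0) (jetRate 𝔸 l Φ j 0 η) (disp W 0 η) +
      P j (η.J 0) (dispRate W 𝔸 l Φ j 0 η)) =O[𝓟 (admissible W 1 C₀ r)]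
      fun η => ‖disp W 0 η‖ + |η.d| := by
  have h0 : disp W 0 =O[𝓟 (admissible W 1 C₀ r)] fun η => ‖disp W 0 η‖ + |η.d| :=
    isBigO_of_le _ fun η => by
      rw [Real.norm_of_nonneg (by positivity)]
      linarith [abs_nonneg η.d]
  have hd : (fun η : JetConfig E => η.d) =O[𝓟 (admissible W 1 C₀ r)]
      fun η => ‖disp W 0 η‖ + |η.d| :=
    isBigO_of_le _ fun η => by
      rw [Real.norm_eq_abs, Real.norm_of_nonneg (by positivity : 0 ≤ ‖disp W 0 η‖ + |η.d|)]
      linarith [norm_nonneg (disp W 0 η)]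
  have hPV := comp_isBigO_one (K := 1) (C₀ := C₀) hh.tube (hh.smooth_P j)
  have hdPV := comp_isBigO_one (K := 1) (C₀ := C₀) hh.tube
    (contDiffOn_fderiv hh.tube.isOpen (hh.smooth_P j))
  have hrate : (fun η : JetConfig E => jetRate 𝔸 l Φ j 0 η) =O[𝓟 (admissible W 1 C₀ r)]
      fun _ => (1 : ℝ) := by
    have h1 := (jetRate_sub_isBigO_eps (C₀ := C₀) hh le_rfl hΦ0 hΦW j).trans eps_isBigO_one
    have h2 := isBigO_smul_right (comp_profile_isBigO_one (K := 1) (C₀ := C₀) hh.tube (hh.smooth_l j))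
      (isBigO_one_of_bdd (W := W) (hh.tube.bdd 1))
    exact (h1.add h2).congr_left fun η => by simp only [jet]; abel
  have hrem := remainder_sub_isBigO (Φ := Φ) (f := fun _ => 0) (a := 0) hh.tube hh.smooth_A
    (((comp_sub_isBigO (K := 1) (C₀ := C₀) hh.tube hh.smooth_q).trans h0).congr_left fun η => by
      simp [hΦ0, jet]) h0 hd
  refine ((isBigO_clm_apply_right (isBigO_clm_apply_right hdPV hrate) h0).add
    (isBigO_clm_apply_right hPV hrem)).congr' ?_ EventuallyEq.rfl
  filter_upwards [mem_principal_self _] with η hη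
  rw [proj_dispRate hΦW
    (hh.frame _ (hh.tube.subset (hh.tube.closedBall_subset _ (base_mem hη)))), sub_zero]

end JetConfig

end Weight

/-! ### Perturbed solutions followed along characteristics -/

section Dynamics

/-- A weighted version of `norm_le_expHistory`. -/
theorem norm_le_expHistory_of_weight {H : Type*} [NormedAddCommGroup H] [InnerProductSpace ℝ H]
    {φ x x' g : ℝ → ℝ} {z z' : ℝ → H} {θ a t T M c₀ α c : ℝ} (hθ : 0 < θ) (ht : 0 ≤ t)
    (htT : t ≤ T) (ha : 0 ≤ a) (hg : IntegrableOn g (Icc 0 T)) (hg0 : ∀ s, 0 ≤ g s) (hα : 0 ≤ α)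
    (hc : 0 ≤ c) (hc₀ : 0 ≤ c₀) (hφ : Differentiable ℝ φ) (hM : ∀ x, |φ x| ≤ M)
    (hx : ContinuousOn x (Icc 0 t)) (hx' : ∀ s ∈ Ioo 0 t, HasDerivAt x (x' s) s)
    (hz : ContinuousOn z (Icc 0 t)) (hz' : ∀ s ∈ Ioo 0 t, HasDerivAt z (z' s) s)
    (h0 : ‖z 0‖ ≤ c₀ * a)
    (hineq : ∀ s ∈ Ioo 0 t, deriv φ (x s) * x' s * ‖z s‖ ^ 2 + ⟪z s, z' s⟫ ≤
      -(2 * θ) * ‖z s‖ ^ 2 + ‖z s‖ * (α * expHistory θ a g s + c * g s)) :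
    ‖z t‖ ≤ Real.exp (2 * M) * (c₀ + α / θ + c) * expHistory θ a g t := by
  have hG : ∀ s ∈ Icc 0 t, 0 ≤ expHistory θ a g s := fun s hs =>
    expHistory_nonneg ha hg hg0 hs.1 (hs.2.trans htT)
  have hexp : ∀ s, Real.exp (φ (x s)) ≤ Real.exp M := fun s =>
    Real.exp_le_exp.2 ((le_abs_self _).trans (hM _))
  have hn : ∀ s, ‖Real.exp (φ (x s)) • z s‖ = Real.exp (φ (x s)) * ‖z s‖ := fun s => by
    rw [norm_smul, Real.norm_of_nonneg (Real.exp_pos _).le]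
  have key := norm_le_expHistory (Z := fun s => Real.exp (φ (x s)) • z s)
    (Z' := fun s => Real.exp (φ (x s)) • z' s + (Real.exp (φ (x s)) * (deriv φ (x s) * x' s)) • z s)
    (c₀ := Real.exp M * c₀) (α := Real.exp M * α) (c := Real.exp M * c) hθ ht htT ha hg hg0
    (by positivity) (by positivity) (by positivity)
    ((Real.continuous_exp.comp_continuousOn (hφ.continuous.comp_continuousOn hx)).smul hz)
    (fun s hs => ((((hφ (x s)).hasDerivAt.comp s (hx' s hs)).exp).smul (hz' s hs)))
    (by
      rw [hn, mul_assoc]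
      exact mul_le_mul (hexp 0) h0 (norm_nonneg _) (Real.exp_pos _).le)
    (by
      intro s hs
      have hp := Real.exp_pos (φ (x s))
      have h1 := mul_le_mul_of_nonneg_left (hineq s hs) (mul_pos hp hp).le
      have hF : 0 ≤ α * expHistory θ a g s + c * g s := add_nonneg
        (mul_nonneg hα (hG s (Ioo_subset_Icc_self hs))) (mul_nonneg hc (hg0 s))
      have h2 := mul_le_mul_of_nonneg_left (hexp s)
        (mul_nonneg (mul_nonneg hp.le (norm_nonneg (z s))) hF)
      rw [hn, inner_add_right, inner_smul_left, inner_smul_right, inner_smul_right, inner_smul_left,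
        real_inner_self_eq_norm_sq]
      simp only [conj_trivial]
      linarith)
  rw [hn] at key
  -- The weight lies between `e^(-M)` and `e^M`; inserting and removing it costs the factor
  -- `e^(2M)`.
  have h3 : Real.exp (-M) ≤ Real.exp (φ (x t)) := Real.exp_le_exp.2 (neg_le_of_abs_le (hM _))
  have h4 : Real.exp M * (Real.exp (φ (x t)) * ‖z t‖) ≥ ‖z t‖ := by
    have h5 := mul_le_mul_of_nonneg_left h3 (Real.exp_pos M).le
    rw [← Real.exp_add, add_neg_cancel, Real.exp_zero] at h5
    nlinarith [norm_nonneg (z t)]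
  refine h4.le.trans ((mul_le_mul_of_nonneg_left key (Real.exp_pos M).le).trans_eq ?_)
  rw [two_mul, Real.exp_add]
  ring

variable {ι E : Type*} [NormedAddCommGroup E] [InnerProductSpace ℝ E]

/-- The functions of jets which describe the space derivatives of `q(W) - 𝔸(W) W'`, up to the term
containing the highest derivative. -/
structure IsJetFlux (O : Set E) (𝔸 : E → E →L[ℝ] E) (q : E → E) (Φ : ℕ → (ℕ → E) → E) : Prop where
  zero : ∀ J, Φ 0 J = q (J 0)
  hasDerivAt : ∀ W : ℝ → E, ContDiff ℝ ∞ W → (∀ x, W x ∈ O) → ∀ k x,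
    HasDerivAt (fun x => Φ k (jet W x) - 𝔸 (W x) (jet W x (k + 1)))
      (Φ (k + 1) (jet W x) - 𝔸 (W x) (jet W x (k + 2))) x

/-- For a stationary profile `q(W) - 𝔸(W) W'` vanishes identically, hence so do all its derivatives.
-/
theorem IsJetFlux.stationary {O : Set E} {𝔸 : E → E →L[ℝ] E} {q : E → E} {Φ : ℕ → (ℕ → E) → E}
    (hΦ : IsJetFlux O 𝔸 q Φ) {W : ℝ → E} (hW : ContDiff ℝ ∞ W) (hWO : ∀ x, W x ∈ O)
    (hst : ∀ x, 𝔸 (W x) (jet W x 1) = q (W x)) (a : ℕ) (x : ℝ) :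
    Φ a (jet W x) = 𝔸 (W x) (jet W x (a + 1)) := by
  induction a generalizing x with
  | zero => rw [hΦ.zero, hst]; simp [jet]
  | succ a ih =>
    have h1 := hΦ.hasDerivAt W hW hWO a x
    have h2 : (fun x => Φ a (jet W x) - 𝔸 (W x) (jet W x (a + 1))) = fun _ => 0 :=
      funext fun x => sub_eq_zero.2 (ih x)
    rw [h2] at h1
    exact sub_eq_zero.1 (h1.unique (hasDerivAt_const x 0))

/-- A smooth solution which stays close to a shifted profile. -/
structure IsPerturbedSolution (W : ℝ → E) (𝔸 : E → E →L[ℝ] E) (q : E → E) (T ε : ℝ)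
    (V : ℝ → ℝ → E) (δ δ' : ℝ → ℝ) : Prop where
  pos : 0 < T
  smooth : ContDiffOn ℝ ∞ (fun p : ℝ × ℝ => V p.1 p.2) (strip T)
  eqn : ∀ t ∈ Icc 0 T, ∀ x,
    derivWithin (fun s => V s x) (Icc 0 T) t + 𝔸 (V t x) (deriv (V t) x) = q (V t x)
  continuousOn_shift : ContinuousOn δ (Icc 0 T)
  hasDerivAt_shift : ∀ t ∈ Ioo 0 T, HasDerivAt δ (δ' t) t
  shift_le : ∀ t ∈ Icc 0 T, |δ' t| ≤ ε
  zero_le : ∀ t ∈ Icc 0 T, ∀ y, ‖jet (V t) y 0 - jet W (y - δ t) 0‖ ≤ ε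
  one_le : ∀ t ∈ Icc 0 T, ∀ y, ‖jet (V t) y 1 - jet W (y - δ t) 1‖ ≤ ε

/-- The configuration of a solution at a point of space-time. -/
noncomputable def solConfig (V : ℝ → ℝ → E) (δ δ' : ℝ → ℝ) (e h ε s y : ℝ) : JetConfig E :=
  ⟨y - δ s, δ' s, e, h, ε, jet (V s) y⟩

variable {tr : (E →L[ℝ] E) →L[ℝ] ℝ} {O Kc : Set E} {r : ℝ} {W : ℝ → E}
  {𝔸 : E → E →L[ℝ] E} {q : E → E} {l : ι → E → ℝ} {P : ι → E → E →L[ℝ] E}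
  {σ : ι → ℝ} {c₀ κ : ℝ} {Φ : ℕ → (ℕ → E) → E} {K : ℕ} {C₀ : ℝ}
  {T ε : ℝ} {V : ℝ → ℝ → E} {δ δ' : ℝ → ℝ}

namespace IsPerturbedSolution

theorem mem (hsol : IsPerturbedSolution W 𝔸 q T ε V δ δ') (hT : IsTube O Kc r W) (hε : ε ≤ r)
    {t : ℝ} (ht : t ∈ Icc 0 T) (y : ℝ) : V t y ∈ Kc := by
  refine hT.closedBall_subset (y - δ t) ?_
  rw [mem_closedBall_iff_norm]
  simpa [jet] using (hsol.zero_le t ht y).trans hε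

theorem contDiffOn_comp {F : Type*} [NormedAddCommGroup F] [NormedSpace ℝ F]
    (hsol : IsPerturbedSolution W 𝔸 q T ε V δ δ') (hT : IsTube O Kc r W)
    (hε : ε ≤ r) {f : E → F} (hf : ContDiffOn ℝ ∞ f O) :
    ContDiffOn ℝ ∞ (fun p : ℝ × ℝ => f (V p.1 p.2)) (strip T) :=
  hf.comp hsol.smooth fun _ hp => hT.subset (hsol.mem hT hε (mem_strip.1 hp) _)

/-- Characteristic curves, with a bound on the speed which depends on the profile only. -/
theorem exists_characteristic (hsol : IsPerturbedSolution W 𝔸 q T ε V δ δ') (hT : IsTube O Kc r W)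
    (hε : ε ≤ r) {f : E → ℝ} (hf : ContDiffOn ℝ ∞ f O) {Λ : ℝ} (hΛ : ∀ v ∈ Kc, |f v| ≤ Λ) {t : ℝ}
    (ht : t ∈ Icc 0 T) (y₀ : ℝ) :
    ∃ y : ℝ → ℝ, y t = y₀ ∧ ContinuousOn y (Icc 0 t) ∧
      (∀ s ∈ Icc 0 t, |y s - y₀| ≤ Λ * (t - s)) ∧
      ∀ s ∈ Ioo 0 t, HasDerivAt y (f (jet (V s) (y s) 0)) s := by
  obtain ⟨C, hC0, hC⟩ := hT.exists_bound (contDiffOn_fderiv hT.isOpen hf).continuousOn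
  obtain ⟨D, hD⟩ := hT.bdd 1
  have h1 := hsol.contDiffOn_comp hT hε hf
  have hL : ∀ p ∈ strip T, |fderivWithin ℝ (fun p : ℝ × ℝ => f (V p.1 p.2)) (strip T) p (0, 1)| ≤
      C * (ε + D) := by
    intro p hp
    have hp1 := mem_strip.1 hp
    rw [(hasDerivAt_space_slice h1 hp1 p.2).unique (hasDerivAt_comp_curve hT.isOpen hf
      (contDiff_slice hsol.smooth hp1) (hT.subset (hsol.mem hT hε hp1 _))), ← Real.norm_eq_abs]
    refine ContinuousLinearMap.le_of_opNorm_le_of_le _ (hC _ (hsol.mem hT hε hp1 _)) ?_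
    have h2 := norm_add_le_of_le (hsol.one_le p.1 hp1 p.2) (hD (p.2 - δ p.1))
    simpa [jet] using h2
  obtain ⟨y, hy⟩ := _root_.exists_characteristic h1
    (fun p hp => hΛ _ (hsol.mem hT hε (mem_strip.1 hp) _)) hL ht y₀
  exact ⟨y, by simpa [jet] using hy⟩

section Curve

variable {y : ℝ → ℝ} {t : ℝ}

theorem continuousOn_jet_curve (hsol : IsPerturbedSolution W 𝔸 q T ε V δ δ') (ht : t ∈ Icc 0 T)
    (hy : ContinuousOn y (Icc 0 t)) (k : ℕ) :
    ContinuousOn (fun s => jet (V s) (y s) k) (Icc 0 t) :=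
  (contDiffOn_spaceDeriv hsol.pos hsol.smooth k).1.continuousOn.comp (continuousOn_id.prodMk hy)
    fun _ hs => mem_strip.2 ⟨hs.1, hs.2.trans ht.2⟩

theorem continuousOn_foot (hsol : IsPerturbedSolution W 𝔸 q T ε V δ δ') (ht : t ∈ Icc 0 T)
    (hy : ContinuousOn y (Icc 0 t)) : ContinuousOn (fun s => y s - δ s) (Icc 0 t) :=
  hy.sub (hsol.continuousOn_shift.mono (Icc_subset_Icc le_rfl ht.2))

theorem continuousOn_disp_curve (hsol : IsPerturbedSolution W 𝔸 q T ε V δ δ')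
    (hW : ContDiff ℝ ∞ W) (ht : t ∈ Icc 0 T)
    (hy : ContinuousOn y (Icc 0 t)) (e h : ℝ) (k : ℕ) :
    ContinuousOn (fun s => JetConfig.disp W k (solConfig V δ δ' e h ε s (y s))) (Icc 0 t) :=
  (hsol.continuousOn_jet_curve ht hy k).sub
    ((hW.continuous_iteratedDeriv k (by exact_mod_cast le_top)).comp_continuousOn
      (hsol.continuousOn_foot ht hy))

variable (hsol : IsPerturbedSolution W 𝔸 q T ε V δ δ') (hT : IsTube O Kc r W) (hε : ε ≤ r)
  (hΦ : IsJetFlux O 𝔸 q Φ) {j : ι} {s : ℝ} (hs : s ∈ Ioo 0 T)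
  (hy : HasDerivAt y (l j (jet (V s) (y s) 0)) s)

include hsol hT hε hΦ hs hy

/-- The chain rule adds the speed times the next space derivative to the time derivative furnished
by the differentiated equation. -/
theorem hasDerivAt_jet_curve (e h : ℝ) (k : ℕ) : HasDerivAt (fun s => jet (V s) (y s) k)
    (JetConfig.jetRate 𝔸 l Φ j k (solConfig V δ δ' e h ε s (y s))) s := by
  have h1 := hasDerivAt_spaceDeriv_curve hsol.pos hsol.smooth hs hy k
  have h2 := fderivWithin_spaceDeriv_time hsol.pos hsol.smooth
    (fun t ht y => hT.subset (hsol.mem hT hε ht y)) hΦ.zero hΦ.hasDerivAt hsol.eqn k (s, y s)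
    (mem_strip.2 (Ioo_subset_Icc_self hs))
  rw [h2] at h1
  refine h1.congr_deriv ?_
  simp only [JetConfig.jetRate, solConfig, spaceDeriv]
  simp [jet]

theorem hasDerivAt_disp_curve (e h : ℝ) (k : ℕ) :
    HasDerivAt (fun s => JetConfig.disp W k (solConfig V δ δ' e h ε s (y s)))
      (JetConfig.dispRate W 𝔸 l Φ j k (solConfig V δ δ' e h ε s (y s))) s :=
  (hsol.hasDerivAt_jet_curve hT hε hΦ hs hy e h k).sub
    ((hasDerivAt_jet hT.smooth k (y s - δ s)).scomp s (hy.sub (hsol.hasDerivAt_shift s hs)))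

theorem hasDerivAt_comp_jet_curve {F : Type*} [NormedAddCommGroup F] [NormedSpace ℝ F] (e h : ℝ)
    {f : E → F} (hf : ContDiffOn ℝ ∞ f O) :
    HasDerivAt (fun s => f (jet (V s) (y s) 0)) (fderiv ℝ f (jet (V s) (y s) 0)
      (JetConfig.jetRate 𝔸 l Φ j 0 (solConfig V δ δ' e h ε s (y s)))) s := by
  have h1 : jet (V s) (y s) 0 ∈ O := by
    have := hT.subset (hsol.mem hT hε (Ioo_subset_Icc_self hs) (y s))
    simpa [jet] using this
  exact (hT.hasFDerivAt hf h1).comp_hasDerivAt s (hsol.hasDerivAt_jet_curve hT hε hΦ hs hy e h 0)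

end Curve

end IsPerturbedSolution

end Dynamics

/-! ### Duhamel estimates for the characteristic components -/

section CharacteristicEstimates

/-- An integrable function of time which bounds the perturbation and the speed of the shift. -/
structure IsDriver {E : Type*} [NormedAddCommGroup E] [NormedSpace ℝ E] (W : ℝ → E) (T : ℝ)
    (V : ℝ → ℝ → E) (δ δ' g : ℝ → ℝ) : Prop where
  integrable : IntegrableOn g (Icc 0 T)
  nonneg : ∀ s, 0 ≤ g s
  disp_le : ∀ s ∈ Icc 0 T, ∀ y, ‖jet (V s) y 0 - jet W (y - δ s) 0‖ ≤ g s
  shift_le : ∀ s ∈ Icc 0 T, |δ' s| ≤ g s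

variable {ι E : Type*} [Fintype ι] [NormedAddCommGroup E] [InnerProductSpace ℝ E]
  {tr : (E →L[ℝ] E) →L[ℝ] ℝ} {O Kc : Set E} {r : ℝ} {W : ℝ → E}
  {𝔸 : E → E →L[ℝ] E} {q : E → E} {l : ι → E → ℝ} {P : ι → E → E →L[ℝ] E}
  {σ : ι → ℝ} {c₀ κ : ℝ} {Φ : ℕ → (ℕ → E) → E} {K : ℕ} {C₀ : ℝ}
  {T ε : ℝ} {V : ℝ → ℝ → E} {δ δ' : ℝ → ℝ}

open JetConfig

theorem IsPerturbedSolution.nonneg (hsol : IsPerturbedSolution W 𝔸 q T ε V δ δ') : 0 ≤ ε :=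
  (abs_nonneg _).trans (hsol.shift_le 0 (left_mem_Icc.2 hsol.pos.le))

theorem IsPerturbedSolution.solConfig_mem_admissible
    (hsol : IsPerturbedSolution W 𝔸 q T ε V δ δ') (hε : ε ≤ r) (hε1 : ε ≤ 1) {s : ℝ}
    (hs : s ∈ Icc 0 T) (y : ℝ) : solConfig V δ δ' ε 1 ε s y ∈ admissible W 1 1 r := by
  refine ⟨⟨hsol.nonneg, hε, hε1, le_rfl, ?_, fun a ha1 ha2 => ?_⟩, le_rfl, hsol.shift_le s hs, hε1⟩
  · have := hsol.zero_le s hs y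
    simpa [solConfig, jet] using this
  · obtain rfl : a = 1 := le_antisymm ha2 ha1
    have := hsol.one_le s hs y
    simpa [solConfig] using this

/-- At order zero the rate along the characteristic is bounded by the driver `g`, and so is the
component itself. A damping term can be added and paid for by `g`, whence the arbitrary `θ`. -/
theorem exists_norm_proj_disp_le [CompleteSpace E]
    (hh : IsHyperbolicTube tr O Kc r W 𝔸 q l P σ c₀ κ) (hΦ : IsJetFlux O 𝔸 q Φ) (j : ι) {θ : ℝ}
    (hθ : 0 < θ) :
    ∃ C, 0 ≤ C ∧ ∀ {T ε : ℝ} {V : ℝ → ℝ → E} {δ δ' g : ℝ → ℝ} {a : ℝ},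
      IsPerturbedSolution W 𝔸 q T ε V δ δ' → ε ≤ r → ε ≤ 1 → IsDriver W T V δ δ' g → 0 ≤ a →
      (∀ y, ‖jet (V 0) y 0 - jet W (y - δ 0) 0‖ ≤ a) → ∀ t ∈ Icc 0 T, ∀ y,
        ‖P j (V t y) (jet (V t) y 0 - jet W (y - δ t) 0)‖ ≤ C * expHistory θ a g t := by
  obtain ⟨C, hC⟩ := isBigO_principal.1 (proj_rate_isBigO (C₀ := 1) hh hΦ.zero
    (hΦ.stationary hh.tube.smooth hh.mem hh.stationary) j)
  obtain ⟨Λ, -, hΛ⟩ := hh.tube.exists_bound (hh.smooth_l j).continuousOn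
  obtain ⟨D, hD0, hD⟩ := hh.tube.exists_bound (hh.smooth_P j).continuousOn
  -- The term `2 * |C|` covers the perturbation and the shift, each at most `g`; `2 * θ * D` pays
  -- for the inserted damping. The history does not enter as a forcing, so its coefficient is `0`.
  refine ⟨D + 0 / θ + (2 * |C| + 2 * θ * D), by positivity, ?_⟩
  intro T ε V δ δ' g a hsol hε hε1 hg ha h0 t ht y₀
  obtain ⟨y, hyt, hyc, -, hy'⟩ := hsol.exists_characteristic hh.tube hε (hh.smooth_l j) hΛ ht y₀
  have hsub : ∀ s ∈ Icc 0 t, s ∈ Icc 0 T := fun s hs => ⟨hs.1, hs.2.trans ht.2⟩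
  have hsub' : ∀ s ∈ Ioo 0 t, s ∈ Ioo 0 T := fun s hs => ⟨hs.1, hs.2.trans_le ht.2⟩
  have hV0 : ∀ s y, V s y = jet (V s) y 0 := fun s y => by simp [jet]
  have hPD : ∀ s ∈ Icc 0 T, ∀ y v, ‖P j (jet (V s) y 0) v‖ ≤ D * ‖v‖ := fun s hs y v => by
    refine (P j _).le_of_opNorm_le (hD _ ?_) v
    rw [← hV0]; exact hsol.mem hh.tube hε hs y
  have key := norm_le_expHistory (θ := θ) (a := a) (g := g) (α := 0) (c₀ := D)
    (c := 2 * |C| + 2 * θ * D)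
    (Z := fun s => P j (jet (V s) (y s) 0) (disp W 0 (solConfig V δ δ' ε 1 ε s (y s))))
    hθ ht.1 ht.2 ha hg.integrable hg.nonneg le_rfl (by positivity) hD0
    (ContinuousOn.clm_apply
      ((hh.smooth_P j).continuousOn.comp (hsol.continuousOn_jet_curve ht hyc 0) fun s hs => by
        rw [← hV0]; exact hh.tube.subset (hsol.mem hh.tube hε (hsub s hs) _))
      (hsol.continuousOn_disp_curve hh.tube.smooth ht hyc ε 1 0))
    (fun s hs => (hsol.hasDerivAt_comp_jet_curve hh.tube hε hΦ (hsub' s hs) (hy' s hs) ε 1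
      (hh.smooth_P j)).clm_apply
        (hsol.hasDerivAt_disp_curve hh.tube hε hΦ (hsub' s hs) (hy' s hs) ε 1 0))
    ((hPD 0 (left_mem_Icc.2 hsol.pos.le) _ _).trans (mul_le_mul_of_nonneg_left (h0 _) hD0))
    (fun s hs => by
      have hs' := hsub s (Ioo_subset_Icc_self hs)
      have h1 := hC _ (hsol.solConfig_mem_admissible hε hε1 hs' (y s))
      have h2 : ‖disp W 0 (solConfig V δ δ' ε 1 ε s (y s))‖ ≤ g s := hg.disp_le s hs' (y s)
      have h3 : |(solConfig V δ δ' ε 1 ε s (y s)).d| ≤ g s := hg.shift_le s hs'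
      rw [Real.norm_of_nonneg (by positivity)] at h1
      have h4 := h1.trans ((mul_le_mul_of_nonneg_right (le_abs_self C) (by positivity)).trans
        (mul_le_mul_of_nonneg_left (add_le_add h2 h3) (abs_nonneg C)))
      set z := P j (jet (V s) (y s) 0) (disp W 0 (solConfig V δ δ' ε 1 ε s (y s))) with hz
      have h5 : ‖z‖ ≤ D * g s := (hPD s hs' _ _).trans (mul_le_mul_of_nonneg_left h2 hD0)
      have h6 := (real_inner_le_norm z _).trans (mul_le_mul_of_nonneg_left h4 (norm_nonneg z))
      have h7 := mul_le_mul_of_nonneg_left h5 (mul_nonneg hθ.le (norm_nonneg z))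
      refine h6.trans ?_
      nlinarith)
  rw [← hyt, hV0]
  exact key

theorem exists_norm_disp_zero_le [CompleteSpace E]
    (hh : IsHyperbolicTube tr O Kc r W 𝔸 q l P σ c₀ κ) (hΦ : IsJetFlux O 𝔸 q Φ) {θ : ℝ}
    (hθ : 0 < θ) :
    ∃ C, 0 ≤ C ∧ ∀ {T ε : ℝ} {V : ℝ → ℝ → E} {δ δ' g : ℝ → ℝ} {a : ℝ},
      IsPerturbedSolution W 𝔸 q T ε V δ δ' → ε ≤ r → ε ≤ 1 → IsDriver W T V δ δ' g → 0 ≤ a →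
      (∀ y, ‖jet (V 0) y 0 - jet W (y - δ 0) 0‖ ≤ a) → ∀ t ∈ Icc 0 T, ∀ y,
        ‖jet (V t) y 0 - jet W (y - δ t) 0‖ ≤ C * expHistory θ a g t := by
  choose C hC0 hC using fun j => exists_norm_proj_disp_le hh hΦ j hθ
  refine ⟨∑ j, C j, Finset.sum_nonneg fun j _ => hC0 j, ?_⟩
  intro T ε V δ δ' g a hsol hε hε1 hg ha h0 t ht y
  have h1 := congr($((hh.frame _ (hh.tube.subset (hsol.mem hh.tube hε ht y))).sum_eq_one)
    (jet (V t) y 0 - jet W (y - δ t) 0))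
  rw [sum_apply, one_apply_eq_self] at h1
  rw [← h1, Finset.sum_mul]
  exact norm_sum_le_of_le _ fun j _ => hC j hsol hε hε1 hg ha h0 t ht y

variable [DecidableEq ι]

/-- The weighted Duhamel inequality is applied along the backward characteristic. Admissibility and
the error bound are required only in the cone of slope `Λ` that contains this curve, which is what
makes a local argument possible. The rate `κ / 4` is half of the damping `κ / 2` left by the weight.
-/
theorem exists_norm_charComp_le [CompleteSpace E]
    (hh : IsHyperbolicTube tr O Kc r W 𝔸 q l P σ c₀ κ) (hΦ : IsJetFlux O 𝔸 q Φ) (hK : 1 ≤ K)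
    {β : ℝ → E →L[ℝ] E} (hβ : BddC1 β) (hβ0 : Tendsto β (cocompact ℝ) (𝓝 0))
    (hlow : (fun η : JetConfig E => Φ (K - 1) η.J - Φ (K - 1) (jet W η.x))
      =O[𝓟 (admissible W K C₀ r)] err W K)
    (htop : (fun η : JetConfig E => Φ K η.J - Φ K (jet W η.x) -
      (fderiv ℝ q (W η.x) + β η.x) (disp W K η)) =O[𝓟 (admissible W K C₀ r)] err W K)
    {B : ℝ → E →L[ℝ] E} (hB : B = profileGauge W l P fun x => fderiv ℝ q (W x) + β x) (j : ι) :
    ∃ C ε₀ Λ, 0 ≤ C ∧ 0 < ε₀ ∧ 0 ≤ Λ ∧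
      ∀ {T ε : ℝ} {V : ℝ → ℝ → E} {δ δ' g : ℝ → ℝ} {a α c t y₀ : ℝ},
      IsPerturbedSolution W 𝔸 q T ε V δ δ' → ε ≤ r → ε ≤ ε₀ → IsDriver W T V δ δ' g → 0 ≤ a →
      0 ≤ α → 0 ≤ c → t ∈ Icc 0 T →
      (∀ k ≤ K, ∀ y, ‖jet (V 0) y k - jet W (y - δ 0) k‖ ≤ a) →
      (∀ s ∈ Icc 0 t, ∀ y, |y - y₀| ≤ Λ * (t - s) → ∃ e h,
        solConfig V δ δ' e h ε s y ∈ admissible W K C₀ r ∧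
        err W K (solConfig V δ δ' e h ε s y) ≤ α * expHistory (κ / 4) a g s + c * g s) →
      ‖charComp W P B j K (solConfig V δ δ' 0 1 ε t y₀)‖ ≤
        C * (1 + α + c) * expHistory (κ / 4) a g t := by
  have hΦW := hΦ.stationary hh.tube.smooth hh.mem hh.stationary
  obtain ⟨φ, hφ, ⟨M, hM⟩, C, ε₀, hC0, hε₀, hC⟩ :=
    exists_weight hh hK hΦ.zero hΦW hβ hβ0 hlow htop hB j
  obtain ⟨Λ, hΛ0, hΛ⟩ := hh.tube.exists_bound (hh.smooth_l j).continuousOn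
  obtain ⟨D, hD0, hD⟩ := hh.tube.exists_bound (hh.smooth_P j).continuousOn
  have hBc : BddC1 B := hB ▸ hh.bddC1_profileGauge
    ((hh.tube.bddC1_comp (contDiffOn_fderiv hh.tube.isOpen hh.smooth_q)).add hβ)
  obtain ⟨b, hb⟩ := hBc.bdd
  have hb0 : 0 ≤ b := (norm_nonneg _).trans (hb 0)
  have hκ := hh.damping_pos
  refine ⟨Real.exp (2 * M) * (D * (1 + b) + C / (κ / 4) + C), ε₀, Λ, by positivity, hε₀, hΛ0, ?_⟩
  intro T ε V δ δ' g a α c t y₀ hsol hε hεε₀ hg ha hα hc ht h0 hJ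
  obtain ⟨y, hyt, hyc, hyd, hy'⟩ := hsol.exists_characteristic hh.tube hε (hh.smooth_l j) hΛ ht y₀
  have hsub : ∀ s ∈ Icc 0 t, s ∈ Icc 0 T := fun s hs => ⟨hs.1, hs.2.trans ht.2⟩
  have hsub' : ∀ s ∈ Ioo 0 t, s ∈ Ioo 0 T := fun s hs => ⟨hs.1, hs.2.trans_le ht.2⟩
  have hV0 : ∀ s y, V s y = jet (V s) y 0 := fun s y => by simp [jet]
  have hxc := hsol.continuousOn_foot ht hyc
  have key := norm_le_expHistory_of_weight (θ := κ / 4) (a := a) (g := g) (α := C * α)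
    (c₀ := D * (1 + b)) (c := C * c)
    -- The component depends only on the base point and the jet. The scales `e` and `h` are
    -- therefore filled with the dummy values `0` and `1`, although admissibility is later checked
    -- with other scales.
    (z := fun s => charComp W P B j K (solConfig V δ δ' 0 1 ε s (y s)))
    (z' := fun s => charRate W 𝔸 l P Φ B j K (solConfig V δ δ' 0 1 ε s (y s)))
    (x := fun s => y s - δ s) (x' := fun s => l j (jet (V s) (y s) 0) - δ' s)
    (by positivity) ht.1 ht.2 ha hg.integrable hg.nonneg (by positivity) (by positivity)
    (by positivity) hφ hM hxc (fun s hs => (hy' s hs).sub (hsol.hasDerivAt_shift s (hsub' s hs)))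
    (ContinuousOn.clm_apply
      ((hh.smooth_P j).continuousOn.comp (hsol.continuousOn_jet_curve ht hyc 0) fun s hs => by
        change jet (V s) (y s) 0 ∈ O
        rw [← hV0]; exact hh.tube.subset (hsol.mem hh.tube hε (hsub s hs) _))
      ((hsol.continuousOn_disp_curve hh.tube.smooth ht hyc 0 1 K).add
        ((hBc.differentiable.continuous.comp_continuousOn hxc).clm_apply
          (hsol.continuousOn_disp_curve hh.tube.smooth ht hyc 0 1 (K - 1)))))
    (fun s hs => by
      have hu := hsol.hasDerivAt_disp_curve hh.tube hε hΦ (hsub' s hs) (hy' s hs) 0 1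
      have hx := (hy' s hs).sub (hsol.hasDerivAt_shift s (hsub' s hs))
      refine ((hsol.hasDerivAt_comp_jet_curve hh.tube hε hΦ (hsub' s hs) (hy' s hs) 0 1
        (hh.smooth_P j)).clm_apply ((hu K).add (((hBc.differentiable _).hasDerivAt.scomp s
          hx).clm_apply (hu (K - 1))))).congr_deriv ?_
      rfl)
    (by
      have h1 : ‖P j (jet (V 0) (y 0) 0)‖ ≤ D := by
        rw [← hV0]; exact hD _ (hsol.mem hh.tube hε (left_mem_Icc.2 hsol.pos.le) _)
      have h2 : ‖disp W K (solConfig V δ δ' 0 1 ε 0 (y 0)) + B (y 0 - δ 0)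
          (disp W (K - 1) (solConfig V δ δ' 0 1 ε 0 (y 0)))‖ ≤ a + b * a :=
        norm_add_le_of_le (h0 K le_rfl _) (ContinuousLinearMap.le_of_opNorm_le_of_le _ (hb _)
          (h0 (K - 1) (Nat.sub_le _ _) _))
      refine (ContinuousLinearMap.le_of_opNorm_le_of_le _ h1 h2).trans_eq (by ring))
    (fun s hs => by
      obtain ⟨e, h, hadm, herr⟩ := hJ s (Ioo_subset_Icc_self hs) (y s)
        (hyd s (Ioo_subset_Icc_self hs))
      have h1 := hC _ hadm hεε₀
      have h2 := mul_le_mul_of_nonneg_left (mul_le_mul_of_nonneg_left herr hC0)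
        (norm_nonneg (charComp W P B j K (solConfig V δ δ' 0 1 ε s (y s))))
      refine (h1.trans (add_le_add_right h2 _)).trans_eq ?_
      have h3 : charComp W P B j K (solConfig V δ δ' e h ε s (y s)) =
        charComp W P B j K (solConfig V δ δ' 0 1 ε s (y s)) := rfl
      rw [h3]
      ring)
  have hG := expHistory_nonneg (θ := κ / 4) ha hg.integrable hg.nonneg ht.1 ht.2
  rw [← hyt]
  refine key.trans (mul_le_mul_of_nonneg_right ?_ hG)
  rw [mul_assoc]
  refine mul_le_mul_of_nonneg_left ?_ (Real.exp_pos _).le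
  have e1 : C * α / (κ / 4) = C / (κ / 4) * α := by ring
  have e2 : 0 ≤ C / (κ / 4) := by positivity
  have e3 : 0 ≤ D * (1 + b) := by positivity
  rw [e1]
  nlinarith [mul_nonneg e2 hc, mul_nonneg e3 hα, mul_nonneg e3 hc, mul_nonneg hC0 hα]

end CharacteristicEstimates

/-! ### Interpolation scales adapted to smallness in `C^1` -/

section JetInterpolation

variable {E : Type*} [NormedAddCommGroup E] [NormedSpace ℝ E]

/-- Take `e = min ε X` and, for `K ≥ 2`, `h` with `e * h ^ (K - 1) = X`, then interpolate between
the first derivative and the `K`-th with step `1 / h`. Starting from order one rather than zero is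
what produces the exponents `a - 1`. -/
theorem exists_geometric_bound {K : ℕ} (hK : 1 ≤ K) : ∃ C₀ : ℝ, 0 ≤ C₀ ∧
    ∀ (f : ℕ → ℝ → E) (lo hi ε X : ℝ), 1 ≤ hi - lo →
      (∀ k x, HasDerivAt (f k) (f (k + 1) x) x) → 0 < ε → 0 < X →
      (∀ x ∈ Icc lo hi, ‖f 0 x‖ ≤ ε) → (∀ x ∈ Icc lo hi, ‖f 1 x‖ ≤ ε) →
      (∀ x ∈ Icc lo hi, ‖f 0 x‖ ≤ X) → (∀ x ∈ Icc lo hi, ‖f K x‖ ≤ X) →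
      ∃ e h : ℝ, 0 ≤ e ∧ e ≤ ε ∧ 1 ≤ h ∧ e * h ^ (K - 1) ≤ X ∧
        (∀ x ∈ Icc lo hi, ‖f 0 x‖ ≤ e) ∧
        ∀ a, 1 ≤ a → a ≤ K → ∀ x ∈ Icc lo hi, ‖f a x‖ ≤ C₀ * (e * h ^ (a - 1)) := by
  obtain ⟨C₁, hC₁, h₁⟩ := exists_interpolation (F := E) K
  obtain ⟨C₂, hC₂, h₂⟩ := exists_interpolation (F := E) (K - 1)
  refine ⟨C₂ * (2 * C₁ + 1), by positivity, ?_⟩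
  intro f lo hi ε X hlen hf hε hX h0ε h1ε h0X hKX
  have he : 0 < min ε X := lt_min hε hX
  -- The first derivative is at most `ε` by assumption and at most a multiple of `X` by
  -- interpolation with step one, hence bounded by a multiple of the minimum.
  have h1e : ∀ x ∈ Icc lo hi, ‖f 1 x‖ ≤ 2 * C₁ * min ε X := fun x hx => by
    have h3 := h₁ f lo hi X X 1 hlen hf one_pos le_rfl h0X hKX 1 hK x hx
    simp only [one_pow, one_mul] at h3
    rw [mul_min_of_nonneg _ _ (by positivity : 0 ≤ 2 * C₁)]
    refine le_min ((h1ε x hx).trans ?_) (by linarith)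
    nlinarith
  have hC₂' : 2 * C₁ ≤ C₂ * (2 * C₁ + 1) := by nlinarith
  -- For `K = 1` there is no exponent from which to determine `h`, and `h = 1` serves.
  rcases eq_or_lt_of_le hK with rfl | hK2
  · refine ⟨min ε X, 1, he.le, min_le_left _ _, le_rfl, by simp, fun x hx =>
      le_min (h0ε x hx) (h0X x hx), fun a ha1 ha2 x hx => ?_⟩
    obtain rfl : a = 1 := le_antisymm ha2 ha1
    simp only [Nat.sub_self, pow_zero, mul_one]
    exact (h1e x hx).trans (mul_le_mul_of_nonneg_right hC₂' he.le)
  · have hn : K - 1 ≠ 0 := by omega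
    have hq : 1 ≤ X / min ε X := (one_le_div he).2 (min_le_right _ _)
    set h := (X / min ε X) ^ ((K - 1 : ℕ) : ℝ)⁻¹ with hh
    have hh1 : 1 ≤ h := Real.one_le_rpow hq (by positivity)
    have hpow : h ^ (K - 1) = X / min ε X := Real.rpow_inv_natCast_pow (by positivity) hn
    have hX' : min ε X * h ^ (K - 1) = X := by rw [hpow]; field_simp
    refine ⟨min ε X, h, he.le, min_le_left _ _, hh1, hX'.le, fun x hx =>
      le_min (h0ε x hx) (h0X x hx), fun a ha1 ha2 x hx => ?_⟩
    have hh0 : 0 < h := one_pos.trans_le hh1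
    have h3 := h₂ (fun k => f (k + 1)) lo hi (2 * C₁ * min ε X) X h⁻¹ hlen (fun k x => hf (k + 1) x)
      (by positivity) (inv_le_one_of_one_le₀ hh1) h1e
      (by simpa only [Nat.sub_add_cancel hK] using hKX) (a - 1) (by omega) x hx
    simp only [Nat.sub_add_cancel ha1, inv_pow] at h3
    rw [show (h ^ (K - 1))⁻¹ * X = min ε X by rw [hpow]; field_simp, inv_mul_le_iff₀ (by positivity)]
      at h3
    exact h3.trans_eq (by ring)

/-- Interpolation with step `τ` gives `τ ^ K * X` on the right and `τ ^ k` on the left. As `k < K`,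
a small factor `τ` is left in front of the top-order bound. -/
theorem exists_lower_order_bound (K : ℕ) : ∃ C : ℝ, 1 ≤ C ∧
    ∀ (f : ℕ → ℝ → E) (lo hi m X τ : ℝ), 1 ≤ hi - lo →
      (∀ k x, HasDerivAt (f k) (f (k + 1) x) x) → 0 < τ → τ ≤ 1 → 0 ≤ X →
      (∀ x ∈ Icc lo hi, ‖f 0 x‖ ≤ m) → (∀ x ∈ Icc lo hi, ‖f K x‖ ≤ X) →
      ∀ k < K, ∀ x ∈ Icc lo hi, ‖f k x‖ ≤ C * (m / τ ^ K + τ * X) := by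
  obtain ⟨C, hC, h⟩ := exists_interpolation (F := E) K
  refine ⟨C, hC, fun f lo hi m X τ hlen hf hτ hτ1 hX h0 hK k hk x hx => ?_⟩
  have h1 := h f lo hi m X τ hlen hf hτ hτ1 h0 hK k hk.le x hx
  have hm : 0 ≤ m := (norm_nonneg _).trans (h0 x hx)
  have h2 : τ ^ k * (C * (m / τ ^ K + τ * X)) ≥ C * (m + τ ^ K * X) := by
    have e1 : τ ^ K ≤ τ ^ (k + 1) := pow_le_pow_of_le_one hτ.le hτ1 hk
    have e2 : m ≤ τ ^ k * (m / τ ^ K) := by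
      rw [mul_div_assoc', le_div_iff₀ (by positivity), mul_comm]
      exact mul_le_mul_of_nonneg_right (pow_le_pow_of_le_one hτ.le hτ1 hk.le) hm
    have e3 := mul_le_mul_of_nonneg_right e1 hX
    rw [pow_succ] at e3
    have e4 : m + τ ^ K * X ≤ τ ^ k * (m / τ ^ K + τ * X) := by linarith
    calc _ ≤ C * (τ ^ k * (m / τ ^ K + τ * X)) := mul_le_mul_of_nonneg_left e4 (by linarith)
      _ = _ := by ring
  exact le_of_mul_le_mul_left (h1.trans h2) (by positivity)

end JetInterpolation

/-! ### Local finiteness and recovery of the highest derivative -/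

section HighOrder

variable {ι E : Type*} [Fintype ι] [DecidableEq ι] [NormedAddCommGroup E] [InnerProductSpace ℝ E]
  {tr : (E →L[ℝ] E) →L[ℝ] ℝ} {O Kc : Set E} {r : ℝ} {W : ℝ → E}
  {𝔸 : E → E →L[ℝ] E} {q : E → E} {l : ι → E → ℝ} {P : ι → E → E →L[ℝ] E}
  {σ : ι → ℝ} {c₀ κ : ℝ} {Φ : ℕ → (ℕ → E) → E} {K : ℕ}

open JetConfig

/-- Smoothness on a compact set gives a finite, though not uniform, bound on derivatives that are
not controlled at infinity. It only serves to start the absorption. -/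
theorem IsPerturbedSolution.exists_bound_on_rectangle {T ε : ℝ} {V : ℝ → ℝ → E} {δ δ' : ℝ → ℝ}
    (hsol : IsPerturbedSolution W 𝔸 q T ε V δ δ') (hW : ContDiff ℝ ∞ W) (k : ℕ) {t : ℝ}
    (ht : t ∈ Icc 0 T) (lo hi : ℝ) :
    ∃ C, 0 ≤ C ∧ ∀ s ∈ Icc 0 t, ∀ y ∈ Icc lo hi, ‖jet (V s) y k - jet W (y - δ s) k‖ ≤ C := by
  have hsub : Icc 0 t ×ˢ Icc lo hi ⊆ strip T := fun p hp =>
    mem_strip.2 ⟨hp.1.1, hp.1.2.trans ht.2⟩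
  have h1 : ContinuousOn (fun p : ℝ × ℝ => jet (V p.1) p.2 k - jet W (p.2 - δ p.1) k)
      (Icc 0 t ×ˢ Icc lo hi) := by
    refine ((contDiffOn_spaceDeriv hsol.pos hsol.smooth k).1.continuousOn.mono hsub).sub ?_
    refine (hW.continuous_iteratedDeriv k (by exact_mod_cast le_top)).comp_continuousOn
      (continuousOn_snd.sub (hsol.continuousOn_shift.comp continuousOn_fst fun p hp => ?_))
    exact mem_strip.1 (hsub hp)
  obtain ⟨C, hC⟩ := ((isCompact_Icc.prod isCompact_Icc).image_of_continuousOn h1.norm).bddAbove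
  exact ⟨max C 0, le_max_right _ _, fun s hs y hy =>
    (hC ⟨(s, y), ⟨hs, hy⟩, rfl⟩).trans (le_max_left _ _)⟩

theorem IsPerturbedSolution.hasDerivAt_disp {T ε : ℝ} {V : ℝ → ℝ → E} {δ δ' : ℝ → ℝ}
    (hsol : IsPerturbedSolution W 𝔸 q T ε V δ δ') (hW : ContDiff ℝ ∞ W) {s : ℝ} (hs : s ∈ Icc 0 T)
    (k : ℕ) (y : ℝ) : HasDerivAt (fun y => jet (V s) y k - jet W (y - δ s) k)
      (jet (V s) y (k + 1) - jet W (y - δ s) (k + 1)) y :=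
  (hasDerivAt_jet (contDiff_slice hsol.smooth hs) k y).sub
    ((hasDerivAt_jet hW k (y - δ s)).comp_sub_const y (δ s))

theorem expHistory_pos {θ a T t : ℝ} {g : ℝ → ℝ} (ha : 0 < a) (hg : IntegrableOn g (Icc 0 T))
    (hg0 : ∀ s, 0 ≤ g s) (ht : t ∈ Icc 0 T) : 0 < expHistory θ a g t :=
  pos_of_mul_pos_right (ha.trans_le (le_exp_mul_expHistory (θ := θ) hg hg0 ht.1 ht.2))
    (Real.exp_pos _).le

omit [DecidableEq ι] in
-- The projections sum to one, so the components rebuild the derivative of order `K` up to the gauge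
-- term, which has lower order.
theorem norm_disp_le_of_charComp {T ε : ℝ} {V : ℝ → ℝ → E} {δ δ' : ℝ → ℝ}
    (hh : IsHyperbolicTube tr O Kc r W 𝔸 q l P σ c₀ κ)
    (hsol : IsPerturbedSolution W 𝔸 q T ε V δ δ') (hε : ε ≤ r) {B : ℝ → E →L[ℝ] E} {b : ℝ}
    (hb : ∀ x, ‖B x‖ ≤ b) {t y G m : ℝ} (ht : t ∈ Icc 0 T) {C : ι → ℝ}
    (hC : ∀ j, ‖charComp W P B j K (solConfig V δ δ' 0 1 ε t y)‖ ≤ C j * G)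
    (hm : ‖jet (V t) y (K - 1) - jet W (y - δ t) (K - 1)‖ ≤ m) :
    ‖jet (V t) y K - jet W (y - δ t) K‖ ≤ (∑ j, C j) * G + b * m := by
  set u := jet (V t) y K - jet W (y - δ t) K
  set u' := jet (V t) y (K - 1) - jet W (y - δ t) (K - 1)
  have hV0 : jet (V t) y 0 = V t y := by simp [jet]
  have h1 := congr($((hh.frame _ (hh.tube.subset (hsol.mem hh.tube hε ht y))).sum_eq_one)
    (u + B (y - δ t) u'))
  rw [sum_apply, one_apply_eq_self] at h1
  have h2 : ‖u + B (y - δ t) u'‖ ≤ (∑ j, C j) * G := by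
    rw [← h1, Finset.sum_mul]
    refine norm_sum_le_of_le _ fun j _ => ?_
    rw [← hV0]
    exact hC j
  have h3 : ‖B (y - δ t) u'‖ ≤ b * m := ContinuousLinearMap.le_of_opNorm_le_of_le _ (hb _) hm
  calc ‖u‖ = ‖(u + B (y - δ t) u') - B (y - δ t) u'‖ := by rw [add_sub_cancel_right]
    _ ≤ _ := norm_sub_le_of_le h2 h3

end HighOrder

/-! ### Absorption of the highest order terms in a backward cone -/

section Absorption

variable {ι E : Type*} [Fintype ι] [DecidableEq ι] [NormedAddCommGroup E] [InnerProductSpace ℝ E]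
  {tr : (E →L[ℝ] E) →L[ℝ] ℝ} {O Kc : Set E} {r : ℝ} {W : ℝ → E}
  {𝔸 : E → E →L[ℝ] E} {q : E → E} {l : ι → E → ℝ} {P : ι → E → E →L[ℝ] E}
  {σ : ι → ℝ} {c₀ κ : ℝ} {Φ : ℕ → (ℕ → E) → E} {K : ℕ}

open JetConfig

theorem exists_pos_le_of_finite {ι : Type*} [Finite ι] {f : ι → ℝ} (hf : ∀ j, 0 < f j) :
    ∃ ε > 0, ∀ j, ε ≤ f j := by
  have h : ∀ᶠ ε : ℝ in 𝓝[>] 0, ∀ j, ε ≤ f j :=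
    eventually_all.2 fun j => nhdsWithin_le_nhds (Iic_mem_nhds (hf j))
  obtain ⟨ε, h1, h2⟩ := (h.and self_mem_nhdsWithin).exists
  exact ⟨ε, h2, h1⟩

/-- Damping estimate for the derivative of highest order. -/
theorem exists_norm_top_disp_le [CompleteSpace E]
    (hh : IsHyperbolicTube tr O Kc r W 𝔸 q l P σ c₀ κ) (hΦ : IsJetFlux O 𝔸 q Φ) (hK : 1 ≤ K)
    (hflux : ∀ C₀, 0 ≤ C₀ → ∃ β : ℝ → E →L[ℝ] E, BddC1 β ∧ Tendsto β (cocompact ℝ) (𝓝 0) ∧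
      ((fun η : JetConfig E => Φ (K - 1) η.J - Φ (K - 1) (jet W η.x))
        =O[𝓟 (admissible W K C₀ r)] err W K) ∧
      ((fun η : JetConfig E => Φ K η.J - Φ K (jet W η.x) -
        (fderiv ℝ q (W η.x) + β η.x) (disp W K η)) =O[𝓟 (admissible W K C₀ r)] err W K)) :
    ∃ C ε, 0 ≤ C ∧ 0 < ε ∧ ε ≤ r ∧ ε ≤ 1 ∧
      ∀ {T : ℝ} {V : ℝ → ℝ → E} {δ δ' g : ℝ → ℝ} {a : ℝ},
      IsPerturbedSolution W 𝔸 q T ε V δ δ' → IsDriver W T V δ δ' g → 0 < a →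
      (∀ k ≤ K, ∀ y, ‖jet (V 0) y k - jet W (y - δ 0) k‖ ≤ a) → ∀ t ∈ Icc 0 T, ∀ y,
        ‖jet (V t) y K - jet W (y - δ t) K‖ ≤ C * expHistory (κ / 4) a g t := by
  have hκ := hh.damping_pos
  obtain ⟨C₀, hC₀, hgeom⟩ := exists_geometric_bound (E := E) hK
  obtain ⟨C₁, hC₁, hlower⟩ := exists_lower_order_bound (E := E) K
  obtain ⟨β, hβ, hβ0, hlow, htop⟩ := hflux C₀ hC₀
  obtain ⟨M₀, hM₀, hzero⟩ := exists_norm_disp_zero_le hh hΦ (by positivity : 0 < κ / 4)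
  set B := profileGauge W l P fun x => fderiv ℝ q (W x) + β x with hB
  have hBc : BddC1 B := hh.bddC1_profileGauge
    ((hh.tube.bddC1_comp (contDiffOn_fderiv hh.tube.isOpen hh.smooth_q)).add hβ)
  obtain ⟨b, hb⟩ := hBc.bdd
  have hb0 : 0 ≤ b := (norm_nonneg _).trans (hb 0)
  choose Cj εj Λj hCj hεj hΛj hchar using
    fun j => exists_norm_charComp_le hh hΦ hK hβ hβ0 hlow htop hB j
  obtain ⟨ε₀, hε₀, hεle⟩ := exists_pos_le_of_finite hεj
  set Λ := ∑ j, Λj j with hΛ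
  have hΛle : ∀ j, Λj j ≤ Λ := fun j => Finset.single_le_sum (fun j _ => hΛj j) (Finset.mem_univ j)
  have hΛ0 : 0 ≤ Λ := Finset.sum_nonneg fun j _ => hΛj j
  set Cs := ∑ j, Cj j with hCs
  have hCs0 : 0 ≤ Cs := Finset.sum_nonneg fun j _ => hCj j
  have hC₁0 : 0 ≤ C₁ := zero_le_one.trans hC₁
  have hr := hh.tube.pos
  -- the step of the interpolation and the smallness of the solution
  set Q := Cs * (K * C₁) + b * C₁ with hQ
  have hQ0 : 0 ≤ Q := by positivity
  -- Here `Q` collects all coefficients of `τ` times the top order; the choice of `τ` makes their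
  -- contribution at most a quarter.
  set τ := min 1 (1 / (4 * (Q + 1))) with hτ
  have hτ0 : 0 < τ := lt_min one_pos (by positivity)
  have hτ1 : τ ≤ 1 := min_le_left _ _
  have hτQ : Q * τ ≤ 1 / 4 := by
    have h1 : Q * τ ≤ Q * (1 / (4 * (Q + 1))) := mul_le_mul_of_nonneg_left (min_le_right _ _) hQ0
    refine h1.trans ?_
    rw [mul_one_div, div_le_div_iff₀ (by positivity) (by norm_num)]
    linarith
  -- The nonlinear terms contribute another quarter of the top order, so half of the assumed bound
  -- is recovered in total.
  set ε := min (min r 1) (min ε₀ (1 / (4 * (Cs + 1)))) with hε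
  have hεpos : 0 < ε := lt_min (lt_min hr one_pos) (lt_min hε₀ (by positivity))
  have hεr : ε ≤ r := (min_le_left _ _).trans (min_le_left _ _)
  have hε1 : ε ≤ 1 := (min_le_left _ _).trans (min_le_right _ _)
  have hεε₀ : ε ≤ ε₀ := (min_le_right _ _).trans (min_le_left _ _)
  have hεC : Cs * ε ≤ 1 / 4 := by
    have h1 : Cs * ε ≤ Cs * (1 / (4 * (Cs + 1))) :=
      mul_le_mul_of_nonneg_left ((min_le_right _ _).trans (min_le_right _ _)) hCs0
    refine h1.trans ?_
    rw [mul_one_div, div_le_div_iff₀ (by positivity) (by norm_num)]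
    linarith
  set c := K * C₁ / τ ^ K + 1 with hc
  have hc0 : 0 ≤ c := by positivity
  -- The summand `M₀` ensures that every `S ≥ 2 * D` also bounds the undifferentiated perturbation
  -- relative to the history; the summand `1` makes `D` positive.
  set D := Cs * (1 + c) + b * (C₁ * (M₀ / τ ^ K)) + M₀ + 1 with hD
  have hDM : M₀ ≤ 2 * D := by
    have h1 : 0 ≤ Cs * (1 + c) := by positivity
    have h2 : 0 ≤ b * (C₁ * (M₀ / τ ^ K)) := by positivity
    linarith
  have hDpos : 0 < D := by positivity
  refine ⟨2 * D, ε, by positivity, hεpos, hεr, hε1, ?_⟩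
  intro T V δ δ' g a hsol hg ha h0 t ht y
  have hG : ∀ s ∈ Icc 0 T, 0 < expHistory (κ / 4) a g s := fun s hs =>
    expHistory_pos ha hg.integrable hg.nonneg hs
  have hsubT : ∀ s ∈ Icc 0 t, s ∈ Icc 0 T := fun s hs => ⟨hs.1, hs.2.trans ht.2⟩
  have hW := hh.tube.smooth
  have hz := fun s hs y => hzero hsol hεr hε1 hg ha.le (h0 0 (Nat.zero_le K)) s hs y
  obtain ⟨B₁, hB₁, hrect⟩ := hsol.exists_bound_on_rectangle hW K ht (y - 1 - Λ * t) (y + 1 + Λ * t)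
  -- The slope exceeds every characteristic speed, so backward characteristics from points of the
  -- cone stay in it. The extra width `1` keeps every time slice long enough for interpolation.
  set cone : Set (ℝ × ℝ) := {p | p.1 ∈ Icc 0 t ∧ |p.2 - y| ≤ 1 + Λ * (t - p.1)} with hcone
  suffices hf : ∀ p : cone, ‖jet (V p.1.1) p.1.2 K - jet W (p.1.2 - δ p.1.1) K‖ /
      expHistory (κ / 4) a g p.1.1 ≤ 2 * D by
    have h1 := hf ⟨(t, y), right_mem_Icc.2 ht.1, by simp⟩
    rwa [div_le_iff₀ (hG t ht)] at h1
  -- The quantity to be bounded is the ratio of the top derivative to the history. The bound `B₀`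
  -- depends on the cone, but the conclusion does not.
  refine fun p => le_two_mul_of_improving
    (f := fun p : cone => ‖jet (V p.1.1) p.1.2 K - jet W (p.1.2 - δ p.1.1) K‖ /
      expHistory (κ / 4) a g p.1.1) (B₀ := B₁ * (Real.exp (κ / 4 * t) / a)) (fun p => ?_)
    (fun S hS hSf p => ?_) p
  · obtain ⟨⟨s, y'⟩, hs, hy'⟩ := p
    have h1 : ‖jet (V s) y' K - jet W (y' - δ s) K‖ ≤ B₁ := hrect s hs y' (by
      have h2 : Λ * (t - s) ≤ Λ * t := by
        have := mul_nonneg hΛ0 hs.1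
        simp only at this
        linarith [mul_sub Λ t s]
      have h3 := abs_le.1 hy'
      simp only at h3
      constructor <;> linarith)
    have h2 := le_exp_mul_expHistory (θ := κ / 4) (a := a) hg.integrable hg.nonneg hs.1
      (hsubT s hs).2
    have h3 : Real.exp (κ / 4 * s) ≤ Real.exp (κ / 4 * t) := by
      gcongr; exact hs.2
    have h4 := hG s (hsubT s hs)
    simp only at h2 ⊢
    rw [div_le_iff₀ h4, mul_assoc]
    refine h1.trans (le_mul_of_one_le_right hB₁ ?_)
    rw [div_mul_eq_mul_div, one_le_div ha]
    exact h2.trans (mul_le_mul_of_nonneg_right h3 h4.le)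
  · obtain ⟨⟨s₀, y₀⟩, hs₀, hy₀⟩ := p
    have hS0 : 0 ≤ S := hDpos.le.trans (by linarith)
    have hSpos : 0 < S := by linarith
    have hMS : M₀ ≤ S := hDM.trans hS
    have htop : ∀ s ∈ Icc 0 t, ∀ y' ∈ Icc (y - (1 + Λ * (t - s))) (y + (1 + Λ * (t - s))),
        ‖jet (V s) y' K - jet W (y' - δ s) K‖ ≤ S * expHistory (κ / 4) a g s := by
      intro s hs y' hy'
      have h1 := hSf ⟨(s, y'), hs, abs_le.2 ⟨by
        have := hy'.1
        simp only
        linarith, by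
        have := hy'.2
        simp only
        linarith⟩⟩
      rwa [div_le_iff₀ (hG s (hsubT s hs))] at h1
    have hlen : ∀ s ∈ Icc 0 t,
        1 ≤ y + (1 + Λ * (t - s)) - (y - (1 + Λ * (t - s))) := fun s hs => by
      have := mul_nonneg hΛ0 (sub_nonneg.2 hs.2)
      linarith
    have hlow' : ∀ s ∈ Icc 0 t, ∀ m,
        (∀ y', ‖jet (V s) y' 0 - jet W (y' - δ s) 0‖ ≤ m) → ∀ k < K,
        ∀ y' ∈ Icc (y - (1 + Λ * (t - s))) (y + (1 + Λ * (t - s))),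
          ‖jet (V s) y' k - jet W (y' - δ s) k‖ ≤
            C₁ * (m / τ ^ K + τ * (S * expHistory (κ / 4) a g s)) := fun s hs m hm k hk =>
      hlower (fun k y => jet (V s) y k - jet W (y - δ s) k) _ _ m _ τ (hlen s hs)
        (hsol.hasDerivAt_disp hW (hsubT s hs)) hτ0 hτ1
        (mul_nonneg hS0 (hG s (hsubT s hs)).le) (fun x _ => hm x) (htop s hs) k hk
    -- The backward cone of a point of the cone is contained in the cone.
    have hmem : ∀ s ∈ Icc 0 s₀, ∀ y', |y' - y₀| ≤ Λ * (s₀ - s) →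
        y' ∈ Icc (y - (1 + Λ * (t - s))) (y + (1 + Λ * (t - s))) := by
      intro s _ y' hy'
      have h1 := abs_le.1 hy'
      have h2 := abs_le.1 hy₀
      simp only at h2
      constructor <;> linarith [mul_sub Λ t s₀, mul_sub Λ s₀ s, mul_sub Λ t s]
    have hs₀T := hsubT s₀ hs₀
    have hG₀ := hG s₀ hs₀T
    -- The coefficient of the history has a factor `τ` from interpolating the lower derivatives and
    -- a factor `ε` from the nonlinear terms.
    have hkey : ∀ j, ‖charComp W P B j K (solConfig V δ δ' 0 1 ε s₀ y₀)‖ ≤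
        (Cj j * (1 + (K * C₁ * τ + ε) * S + c)) * expHistory (κ / 4) a g s₀ := by
      intro j
      refine hchar j hsol hεr (hεε₀.trans (hεle j)) hg ha.le (by positivity) hc0 hs₀T h0
        fun s hs y' hy' => ?_
      have hst : s ∈ Icc 0 t := ⟨hs.1, hs.2.trans hs₀.2⟩
      have hsT := hsubT s hst
      have hGs := hG s hsT
      have hy'' := hmem s hs y' (hy'.trans
        (mul_le_mul_of_nonneg_right (hΛle j) (sub_nonneg.2 hs.2)))
      obtain ⟨e, h, he0, heε, hh1, hsize, hbase, hder⟩ := hgeom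
        (fun k y => jet (V s) y k - jet W (y - δ s) k) _ _ ε (S * expHistory (κ / 4) a g s)
        (hlen s hst) (hsol.hasDerivAt_disp hW hsT) hεpos (mul_pos hSpos hGs)
        (fun x _ => hsol.zero_le s hsT x) (fun x _ => hsol.one_le s hsT x)
        (fun x _ => (hz s hsT x).trans (mul_le_mul_of_nonneg_right hMS hGs.le)) (htop s hst)
      refine ⟨e, h, ⟨⟨he0, heε.trans hεr, heε.trans hε1, hh1, ?_, fun a ha1 ha2 => ?_⟩, heε,
        hsol.shift_le s hsT, hε1⟩, ?_⟩
      · have := hbase y' hy''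
        simpa [solConfig, jet] using this
      · exact hder a ha1 ha2 y' hy''
      · have h1 : ∑ a ∈ Finset.range K, ‖disp W a (solConfig V δ δ' e h ε s y')‖ ≤
            K * (C₁ * (g s / τ ^ K + τ * (S * expHistory (κ / 4) a g s))) := by
          refine (Finset.sum_le_card_nsmul _ _ _ fun k hk =>
            hlow' s hst (g s) (hg.disp_le s hsT) k (Finset.mem_range.1 hk) y' hy'').trans_eq ?_
          rw [Finset.card_range, nsmul_eq_mul]
        have h2 : ε * size K (solConfig V δ δ' e h ε s y') ≤ ε * (S * expHistory (κ / 4) a g s) :=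
          mul_le_mul_of_nonneg_left hsize hεpos.le
        have h3 : |δ' s| ≤ g s := hg.shift_le s hsT
        refine (add_le_add (add_le_add h1 h2) h3).trans_eq ?_
        rw [hc]
        ring
    -- The gauge term is evaluated at the single time `s₀`, where the driver `g` is not controlled
    -- by the history. The order-zero bound with constant `M₀` is therefore used in place of `g`.
    have hfin := norm_disp_le_of_charComp hh hsol hεr hb hs₀T hkey
      (hlow' s₀ hs₀ _ (fun y' => hz s₀ hs₀T y') (K - 1) (by omega) y₀
        (hmem s₀ (right_mem_Icc.2 hs₀.1) y₀ (by simp)))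
    simp only
    rw [div_le_iff₀ hG₀]
    refine hfin.trans ?_
    rw [← Finset.sum_mul, ← hCs]
    have e1 : Cs * (1 + (K * C₁ * τ + ε) * S + c) * expHistory (κ / 4) a g s₀ +
        b * (C₁ * (M₀ * expHistory (κ / 4) a g s₀ / τ ^ K +
          τ * (S * expHistory (κ / 4) a g s₀))) =
        (Cs * (1 + c) + b * (C₁ * (M₀ / τ ^ K)) + (Q * τ + Cs * ε) * S) *
          expHistory (κ / 4) a g s₀ := by
      rw [hQ]; ring
    rw [e1]
    refine mul_le_mul_of_nonneg_right ?_ hG₀.le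
    have e2 := mul_le_mul_of_nonneg_right (add_le_add hτQ hεC) hS0
    linarith

/-- Damping estimate for all derivatives up to order `K`. -/
theorem exists_norm_disp_le [CompleteSpace E]
    (hh : IsHyperbolicTube tr O Kc r W 𝔸 q l P σ c₀ κ) (hΦ : IsJetFlux O 𝔸 q Φ) (hK : 1 ≤ K)
    (hflux : ∀ C₀, 0 ≤ C₀ → ∃ β : ℝ → E →L[ℝ] E, BddC1 β ∧ Tendsto β (cocompact ℝ) (𝓝 0) ∧
      ((fun η : JetConfig E => Φ (K - 1) η.J - Φ (K - 1) (jet W η.x))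
        =O[𝓟 (admissible W K C₀ r)] err W K) ∧
      ((fun η : JetConfig E => Φ K η.J - Φ K (jet W η.x) -
        (fderiv ℝ q (W η.x) + β η.x) (disp W K η)) =O[𝓟 (admissible W K C₀ r)] err W K)) :
    ∃ C ε, 0 ≤ C ∧ 0 < ε ∧ ε ≤ r ∧ ε ≤ 1 ∧
      ∀ {T : ℝ} {V : ℝ → ℝ → E} {δ δ' g : ℝ → ℝ} {a : ℝ},
      IsPerturbedSolution W 𝔸 q T ε V δ δ' → IsDriver W T V δ δ' g → 0 < a →
      (∀ k ≤ K, ∀ y, ‖jet (V 0) y k - jet W (y - δ 0) k‖ ≤ a) → ∀ t ∈ Icc 0 T, ∀ k ≤ K, ∀ y,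
        ‖jet (V t) y k - jet W (y - δ t) k‖ ≤ C * expHistory (κ / 4) a g t := by
  obtain ⟨C, ε, hC, hε, hεr, hε1, h⟩ := exists_norm_top_disp_le hh hΦ hK hflux
  obtain ⟨M₀, hM₀, hzero⟩ := exists_norm_disp_zero_le hh hΦ
    (div_pos hh.damping_pos four_pos : 0 < κ / 4)
  obtain ⟨C₁, hC₁, hinterp⟩ := exists_interpolation (F := E) K
  refine ⟨C₁ * (M₀ + C), ε, by positivity, hε, hεr, hε1, ?_⟩
  intro T V δ δ' g a hsol hg ha h0 t ht k hk y
  have h1 := hinterp (fun k y => jet (V t) y k - jet W (y - δ t) k) (y - 1) (y + 1) _ _ 1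
    (by linarith) (hsol.hasDerivAt_disp hh.tube.smooth ht) one_pos le_rfl
    (fun x _ => hzero hsol hεr hε1 hg ha.le (h0 0 (Nat.zero_le K)) t ht x)
    (fun x _ => h hsol hg ha h0 t ht x) k hk y ⟨by linarith, by linarith⟩
  simp only [one_pow, one_mul] at h1
  exact h1.trans_eq (by ring)

end Absorption

/-! ### Linearisation of the prolonged equation -/

section Flux

open JetConfig

/-- The variation of the coefficient multiplies either a perturbation, giving `ε` times the top
size, or a bounded derivative of the profile, giving a term of order zero. -/
theorem JetConfig.linear_sub_isBigO_err {E F : Type*} [NormedAddCommGroup E] [NormedSpace ℝ E]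
    [NormedAddCommGroup F] [NormedSpace ℝ F] {O Kc : Set E} {r : ℝ} {W : ℝ → E} {K : ℕ} {C₀ : ℝ}
    (hT : IsTube O Kc r W) (hK : 1 ≤ K) {g : E → E →L[ℝ] F} (hg : ContDiffOn ℝ ∞ g O) {a : ℕ}
    (ha : a ≤ K) :
    (fun η : JetConfig E => g (η.J 0) (η.J a) - g (W η.x) (jet W η.x a) - g (W η.x) (disp W a η))
      =O[𝓟 (admissible W K C₀ r)] err W K := by
  have h0 := comp_sub_isBigO (K := K) (C₀ := C₀) hT hg
  have h1 := (isBigO_clm_apply (h0.trans disp_zero_isBigO_eps) (disp_isBigO_size ha)).trans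
    eps_mul_size_isBigO_err
  have h2 := isBigO_clm_apply ((h0.trans (disp_isBigO_err hK)).norm_right)
    (isBigO_one_of_bdd (W := W) (hT.bdd a))
  simp only [mul_one] at h2
  refine (h1.add h2.of_norm_right).congr_left fun η => ?_
  simp only [disp, sub_apply, map_sub, jet]
  abel

theorem JetConfig.isBigO_err_of_le {E F : Type*} [NormedAddCommGroup E] [NormedSpace ℝ E]
    [NormedAddCommGroup F] {r : ℝ} {W : ℝ → E} {K : ℕ} {C₀ C : ℝ} (hC : 0 ≤ C)
    {f : JetConfig E → F}
    (h : ∀ η ∈ admissible W K C₀ r, ‖f η‖ ≤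
      C * (∑ a ∈ Finset.range K, ‖η.J a - jet W η.x a‖ + η.e ^ 2 * η.h ^ (K - 1))) :
    f =O[𝓟 (admissible W K C₀ r)] err W K := by
  refine isBigO_principal.2 ⟨C, fun η hη => (h η hη).trans (mul_le_mul_of_nonneg_left ?_ hC)⟩
  refine le_trans ?_ (le_abs_self _)
  have h1 : η.e ^ 2 * η.h ^ (K - 1) ≤ η.ε * size K η := by
    rw [sq, mul_assoc]
    exact mul_le_mul_of_nonneg_right hη.2.1 (size_nonneg hη)
  have h2 := abs_nonneg η.d
  simp only [err, disp]
  linarith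

/-- The nonlinear part at order `K` has degree at least two and total order at most `K + 1`, which
is the range where linearisation yields a coefficient `β` vanishing at infinity and an admissible
error. One order lower the highest derivative does not occur. -/
theorem JetConfig.exists_flux_estimate {N : ℕ} {O Kc : Set (StateSpace N)} {r : ℝ}
    {W : ℝ → StateSpace N} {q : StateSpace N → StateSpace N}
    {R : ℕ → (ℕ → StateSpace N) → StateSpace N} {K : ℕ} {C₀ : ℝ} (hT : IsTube O Kc r W)
    (hq : ContDiffOn ℝ ∞ q O) (hR : ∀ k, DiffPoly O (k + 1) (k + 2) 2 (R k)) (hK : 1 ≤ K)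
    (hC₀ : 0 ≤ C₀) :
    ∃ β : ℝ → StateSpace N →L[ℝ] StateSpace N, BddC1 β ∧ Tendsto β (cocompact ℝ) (𝓝 0) ∧
      ((fun η : JetConfig (StateSpace N) =>
          prolongation q R (K - 1) η.J - prolongation q R (K - 1) (jet W η.x))
        =O[𝓟 (admissible W K C₀ r)] err W K) ∧
      ((fun η : JetConfig (StateSpace N) =>
          prolongation q R K η.J - prolongation q R K (jet W η.x) -
            (fderiv ℝ q (W η.x) + β η.x) (disp W K η)) =O[𝓟 (admissible W K C₀ r)] err W K) := by
  have hdq := contDiffOn_fderiv hT.isOpen hq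
  have hdqo := comp_profile_isBigO_one (K := K) (C₀ := C₀) hT hdq
  have hW0 : ∀ x, jet W x 0 = W x := fun x => by simp [jet]
  obtain ⟨k, rfl⟩ := Nat.exists_eq_add_of_le' hK
  obtain ⟨C, β, hC, hβ, hβ0, -, -, -, hest⟩ :=
    (hR k).exists_estimate hT hK hC₀ le_rfl le_rfl
  refine ⟨β, hβ, hβ0 le_rfl, ?_, ?_⟩
  · rw [Nat.add_sub_cancel]
    -- For `K = 1` the flux one order lower is `q` itself, without a nonlinear remainder.
    cases k with
    | zero =>
      exact ((comp_sub_isBigO hT hq).trans (disp_isBigO_err hK)).congr_left fun η => by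
        simp [prolongation, hW0]
    | succ k =>
      obtain ⟨C', β', hC', -, -, hβ', -, -, hest'⟩ :=
        (hR k).exists_estimate hT hK hC₀ (by omega) (by omega)
      have h1 := linear_sub_isBigO_err (C₀ := C₀) (a := k + 1) hT hK hdq (by omega)
      have h2 := isBigO_clm_apply_right hdqo (disp_isBigO_err (a := k + 1) (K := k + 1 + 1)
        (by omega))
      have h3 : (fun η : JetConfig (StateSpace N) => R k η.J - R k (jet W η.x))
          =O[𝓟 (admissible W (k + 1 + 1) C₀ r)] err W (k + 1 + 1) :=
        isBigO_err_of_le hC' fun η hη => by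
          have := (hest' η.x η.J η.e η.h hη.1).2
          rwa [hβ' (by omega), zero_apply, sub_zero] at this
      refine ((h1.add h2).add h3).congr_left fun η => ?_
      simp only [prolongation, hW0]
      abel
  · have h1 := linear_sub_isBigO_err (C₀ := C₀) (a := k + 1) hT hK hdq le_rfl
    have h2 : (fun η : JetConfig (StateSpace N) => R k η.J - R k (jet W η.x) -
        β η.x (disp W (k + 1) η)) =O[𝓟 (admissible W (k + 1) C₀ r)] err W (k + 1) :=
      isBigO_err_of_le hC fun η hη => (hest η.x η.J η.e η.h hη.1).2
    refine (h1.add h2).congr_left fun η => ?_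
    simp only [prolongation, hW0, add_apply]
    abel

end Flux

/-! ### From the hypotheses on the profile to a hyperbolic tube -/

section ProfileTube

theorem exists_bound_of_tendsto {F : Type*} [NormedAddCommGroup F] {f : ℝ → F} {a b : F}
    (hf : Continuous f) (ha : Tendsto f atBot (𝓝 a)) (hb : Tendsto f atTop (𝓝 b)) :
    ∃ C, ∀ x, ‖f x‖ ≤ C := by
  have h : ∀ᶠ x in cocompact ℝ, ‖f x‖ ≤ max (‖a‖ + 1) (‖b‖ + 1) := by
    rw [cocompact_eq_atBot_atTop, eventually_sup]
    exact ⟨(ha.norm.eventually_le_const (lt_add_one _)).mono fun x hx => hx.trans (le_max_left _ _),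
      (hb.norm.eventually_le_const (lt_add_one _)).mono fun x hx => hx.trans (le_max_right _ _)⟩
  obtain ⟨S, hS, hSc⟩ := mem_cocompact.1 h
  obtain ⟨C, hC⟩ := (hS.image hf.norm).bddAbove
  refine ⟨max C (max (‖a‖ + 1) (‖b‖ + 1)), fun x => ?_⟩
  by_cases hx : x ∈ S
  · exact (hC ⟨x, hx, rfl⟩).trans (le_max_left _ _)
  · exact le_trans (hSc hx) (le_max_right _ _)

/-- Choose an ultrafilter on the line along which `f` tends to `u`. If it contains a compact set, it
converges and `u` is a value of `f`; otherwise it escapes to one of the two ends, and `u` is the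
limit there. -/
theorem mem_closure_range_of_tendsto {F : Type*} [TopologicalSpace F] [T2Space F] {f : ℝ → F}
    {a b u : F} (hf : Continuous f) (ha : Tendsto f atBot (𝓝 a)) (hb : Tendsto f atTop (𝓝 b))
    (hu : u ∈ closure (range f)) : u ∈ range f ∨ u = a ∨ u = b := by
  have hne : (comap f (𝓝 u)).NeBot := comap_neBot_iff_compl_range.2 fun hc =>
    (mem_closure_iff_nhds.1 hu _ hc).elim fun x hx => hx.1 hx.2
  obtain ⟨G, hG⟩ := Ultrafilter.exists_le (comap f (𝓝 u))
  have hGu : Tendsto f G (𝓝 u) := map_le_iff_le_comap.2 hG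
  by_cases hc : ∃ S ∈ G, IsCompact S
  · obtain ⟨S, hS, hSc⟩ := hc
    obtain ⟨x, -, hx⟩ := isCompact_iff_ultrafilter_le_nhds.1 hSc G (le_principal_iff.2 hS)
    exact Or.inl ⟨x, tendsto_nhds_unique ((hf.tendsto x).mono_left hx) hGu⟩
  · have hle : (G : Filter ℝ) ≤ cocompact ℝ := fun s hs => by
      obtain ⟨S, hS, hSc⟩ := mem_cocompact.1 hs
      refine mem_of_superset ?_ hSc
      exact Ultrafilter.compl_mem_iff_notMem.2 fun h => hc ⟨S, h, hS⟩
    rw [cocompact_eq_atBot_atTop] at hle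
    right
    rcases Ultrafilter.le_sup_iff.1 hle with h | h
    · exact Or.inl (tendsto_nhds_unique hGu (ha.mono_left h))
    · exact Or.inr (tendsto_nhds_unique hGu (hb.mono_left h))

/-- By the intermediate value theorem a continuous function bounded away from zero cannot change
sign. -/
theorem exists_sign {f : ℝ → ℝ} (hf : Continuous f) {c : ℝ} (hc : 0 < c) (h : ∀ x, c ≤ |f x|) :
    ∃ σ : ℝ, |σ| = 1 ∧ ∀ x, c ≤ σ * f x := by
  by_cases h0 : ∀ x, 0 ≤ f x
  · exact ⟨1, abs_one, fun x => by simpa [abs_of_nonneg (h0 x)] using h x⟩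
  · push Not at h0
    refine ⟨-1, by simp, fun x => ?_⟩
    have h1 : f x < 0 := by
      by_contra! h2
      obtain ⟨y, hy⟩ := mem_range_of_exists_le_of_exists_ge hf (h0.imp fun _ => le_of_lt) ⟨x, h2⟩
      have := h y
      rw [hy, abs_zero] at this
      linarith
    simpa [abs_of_neg h1] using h x

theorem eventually_trace_mul_le {α E : Type*} [NormedAddCommGroup E] [NormedSpace ℝ E]
    {m : Filter α} {W : α → E} {u : E} {f g : E → E →L[ℝ] E} (tr : (E →L[ℝ] E) →L[ℝ] ℝ) {c κ : ℝ}
    (hW : Tendsto W m (𝓝 u)) (hf : ContinuousAt f u) (hg : ContinuousAt g u)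
    (hc : tr (f u * g u) ≤ -c) (hκ : κ < c) : ∀ᶠ x in m, tr (f (W x) * g (W x)) ≤ -κ := by
  have h : Tendsto (fun x => tr (f (W x) * g (W x))) m (𝓝 (tr (f u * g u))) :=
    (tr.continuous.tendsto (f u * g u)).comp ((hf.tendsto.comp hW).mul (hg.tendsto.comp hW))
  exact h.eventually_le_const (by linarith)

variable {N : ℕ} {𝒰 : Set (StateSpace N)} {A : StateSpace N → Matrix (Fin N) (Fin N) ℝ}
  {q : StateSpace N → StateSpace N} {Ubar : ℝ → StateSpace N} {Um Up : StateSpace N}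

theorem iteratedDeriv_sub_const_eq {F : Type*} [NormedAddCommGroup F] [NormedSpace ℝ F] {k : ℕ}
    (hk : 1 ≤ k) (f : ℝ → F) (c : F) : iteratedDeriv k (fun y => f y - c) = iteratedDeriv k f := by
  obtain ⟨k, rfl⟩ := Nat.exists_eq_add_of_le' hk
  rw [iteratedDeriv_succ', iteratedDeriv_succ']
  congr 1
  ext y
  exact deriv_sub_const (f := f) c

theorem tendsto_exp_neg_mul_abs {θ : ℝ} (c : ℝ) (hθ : 0 < θ) :
    Tendsto (fun x : ℝ => c * Real.exp (-θ * |x|)) (cocompact ℝ) (𝓝 0) := by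
  have h : Tendsto (fun x : ℝ => -θ * |x|) (cocompact ℝ) atBot :=
    (tendsto_norm_cocompact_atTop (E := ℝ)).const_mul_atTop_of_neg (neg_lt_zero.2 hθ)
  simpa using (Real.tendsto_exp_atBot.comp h).const_mul c

namespace IsProfile

theorem tendsto_iteratedDeriv_sub (h : IsProfile 𝒰 A q Ubar Um Up) (k : ℕ) :
    Tendsto (iteratedDeriv k fun y => Ubar y - Um) atBot (𝓝 0) ∧
      Tendsto (iteratedDeriv k fun y => Ubar y - Up) atTop (𝓝 0) := by
  obtain ⟨c, θ, -, hθ, hp, hm⟩ := h.decay k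
  have h0 := tendsto_exp_neg_mul_abs c hθ
  rw [cocompact_eq_atBot_atTop, tendsto_sup] at h0
  exact ⟨squeeze_zero_norm' ((eventually_lt_atBot 0).mono hm) h0.1,
    squeeze_zero_norm' ((eventually_gt_atTop 0).mono hp) h0.2⟩

theorem tendsto_left (h : IsProfile 𝒰 A q Ubar Um Up) : Tendsto Ubar atBot (𝓝 Um) := by
  have := (h.tendsto_iteratedDeriv_sub 0).1
  simp only [iteratedDeriv_zero] at this
  simpa using this.add_const Um

theorem tendsto_right (h : IsProfile 𝒰 A q Ubar Um Up) : Tendsto Ubar atTop (𝓝 Up) := by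
  have := (h.tendsto_iteratedDeriv_sub 0).2
  simp only [iteratedDeriv_zero] at this
  simpa using this.add_const Up

theorem tendsto_iteratedDeriv (h : IsProfile 𝒰 A q Ubar Um Up) {k : ℕ} (hk : 1 ≤ k) :
    Tendsto (iteratedDeriv k Ubar) (cocompact ℝ) (𝓝 0) := by
  have := h.tendsto_iteratedDeriv_sub k
  rw [iteratedDeriv_sub_const_eq hk, iteratedDeriv_sub_const_eq hk] at this
  rw [cocompact_eq_atBot_atTop]
  exact tendsto_sup.2 this

theorem exists_bound (h : IsProfile 𝒰 A q Ubar Um Up) (k : ℕ) :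
    ∃ C, ∀ x, ‖iteratedDeriv k Ubar x‖ ≤ C := by
  rcases Nat.eq_zero_or_pos k with rfl | hk
  · simpa using exists_bound_of_tendsto h.smooth.continuous h.tendsto_left h.tendsto_right
  · have := h.tendsto_iteratedDeriv hk
    rw [cocompact_eq_atBot_atTop, tendsto_sup] at this
    exact exists_bound_of_tendsto (h.smooth.continuous_iteratedDeriv k (by exact_mod_cast le_top))
      this.1 this.2

theorem isCompact_closure_range (h : IsProfile 𝒰 A q Ubar Um Up) :
    IsCompact (closure (range Ubar)) := by
  obtain ⟨C, hC⟩ := exists_bound_of_tendsto h.smooth.continuous h.tendsto_left h.tendsto_right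
  refine Metric.isCompact_of_isClosed_isBounded isClosed_closure (Bornology.IsBounded.closure ?_)
  exact (Metric.isBounded_closedBall (x := (0 : StateSpace N)) (r := C)).subset
    (range_subset_iff.2 fun x => by simpa using hC x)

theorem closure_range_subset (h : IsProfile 𝒰 A q Ubar Um Up) : closure (range Ubar) ⊆ 𝒰 := by
  intro u hu
  rcases mem_closure_range_of_tendsto h.smooth.continuous h.tendsto_left h.tendsto_right hu with
    ⟨x, rfl⟩ | rfl | rfl
  · exact h.mem x
  · exact h.left_mem
  · exact h.right_mem

/-- The profile lies in a tube on which the system is hyperbolic. -/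
theorem exists_isHyperbolicTube (h : IsProfile 𝒰 A q Ubar Um Up) (hAq : SmoothCoefficients 𝒰 A q)
    (hhyp : StrictlyHyperbolicNonchar A Ubar) (hm : HighFrequencyStable A q Um)
    (hp : HighFrequencyStable A q Up) : ∃ Kc r σ c₀ κ,
      IsHyperbolicTube (traceCLM N) (hyperbolicSet 𝒰 A) Kc r Ubar (coeffOp A) q
        (fun j u => eigenvalueTuple A u j) (spectralProj A) σ c₀ κ := by
  obtain ⟨c, hc, hev⟩ := hhyp
  have hO := isOpen_hyperbolicSet hAq.isOpen hAq.smooth_A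
  have hsub : closure (range Ubar) ⊆ hyperbolicSet 𝒰 A := fun u hu => by
    obtain ⟨ev, hmono, hj⟩ := hev u hu
    exact ⟨h.closure_range_subset hu, ev, isSpectralTuple_of_hasEigenvalue hmono fun j => (hj j).1⟩
  have hlow : ∀ u ∈ closure (range Ubar), ∀ j, c ≤ |eigenvalueTuple A u j| := fun u hu j => by
    obtain ⟨ev, hmono, hj⟩ := hev u hu
    rw [(isSpectralTuple_eigenvalueTuple (hsub hu)).unique
      (isSpectralTuple_of_hasEigenvalue hmono fun j => (hj j).1)]
    exact (hj j).2
  have hmem : ∀ x, Ubar x ∈ closure (range Ubar) := fun x => subset_closure (mem_range_self x)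
  have hK := h.isCompact_closure_range
  -- Compactness of the closure of the profile gives one radius for all its points.
  obtain ⟨r, hr, hrsub⟩ := hK.exists_cthickening_subset_open hO hsub
  have hl := contDiffOn_eigenvalueTuple hAq.isOpen hAq.smooth_A
  have hP := contDiffOn_spectralProj hAq.isOpen hAq.smooth_A
  have hq : ContDiffOn ℝ ∞ q (hyperbolicSet 𝒰 A) := hAq.smooth_q.mono fun u hu => hu.1
  choose σ hσ hσl using fun j => exists_sign
    (continuousOn_univ.1 ((hl j).continuousOn.comp h.smooth.continuous.continuousOn
      fun x _ => hsub (hmem x))) hc (fun x => hlow _ (hmem x) j)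
  have hUm : Um ∈ hyperbolicSet 𝒰 A :=
    hsub (mem_closure_of_tendsto h.tendsto_left (Eventually.of_forall mem_range_self))
  have hUp : Up ∈ hyperbolicSet 𝒰 A :=
    hsub (mem_closure_of_tendsto h.tendsto_right (Eventually.of_forall mem_range_self))
  obtain ⟨cm, hcm, hm'⟩ := traceCLM_le_of_highFrequencyStable hUm hm
  obtain ⟨cp, hcp, hp'⟩ := traceCLM_le_of_highFrequencyStable hUp hp
  have hPc : ∀ j, ∀ u ∈ hyperbolicSet 𝒰 A, ContinuousAt (spectralProj A j) u := fun j u hu =>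
    (hP j).continuousOn.continuousAt (hO.mem_nhds hu)
  have hqc : ∀ u ∈ hyperbolicSet 𝒰 A, ContinuousAt (fderiv ℝ q) u := fun u hu =>
    (contDiffOn_fderiv hO hq).continuousOn.continuousAt (hO.mem_nhds hu)
  -- Half of the smaller stability constant leaves room for the trace inequality to pass from the
  -- end-states to neighbourhoods of infinity.
  refine ⟨Metric.cthickening r (closure (range Ubar)), r, σ, c, min cm cp / 2, ?_⟩
  exact
    { tube :=
        { isOpen := hO
          isCompact := hK.cthickening
          subset := hrsub
          pos := hr
          closedBall_subset := fun x => Metric.closedBall_subset_cthickening (hmem x) r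
          smooth := h.smooth
          bdd := h.exists_bound
          tendsto := fun k hk => h.tendsto_iteratedDeriv hk }
      smooth_A := (contDiffOn_coeffOp hAq.smooth_A).mono fun u hu => hu.1
      smooth_q := hq
      smooth_l := hl
      smooth_P := hP
      frame := fun u hu => isSpectralFrame_spectralProj hu
      stationary := fun x => by
        rw [coeffOp_apply, jet, iteratedDeriv_one]
        exact h.stationary x
      pos := hc
      damping_pos := half_pos (lt_min hcm hcp)
      sign := hσ
      speed := fun j x => hσl j x
      damping := fun j => by
        rw [cocompact_eq_atBot_atTop, eventually_sup]
        have h1 : min cm cp / 2 < min cm cp := half_lt_self (lt_min hcm hcp)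
        exact ⟨eventually_trace_mul_le _ h.tendsto_left (hPc j _ hUm) (hqc _ hUm) (hm' j)
            (h1.trans_le (min_le_left _ _)),
          eventually_trace_mul_le _ h.tendsto_right (hPc j _ hUp) (hqc _ hUp) (hp' j)
            (h1.trans_le (min_le_right _ _))⟩ }

end IsProfile

end ProfileTube

/-! ### Extended-valued norms and the moving frame -/

section Translation

variable {N : ℕ} {𝒰 : Set (StateSpace N)} {A : StateSpace N → Matrix (Fin N) (Fin N) ℝ}
  {q : StateSpace N → StateSpace N} {Ubar : ℝ → StateSpace N} {Um Up : StateSpace N}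
  {T ε : ℝ} {V : ℝ → ℝ → StateSpace N} {δ : ℝ → ℝ}

theorem enorm_iteratedDeriv_le_cbNorm {K k : ℕ} (hk : k ≤ K) (f : ℝ → StateSpace N) (x : ℝ) :
    ‖iteratedDeriv k f x‖ₑ ≤ cbNorm K f :=
  le_iSup_of_le k (le_iSup_of_le hk (le_iSup (fun x => ‖iteratedDeriv k f x‖ₑ) x))

theorem cbNorm_mono {K L : ℕ} (h : K ≤ L) (f : ℝ → StateSpace N) : cbNorm K f ≤ cbNorm L f :=
  iSup_le fun _ => iSup_le fun hk => iSup_le fun x =>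
    enorm_iteratedDeriv_le_cbNorm (hk.trans h) f x

theorem cbNorm_zero_eq (f : ℝ → StateSpace N) : cbNorm 0 f = ⨆ x, ‖f x‖ₑ := by
  simp [cbNorm]

theorem norm_iteratedDeriv_le_of_cbNorm_le {K k : ℕ} (hk : k ≤ K) {f : ℝ → StateSpace N} {a : ℝ}
    (ha : 0 ≤ a) (h : cbNorm K f ≤ ENNReal.ofReal a) (x : ℝ) : ‖iteratedDeriv k f x‖ ≤ a := by
  have h1 := (enorm_iteratedDeriv_le_cbNorm hk f x).trans h
  rwa [← ofReal_norm, ENNReal.ofReal_le_ofReal_iff ha] at h1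

theorem IsSmoothSolution.iteratedDeriv_shiftedPerturbation (hV : IsSmoothSolution 𝒰 A q T V)
    (hU : ContDiff ℝ ∞ Ubar) {t : ℝ} (ht : t ∈ Icc 0 T) (k : ℕ) (x : ℝ) :
    iteratedDeriv k (shiftedPerturbation V Ubar δ t) x =
      jet (V t) (x + δ t) k - jet Ubar x k := by
  have hVt : ContDiff ℝ ∞ (V t) := contDiff_slice hV.smooth ht
  have h1 : ContDiff ℝ ∞ fun x => V t (x + δ t) := hVt.comp (by fun_prop)
  have h2 : shiftedPerturbation V Ubar δ t = (fun x => V t (x + δ t)) - Ubar := rfl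
  have hk : (k : WithTop ℕ∞) ≤ (∞ : WithTop ℕ∞) := by exact_mod_cast le_top
  rw [h2, iteratedDeriv_sub (h1.of_le hk).contDiffAt (hU.of_le hk).contDiffAt,
    iteratedDeriv_comp_add_const]
  rfl

theorem IsSmoothSolution.norm_jet_sub_le (hV : IsSmoothSolution 𝒰 A q T V)
    (hU : ContDiff ℝ ∞ Ubar) {t : ℝ} (ht : t ∈ Icc 0 T) {K k : ℕ} (hk : k ≤ K) {a : ℝ}
    (ha : 0 ≤ a) (h : cbNorm K (shiftedPerturbation V Ubar δ t) ≤ ENNReal.ofReal a) (y : ℝ) :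
    ‖jet (V t) y k - jet Ubar (y - δ t) k‖ ≤ a := by
  have h1 := norm_iteratedDeriv_le_of_cbNorm_le hk ha h (y - δ t)
  rwa [hV.iteratedDeriv_shiftedPerturbation hU ht, sub_add_cancel] at h1

theorem IsSmoothSolution.isPerturbedSolution (hV : IsSmoothSolution 𝒰 A q T V)
    (hU : ContDiff ℝ ∞ Ubar) (hT : 0 < T) (hε : 0 ≤ ε) (hδ : ContDiffOn ℝ 1 δ (Icc 0 T))
    (hδε : ∀ t ∈ Icc 0 T, |derivWithin δ (Icc 0 T) t| ≤ ε)
    (hVε : ∀ t ∈ Icc 0 T, cbNorm 1 (shiftedPerturbation V Ubar δ t) ≤ ENNReal.ofReal ε) :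
    IsPerturbedSolution Ubar (coeffOp A) q T ε V δ (derivWithin δ (Icc 0 T)) where
  pos := hT
  smooth := hV.smooth
  eqn t ht x := hV.eqn t ht x
  continuousOn_shift := hδ.continuousOn
  hasDerivAt_shift t ht := ((hδ.differentiableOn (by simp) t
    (Ioo_subset_Icc_self ht)).hasDerivWithinAt).hasDerivAt (Icc_mem_nhds ht.1 ht.2)
  shift_le := hδε
  zero_le t ht := hV.norm_jet_sub_le hU ht zero_le_one hε (hVε t ht)
  one_le t ht := hV.norm_jet_sub_le hU ht le_rfl hε (hVε t ht)

/-- A supremum of uncountably many continuous functions of time is still lower semicontinuous, hence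
measurable. Projecting time to `[0,T]` makes these functions continuous on the whole line. -/
theorem IsSmoothSolution.measurable_cbNorm_zero (hV : IsSmoothSolution 𝒰 A q T V)
    (hT : 0 ≤ T) (hδ : ContinuousOn δ (Icc 0 T)) :
    Measurable fun s => cbNorm 0 (shiftedPerturbation V Ubar δ (projIcc 0 T hT s)) := by
  have hp : Continuous fun s => ((projIcc 0 T hT s : Icc 0 T) : ℝ) :=
    continuous_subtype_val.comp continuous_projIcc
  have hmem : ∀ s, ((projIcc 0 T hT s : Icc 0 T) : ℝ) ∈ Icc 0 T := fun s => (projIcc 0 T hT s).2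
  simp only [cbNorm_zero_eq]
  refine (lowerSemicontinuous_iSup fun x => Continuous.lowerSemicontinuous ?_).measurable
  have h1 : Continuous fun s => V (projIcc 0 T hT s) (x + δ (projIcc 0 T hT s)) :=
    hV.smooth.continuousOn.comp_continuous
      (hp.prodMk (continuous_const.add (hδ.comp_continuous hp hmem)))
      fun s => ⟨hmem s, mem_univ _⟩
  exact (h1.sub continuous_const).enorm

/-- The sum of the size of the perturbation and of the speed of the shift, extended by constants
outside `[0,T]`. -/
noncomputable def driver (V : ℝ → ℝ → StateSpace N) (Ubar : ℝ → StateSpace N) (δ : ℝ → ℝ) {T : ℝ}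
    (hT : 0 ≤ T) (s : ℝ) : ℝ :=
  (cbNorm 0 (shiftedPerturbation V Ubar δ (projIcc 0 T hT s))).toReal +
    |derivWithin δ (Icc 0 T) (projIcc 0 T hT s)|

theorem IsSmoothSolution.isDriver (hV : IsSmoothSolution 𝒰 A q T V)
    (hU : ContDiff ℝ ∞ Ubar) (hT : 0 < T) (hε : 0 ≤ ε) (hδ : ContDiffOn ℝ 1 δ (Icc 0 T))
    (hδε : ∀ t ∈ Icc 0 T, |derivWithin δ (Icc 0 T) t| ≤ ε)
    (hVε : ∀ t ∈ Icc 0 T, cbNorm 1 (shiftedPerturbation V Ubar δ t) ≤ ENNReal.ofReal ε) :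
    IsDriver Ubar T V δ (derivWithin δ (Icc 0 T)) (driver V Ubar δ hT.le) := by
  have hmem : ∀ s, ((projIcc 0 T hT.le s : Icc 0 T) : ℝ) ∈ Icc 0 T := fun s => (projIcc 0 T _ s).2
  have hle : ∀ t ∈ Icc 0 T, cbNorm 0 (shiftedPerturbation V Ubar δ t) ≤ ENNReal.ofReal ε :=
    fun t ht => (cbNorm_mono zero_le_one _).trans (hVε t ht)
  have hfin : ∀ t ∈ Icc 0 T, cbNorm 0 (shiftedPerturbation V Ubar δ t) ≠ ⊤ := fun t ht =>
    ne_top_of_le_ne_top ENNReal.ofReal_ne_top (hle t ht)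
  have hp : Continuous fun s => ((projIcc 0 T hT.le s : Icc 0 T) : ℝ) :=
    continuous_subtype_val.comp continuous_projIcc
  have hδ' : Continuous fun s => derivWithin δ (Icc 0 T) (projIcc 0 T hT.le s) :=
    (hδ.continuousOn_derivWithin (uniqueDiffOn_Icc hT) le_rfl).comp_continuous hp hmem
  have hnonneg : ∀ s, 0 ≤ driver V Ubar δ hT.le s := fun s =>
    add_nonneg ENNReal.toReal_nonneg (abs_nonneg _)
  refine ⟨?_, hnonneg, fun s hs y => ?_, fun s hs => ?_⟩
  · have hmeas : Measurable (driver V Ubar δ hT.le) :=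
      (hV.measurable_cbNorm_zero hT.le hδ.continuousOn).ennreal_toReal.add
        hδ'.abs.measurable
    refine Integrable.of_bound hmeas.aestronglyMeasurable (ε + ε) (ae_of_all _ fun s => ?_)
    rw [Real.norm_of_nonneg (hnonneg s)]
    exact add_le_add (ENNReal.toReal_le_of_le_ofReal hε (hle _ (hmem s))) (hδε _ (hmem s))
  · have h1 := hV.norm_jet_sub_le (δ := δ) (K := 0) hU hs le_rfl ENNReal.toReal_nonneg
      (ENNReal.ofReal_toReal (hfin s hs)).ge y
    refine h1.trans ?_
    rw [driver, projIcc_of_mem hT.le hs]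
    exact le_add_of_nonneg_right (abs_nonneg _)
  · rw [driver, projIcc_of_mem hT.le hs]
    exact le_add_of_nonneg_left ENNReal.toReal_nonneg

/-- The decaying prefactor is moved inside the integral, where it becomes `e^(-θ (t - s))`;
nonnegativity permits the passage to the lower integral. -/
theorem ofReal_mul_expHistory {θ a C t T : ℝ} {g : ℝ → ℝ} (hC : 0 ≤ C) (ha : 0 ≤ a)
    (hg : IntegrableOn g (Icc 0 T)) (hg0 : ∀ s, 0 ≤ g s) (ht : t ∈ Icc 0 T) :
    ENNReal.ofReal (C * expHistory θ a g t) =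
      ENNReal.ofReal (C * Real.exp (-θ * t)) * ENNReal.ofReal a +
        ENNReal.ofReal C *
          ∫⁻ s in Icc 0 t, ENNReal.ofReal (Real.exp (-θ * (t - s))) * ENNReal.ofReal (g s) := by
  have hgt : IntegrableOn g (Icc 0 t) := hg.mono_set (Icc_subset_Icc le_rfl ht.2)
  have hint : IntegrableOn (fun s => Real.exp (-θ * (t - s)) * g s) (Icc 0 t) :=
    hgt.continuousOn_mul (by fun_prop) isCompact_Icc
  have hnn : ∀ s, 0 ≤ Real.exp (-θ * (t - s)) * g s := fun s =>
    mul_nonneg (Real.exp_pos _).le (hg0 s)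
  have h1 : ∫ s in Icc 0 t, Real.exp (-θ * (t - s)) * g s =
      Real.exp (-θ * t) * ∫ s in 0..t, Real.exp (θ * s) * g s := by
    rw [intervalIntegral.integral_of_le ht.1, ← integral_Icc_eq_integral_Ioc,
      ← integral_const_mul]
    congr 1 with s
    rw [← mul_assoc, ← Real.exp_add]
    ring_nf
  have h2 : C * expHistory θ a g t =
      C * Real.exp (-θ * t) * a + C * ∫ s in Icc 0 t, Real.exp (-θ * (t - s)) * g s := by
    rw [h1, expHistory]; ring
  have h3 : 0 ≤ ∫ s in Icc 0 t, Real.exp (-θ * (t - s)) * g s := integral_nonneg hnn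
  rw [h2, ENNReal.ofReal_add (by positivity) (by positivity), ENNReal.ofReal_mul' ha,
    ENNReal.ofReal_mul (p := C) (q := ∫ s in Icc 0 t, Real.exp (-θ * (t - s)) * g s) hC,
    ofReal_integral_eq_lintegral_ofReal hint (ae_of_all _ hnn)]
  congr 3 with s
  exact ENNReal.ofReal_mul (Real.exp_pos _).le

end Translation

/-! ### Conclusion -/

theorem exists_norm_disp_le_of_profile {N : ℕ} {𝒰 : Set (StateSpace N)}
    {A : StateSpace N → Matrix (Fin N) (Fin N) ℝ} {q : StateSpace N → StateSpace N}
    (hAq : SmoothCoefficients 𝒰 A q) {Ubar : ℝ → StateSpace N} {Um Up : StateSpace N}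
    (hprofile : IsProfile 𝒰 A q Ubar Um Up) (hhyp : StrictlyHyperbolicNonchar A Ubar)
    (hstab_left : HighFrequencyStable A q Um) (hstab_right : HighFrequencyStable A q Up) (K : ℕ) :
    ∃ C ε θ : ℝ, 0 < C ∧ 0 < ε ∧ 0 < θ ∧
      ∀ {T : ℝ} {V : ℝ → ℝ → StateSpace N} {δ δ' g : ℝ → ℝ} {a : ℝ},
      IsPerturbedSolution Ubar (coeffOp A) q T ε V δ δ' → IsDriver Ubar T V δ δ' g → 0 < a →
      (∀ k ≤ K, ∀ y, ‖jet (V 0) y k - jet Ubar (y - δ 0) k‖ ≤ a) → ∀ t ∈ Icc 0 T, ∀ k ≤ K, ∀ y,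
        ‖jet (V t) y k - jet Ubar (y - δ t) k‖ ≤ C * expHistory θ a g t := by
  obtain ⟨Kc, r, σ, c₀, κ, hh⟩ :=
    hprofile.exists_isHyperbolicTube hAq hhyp hstab_left hstab_right
  obtain ⟨R, hR, hRd⟩ := exists_prolongation hh.tube.isOpen hh.smooth_q hh.smooth_A
  have hΦ : IsJetFlux (hyperbolicSet 𝒰 A) (coeffOp A) q (prolongation q R) := ⟨fun _ => rfl, hRd⟩
  have hθ : 0 < κ / 4 := div_pos hh.damping_pos four_pos
  obtain ⟨C, ε, hC, hε, h⟩ : ∃ C ε : ℝ, 0 ≤ C ∧ 0 < ε ∧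
      ∀ {T : ℝ} {V : ℝ → ℝ → StateSpace N} {δ δ' g : ℝ → ℝ} {a : ℝ},
      IsPerturbedSolution Ubar (coeffOp A) q T ε V δ δ' → IsDriver Ubar T V δ δ' g → 0 < a →
      (∀ k ≤ K, ∀ y, ‖jet (V 0) y k - jet Ubar (y - δ 0) k‖ ≤ a) → ∀ t ∈ Icc 0 T, ∀ k ≤ K, ∀ y,
        ‖jet (V t) y k - jet Ubar (y - δ t) k‖ ≤ C * expHistory (κ / 4) a g t := by
    -- The top-order argument needs a derivative below the top one; `K = 0` is the estimate without
    -- damping.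
    rcases Nat.eq_zero_or_pos K with rfl | hK
    · obtain ⟨C, hC, h⟩ := exists_norm_disp_zero_le hh hΦ hθ
      refine ⟨C, min r 1, hC, lt_min hh.tube.pos one_pos, ?_⟩
      intro T V δ δ' g a hsol hg ha h0 t ht k hk y
      obtain rfl := Nat.le_zero.1 hk
      exact h hsol (min_le_left _ _) (min_le_right _ _) hg ha.le (h0 0 le_rfl) t ht y
    · obtain ⟨C, ε, hC, hε, -, -, h⟩ := exists_norm_disp_le hh hΦ hK fun C₀ hC₀ =>
        JetConfig.exists_flux_estimate hh.tube hh.smooth_q hR hK hC₀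
      exact ⟨C, ε, hC, hε, h⟩
  refine ⟨C + 1, ε, κ / 4, by positivity, hε, hθ, ?_⟩
  intro T V δ δ' g a hsol hg ha h0 t ht k hk y
  refine (h hsol hg ha h0 t ht k hk y).trans (mul_le_mul_of_nonneg_right (by linarith) ?_)
  exact expHistory_nonneg ha.le hg.integrable hg.nonneg ht.1 ht.2

theorem theorem1 {N : ℕ} (𝒰 : Set (StateSpace N))
    (A : StateSpace N → Matrix (Fin N) (Fin N) ℝ) (q : StateSpace N → StateSpace N)
    (hAq : SmoothCoefficients 𝒰 A q)
    (Ubar : ℝ → StateSpace N) (Um Up : StateSpace N)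
    (hprofile : IsProfile 𝒰 A q Ubar Um Up)
    (hhyp : StrictlyHyperbolicNonchar A Ubar)
    (hstab_left : HighFrequencyStable A q Um) (hstab_right : HighFrequencyStable A q Up)
    (K : ℕ) :
    ∃ C ε θ : ℝ, 0 < C ∧ 0 < ε ∧ 0 < θ ∧
      ∀ T : ℝ, 0 < T →
      ∀ V : ℝ → ℝ → StateSpace N, IsSmoothSolution 𝒰 A q T V →
      ∀ δ : ℝ → ℝ, ContDiffOn ℝ 1 δ (Icc 0 T) →
        (∀ t ∈ Icc 0 T, |derivWithin δ (Icc 0 T) t| ≤ ε) →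
        (∀ t ∈ Icc 0 T, cbNorm 1 (shiftedPerturbation V Ubar δ t) ≤ ENNReal.ofReal ε) →
        ∀ t ∈ Icc 0 T,
          cbNorm K (shiftedPerturbation V Ubar δ t) ≤
            ENNReal.ofReal (C * Real.exp (-θ * t)) * cbNorm K (shiftedPerturbation V Ubar δ 0)
            + ENNReal.ofReal C *
              ∫⁻ s in Icc 0 t, ENNReal.ofReal (Real.exp (-θ * (t - s))) *
                (cbNorm 0 (shiftedPerturbation V Ubar δ s)
                  + ENNReal.ofReal |derivWithin δ (Icc 0 T) s|) := by
  obtain ⟨C, ε, θ, hC, hε, hθ, hmain⟩ :=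
    exists_norm_disp_le_of_profile hAq hprofile hhyp hstab_left hstab_right K
  refine ⟨C, ε, θ, hC, hε, hθ, fun T hT V hV δ hδ hδε hVε t ht => ?_⟩
  -- If the initial norm is infinite, so is the right-hand side, because its coefficient is
  -- positive.
  by_cases htop : cbNorm K (shiftedPerturbation V Ubar δ 0) = ⊤
  · have hpos : 0 < C * Real.exp (-θ * t) := by positivity
    rw [htop, ENNReal.mul_top (ENNReal.ofReal_pos.2 hpos).ne', top_add]
    exact le_top
  have hU := hprofile.smooth
  have hsol := hV.isPerturbedSolution hU hT hε.le hδ hδε hVε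
  have hg := hV.isDriver hU hT hε.le hδ hδε hVε
  set g := driver V Ubar δ hT.le with hgdef
  set a := (cbNorm K (shiftedPerturbation V Ubar δ 0)).toReal with ha
  have ha0 : 0 ≤ a := ENNReal.toReal_nonneg
  have h0T : (0 : ℝ) ∈ Icc 0 T := left_mem_Icc.2 hT.le
  have hbound : ∀ k ≤ K, ∀ x, ‖iteratedDeriv k (shiftedPerturbation V Ubar δ t) x‖ ≤
      C * expHistory θ a g t := by
    intro k hk x
    -- The estimate requires a positive initial size, since the history occurs as a denominator. The
    -- size is enlarged by an amount that changes the final bound by exactly `η`.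
    refine le_of_forall_pos_le_add fun η hη => ?_
    have hb : 0 < C * Real.exp (-θ * t) := by positivity
    have hη' : 0 < η / (C * Real.exp (-θ * t)) := by positivity
    have h1 := hmain hsol hg (add_pos_of_nonneg_of_pos ha0 hη')
      (fun k hk y => (hV.norm_jet_sub_le hU h0T hk ha0
        (ENNReal.ofReal_toReal htop).ge y).trans (le_add_of_nonneg_right hη'.le)) t ht k hk (x + δ t)
    rw [add_sub_cancel_right, ← hV.iteratedDeriv_shiftedPerturbation hU ht] at h1
    refine h1.trans_eq ?_
    rw [expHistory, expHistory]
    field_simp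
    ring
  have hcb : cbNorm K (shiftedPerturbation V Ubar δ t) ≤
      ENNReal.ofReal (C * expHistory θ a g t) :=
    iSup_le fun k => iSup_le fun hk => iSup_le fun x => by
      rw [← ofReal_norm]
      exact ENNReal.ofReal_le_ofReal (hbound k hk x)
  rw [ofReal_mul_expHistory hC.le ha0 hg.integrable hg.nonneg ht, ha,
    ENNReal.ofReal_toReal htop] at hcb
  -- On `[0,t]` the driver coincides with the integrand of the claim, the norms there being finite.
  refine hcb.trans_eq ?_
  congr 2
  refine setLIntegral_congr_fun measurableSet_Icc fun s hs => ?_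
  have hsT : s ∈ Icc 0 T := ⟨hs.1, hs.2.trans ht.2⟩
  have hfin : cbNorm 0 (shiftedPerturbation V Ubar δ s) ≠ ⊤ :=
    ne_top_of_le_ne_top ENNReal.ofReal_ne_top ((cbNorm_mono zero_le_one _).trans (hVε s hsT))
  simp only [hgdef, driver]
  rw [projIcc_of_mem hT.le hsT, ENNReal.ofReal_add ENNReal.toReal_nonneg (abs_nonneg _),
    ENNReal.ofReal_toReal hfin]
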